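/- Let $D\subseteq\mathbb{C}$ be a domain (a non-empty connected open set), let $k\ge 1$ be an integer, and let $\mathcal F$ be a family of holomorphic functions on $D$ such that every zero in $D$ of every $f\in\mathcal F$ has multiplicity at least $k$ (the zeros of the identically zero function count as having infinite multiplicity). Let $a,b,\alpha_0,\alpha_1$ be holomorphic functions on $D$ such that for every $z\in D$ $$\alpha_0(z)\neq 0,\qquad b(z)\neq 0,\qquad a(z)\neq b(z),\qquad b(z)-\alpha_1(z)a(z)-\alpha_0(z)a^{(k)}(z)\neq 0 .$$ Suppose that for every $f\in\mathcal F$ and every $z\in D$: (i) $f(z)=a(z)$ if and only if $\alpha_0(z)f^{(k)}(z)+\alpha_1(z)f(z)=a(z)$; (ii) if $\alpha_0(z)f^{(k)}(z)+\alpha_1(z)f(z)=b(z)$, then $f(z)=b(z)$. Then $\mathcal F$ is normal in $D$; that is, every sequence in $\mathcal F$ has a subsequence which either converges uniformly on each compact subset of $D$ to a finite limit function, or tends to $\infty$ uniformly on each compact subset of $D$. -/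

import Mathlib

open Filter Topology

/-- A family `F` of functions is normal in `D` if every sequence in `F` has a subsequence which,
uniformly on each compact subset of `D`, converges to a (finite) limit function or tends to `∞`.
For holomorphic members and open `D` the finite limit is automatically holomorphic. -/
def IsNormalFamilyOn (F : Set (ℂ → ℂ)) (D : Set ℂ) : Prop :=
  ∀ u : ℕ → ℂ → ℂ, (∀ n, u n ∈ F) →
    ∃ φ : ℕ → ℕ, StrictMono φ ∧
      ((∃ g : ℂ → ℂ, ∀ K ⊆ D, IsCompact K →
          TendstoUniformlyOn (fun n => u (φ n)) g atTop K) ∨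
        (∀ K ⊆ D, IsCompact K → ∀ M : ℝ, ∀ᶠ n in atTop, ∀ z ∈ K, M ≤ ‖u (φ n) z‖))

/-!
Write `γ = α₁ / α₀` and `κ = 1 / α₀`, so that the sharing hypotheses read
`f = a ↔ f⁽ᵏ⁾ + γ f = κ a` and `f⁽ᵏ⁾ + γ f = κ b → f = b`. By Marty's theorem
(`exists_subseq_of_sphericallyBoundedAt`) it suffices to bound spherical derivatives locally, and
this is done by rescaling at points where they blow up.

The core is the criterion `sphericallyBoundedAt_of_iteratedDeriv_add_mul`: if the zeros of `f` have
multiplicity at least `k`, `|f⁽ᵏ⁾|` is bounded at these zeros, and `f⁽ᵏ⁾ + γ f = γ₂` forces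
`f = γ₃` with `γ₂, γ₃` zero-free, then spherical derivatives are locally bounded. Otherwise the
Zalcman–Pang lemma `exists_zalcman_rescaling` with exponent `k` produces an entire function `g` of
bounded spherical derivative. In this scaling the functions themselves tend to `0` while the values
`γ₃` do not, so by Hurwitz's theorem `g⁽ᵏ⁾` omits the value `B = γ₂ (x₀)` or is constant. As `g` has
exponential type, `g⁽ᵏ⁾ = B + exp (c z + d)`; the case `c ≠ 0` contradicts the bounded spherical
derivative (`not_iteratedDeriv_eq_const_add_exp`), and in the case `c = 0` the function `g` is
`m (z - z₁)ᵏ / k!` with `|m| ≤ A`, whose spherical derivative at `0` is too small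
(`norm_deriv_lt_of_iteratedDeriv_eq_const`).

For `k = 1` the criterion applies to `f - a`, whose derivative at its zeros is determined by the
sharing of `a`. For `k ≥ 2` it applies to `f` itself once `f⁽ᵏ⁾` is known to be bounded at the zeros
of `f`, which is `exists_norm_iteratedDeriv_le`. Suppose that `f n (z n) = 0`, `z n → z₀` and
`f n⁽ᵏ⁾ (z n) → ∞`, and let `a` vanish to order `m` at `z₀`. Rescale `f n` about `z n` at the
scale `σ n` at which `|f n|` first reaches `(|z n - z₀| + σ n) ^ m`, that is, the size of `a`. The
rescaled functions share, in the asymptotic sense of `QuasiSharing`, a target converging to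
`P = u₀ (l + μ ζ) ^ m`. Where `P ≠ 0` such sequences have bounded spherical derivatives
(`QuasiSharing.sphericallyBoundedAt`), because a Zalcman limit would be of the form
`q₀ + exp (c z + d)` and have simple zeros. By the maximum principle the zero of `P` is harmless,
so there is an entire limit `G`. It satisfies `G ≠ P` and `G⁽ᵏ⁾ ≠ 0` everywhere, and this is
refuted by blowing down (`false_of_blow_down`).
-/

namespace NormalFamilies

open Metric Set

/-! ### Locally uniform convergence of holomorphic functions -/

/-- `HolTendstoAt F g z`: near `z` the functions `F n` are eventually holomorphic and converge to
`g` locally uniformly. Local uniform convergence is expressed as continuous convergence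
(`F n w' → g w` as `n → ∞` and `w' → w`), which makes algebraic operations and evaluation at
moving points immediate. The index from which `F n` is holomorphic may depend on `z`, as is
needed for rescaled functions, whose domains only exhaust the plane. -/
def HolTendstoAt (F : ℕ → ℂ → ℂ) (g : ℂ → ℂ) (z : ℂ) : Prop :=
  ∃ r > 0, (∀ᶠ n in atTop, DifferentiableOn ℂ (F n) (ball z r)) ∧
    ∀ w ∈ ball z r, Tendsto (fun p : ℕ × ℂ => F p.1 p.2) (atTop ×ˢ 𝓝 w) (𝓝 (g w))

namespace HolTendstoAt

variable {F G : ℕ → ℂ → ℂ} {f g : ℂ → ℂ} {z : ℂ}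

theorem tendsto (h : HolTendstoAt F f z) :
    Tendsto (fun p : ℕ × ℂ => F p.1 p.2) (atTop ×ˢ 𝓝 z) (𝓝 (f z)) := by
  obtain ⟨r, hr, -, h2⟩ := h
  exact h2 z (mem_ball_self hr)

theorem tendsto_seq (h : HolTendstoAt F f z) {x : ℕ → ℂ} (hx : Tendsto x atTop (𝓝 z)) :
    Tendsto (fun n => F n (x n)) atTop (𝓝 (f z)) :=
  h.tendsto.comp (tendsto_id.prodMk hx)

theorem tendsto_seq_comp (h : HolTendstoAt F f z) {φ : ℕ → ℕ} (hφ : Tendsto φ atTop atTop)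
    {x : ℕ → ℂ} (hx : Tendsto x atTop (𝓝 z)) :
    Tendsto (fun n => F (φ n) (x n)) atTop (𝓝 (f z)) :=
  h.tendsto.comp (hφ.prodMk hx)

theorem tendsto_pt (h : HolTendstoAt F f z) : Tendsto (fun n => F n z) atTop (𝓝 (f z)) :=
  h.tendsto_seq tendsto_const_nhds

theorem eventually_nhds (h : HolTendstoAt F f z) : ∀ᶠ w in 𝓝 z, HolTendstoAt F f w := by
  obtain ⟨r, hr, h1, h2⟩ := h
  filter_upwards [isOpen_ball.mem_nhds (mem_ball_self hr)] with w hw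
  obtain ⟨s, hs, hsub⟩ := Metric.isOpen_ball.mem_nhds hw |> Metric.mem_nhds_iff.1
  exact ⟨s, hs, h1.mono fun n hn => hn.mono hsub, fun w' hw' => h2 w' (hsub hw')⟩

/-- Continuous convergence implies locally uniform convergence; no continuity of the members of the
sequence is needed. -/
theorem tendstoLocallyUniformlyOn_of_forall {U : Set ℂ}
    (h : ∀ w ∈ U, Tendsto (fun p : ℕ × ℂ => F p.1 p.2) (atTop ×ˢ 𝓝 w) (𝓝 (f w))) :
    TendstoLocallyUniformlyOn F f atTop U := by
  intro u hu w hw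
  obtain ⟨ε, hε, hεu⟩ := Metric.mem_uniformity_dist.1 hu
  have h1 := (Metric.tendsto_nhds.1 (h w hw)) (ε / 3) (by positivity)
  obtain ⟨pa, hpa, pb, hpb, hab⟩ := eventually_prod_iff.1 h1
  refine ⟨{y | pb y} ∩ U, inter_mem (mem_nhdsWithin_of_mem_nhds hpb) self_mem_nhdsWithin, ?_⟩
  filter_upwards [hpa] with n hn y hy
  apply hεu
  have h2 : Tendsto (fun m => F m y) atTop (𝓝 (f y)) :=
    (h y hy.2).comp (tendsto_id.prodMk tendsto_const_nhds)
  have h3 : dist (f y) (f w) ≤ ε / 3 := by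
    refine le_of_tendsto (h2.dist tendsto_const_nhds) ?_
    filter_upwards [hpa] with m hm using (hab hm hy.1).le
  have h4 := hab hn hy.1
  calc dist (f y) (F n y) ≤ dist (f y) (f w) + dist (F n y) (f w) := dist_triangle_right _ _ _
    _ < ε := by simp only at h4; linarith

theorem tendstoLocallyUniformlyOn {U : Set ℂ} (h : ∀ w ∈ U, HolTendstoAt F f w) :
    TendstoLocallyUniformlyOn F f atTop U :=
  tendstoLocallyUniformlyOn_of_forall fun w hw => (h w hw).tendsto

theorem of_tendstoLocallyUniformlyOn {r : ℝ} (hr : 0 < r)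
    (h1 : ∀ᶠ n in atTop, DifferentiableOn ℂ (F n) (ball z r))
    (h2 : TendstoLocallyUniformlyOn F f atTop (ball z r)) : HolTendstoAt F f z := by
  refine ⟨r, hr, h1, fun w hw => ?_⟩
  have hc : ContinuousAt f w :=
    ((h2.differentiableOn h1 isOpen_ball).differentiableAt (isOpen_ball.mem_nhds hw)).continuousAt
  rw [Metric.tendsto_nhds]
  intro ε hε
  obtain ⟨t, ht, h3⟩ := Metric.tendstoLocallyUniformlyOn_iff.1 h2 (ε / 2) (by positivity) w hw
  rw [isOpen_ball.nhdsWithin_eq hw] at ht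
  have h4 := (Metric.tendsto_nhds.1 hc) (ε / 2) (by positivity)
  filter_upwards [h3.prod_mk (inter_mem ht h4)] with p hp
  have h5 := hp.1 p.2 hp.2.1
  have h6 : dist (f p.2) (f w) < ε / 2 := hp.2.2
  calc dist (F p.1 p.2) (f w) ≤ dist (F p.1 p.2) (f p.2) + dist (f p.2) (f w) := dist_triangle _ _ _
    _ < ε := by rw [dist_comm]; linarith

theorem differentiableAt (h : HolTendstoAt F f z) : DifferentiableAt ℂ f z := by
  obtain ⟨r, hr, h1, h2⟩ := h
  exact ((tendstoLocallyUniformlyOn_of_forall h2).differentiableOn h1 isOpen_ball).differentiableAt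
    (isOpen_ball.mem_nhds (mem_ball_self hr))

theorem analyticAt (h : HolTendstoAt F f z) : AnalyticAt ℂ f z := by
  rw [Complex.analyticAt_iff_eventually_differentiableAt]
  exact h.eventually_nhds.mono fun w hw => hw.differentiableAt

theorem comp_tendsto (h : HolTendstoAt F f z) {φ : ℕ → ℕ} (hφ : Tendsto φ atTop atTop) :
    HolTendstoAt (fun n => F (φ n)) f z := by
  obtain ⟨r, hr, h1, h2⟩ := h
  exact ⟨r, hr, hφ.eventually h1, fun w hw =>
    (h2 w hw).comp ((hφ.comp tendsto_fst).prodMk tendsto_snd)⟩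

theorem congr_left (h : HolTendstoAt F f z) {r : ℝ} (hr : 0 < r)
    (hFG : ∀ᶠ n in atTop, EqOn (G n) (F n) (ball z r)) : HolTendstoAt G f z := by
  obtain ⟨s, hs, h1, h2⟩ := h
  refine ⟨min r s, lt_min hr hs, ?_, fun w hw => ?_⟩
  · filter_upwards [h1, hFG] with n hn hn'
    exact (hn.mono (ball_subset_ball (min_le_right _ _))).congr
      fun x hx => hn' (ball_subset_ball (min_le_left _ _) hx)
  · refine (h2 w (ball_subset_ball (min_le_right _ _) hw)).congr' ?_
    filter_upwards [hFG.prod_mk (isOpen_ball.mem_nhds (ball_subset_ball (min_le_left _ _) hw))]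
      with p hp using (hp.1 hp.2).symm

theorem congr_right (h : HolTendstoAt F f z) (hfg : ∀ᶠ w in 𝓝 z, g w = f w) :
    HolTendstoAt F g z := by
  obtain ⟨s, hs, h1, h2⟩ := h
  obtain ⟨r, hr, h3⟩ := Metric.eventually_nhds_iff_ball.1 hfg
  refine ⟨min r s, lt_min hr hs, ?_, fun w hw => ?_⟩
  · filter_upwards [h1] with n hn using hn.mono (ball_subset_ball (min_le_right _ _))
  · rw [h3 w (ball_subset_ball (min_le_left _ _) hw)]
    exact h2 w (ball_subset_ball (min_le_right _ _) hw)

/-- Holomorphic convergence is preserved by continuous binary operations that preserve holomorphy. -/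
theorem binop {op : ℂ → ℂ → ℂ} (hF : HolTendstoAt F f z) (hG : HolTendstoAt G g z)
    (hc : Continuous fun p : ℂ × ℂ => op p.1 p.2)
    (hd : ∀ (u v : ℂ → ℂ) (s : Set ℂ), DifferentiableOn ℂ u s → DifferentiableOn ℂ v s →
      DifferentiableOn ℂ (fun x => op (u x) (v x)) s) :
    HolTendstoAt (fun n x => op (F n x) (G n x)) (fun x => op (f x) (g x)) z := by
  obtain ⟨r, hr, h1, h2⟩ := hF
  obtain ⟨s, hs, h3, h4⟩ := hG
  refine ⟨min r s, lt_min hr hs, ?_, fun w hw => ?_⟩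
  · filter_upwards [h1, h3] with n hn hn'
    exact hd _ _ _ (hn.mono (ball_subset_ball (min_le_left _ _)))
      (hn'.mono (ball_subset_ball (min_le_right _ _)))
  · have := (h2 w (ball_subset_ball (min_le_left _ _) hw)).prodMk_nhds
      (h4 w (ball_subset_ball (min_le_right _ _) hw))
    exact (hc.tendsto _).comp this

theorem add (hF : HolTendstoAt F f z) (hG : HolTendstoAt G g z) :
    HolTendstoAt (fun n x => F n x + G n x) (fun x => f x + g x) z :=
  hF.binop hG continuous_add fun _ _ _ hu hv => hu.add hv

theorem sub (hF : HolTendstoAt F f z) (hG : HolTendstoAt G g z) :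
    HolTendstoAt (fun n x => F n x - G n x) (fun x => f x - g x) z :=
  hF.binop hG continuous_sub fun _ _ _ hu hv => hu.sub hv

theorem mul (hF : HolTendstoAt F f z) (hG : HolTendstoAt G g z) :
    HolTendstoAt (fun n x => F n x * G n x) (fun x => f x * g x) z :=
  hF.binop hG continuous_mul fun _ _ _ hu hv => hu.mul hv

theorem of_const_seq {c : ℕ → ℂ} {c₀ : ℂ} (hc : Tendsto c atTop (𝓝 c₀)) (z : ℂ) :
    HolTendstoAt (fun n _ => c n) (fun _ => c₀) z :=
  ⟨1, one_pos, .of_forall fun _ => differentiableOn_const _, fun _ _ => hc.comp tendsto_fst⟩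

theorem of_analyticAt (hf : AnalyticAt ℂ f z) : HolTendstoAt (fun _ => f) f z := by
  obtain ⟨r, hr, h⟩ := Metric.eventually_nhds_iff_ball.1
    (Complex.analyticAt_iff_eventually_differentiableAt.1 hf)
  exact ⟨r, hr, .of_forall fun _ x hx => (h x hx).differentiableWithinAt, fun w hw =>
    (h w hw).continuousAt.tendsto.comp tendsto_snd⟩

theorem affine {c d : ℕ → ℂ} {c₀ d₀ : ℂ} (hc : Tendsto c atTop (𝓝 c₀))
    (hd : Tendsto d atTop (𝓝 d₀)) (z : ℂ) :
    HolTendstoAt (fun n x => c n + d n * x) (fun x => c₀ + d₀ * x) z :=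
  (of_const_seq hc z).add ((of_const_seq hd z).mul (of_analyticAt analyticAt_id))

/-- Composition with a convergent sequence of holomorphic inner functions, combined with passage to
a subsequence of the outer functions. -/
theorem comp {A : ℕ → ℂ → ℂ} {A₀ : ℂ → ℂ} (hF : HolTendstoAt F f (A₀ z))
    (hA : HolTendstoAt A A₀ z) {φ : ℕ → ℕ} (hφ : Tendsto φ atTop atTop) :
    HolTendstoAt (fun n x => F (φ n) (A n x)) (fun x => f (A₀ x)) z := by
  obtain ⟨r, hr, h1, h2⟩ := hF
  obtain ⟨s, hs, h3, h4⟩ := id hA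
  have h5 := hA.tendsto.eventually (isOpen_ball.mem_nhds (mem_ball_self hr))
  obtain ⟨pa, hpa, pb, hpb, hab⟩ := eventually_prod_iff.1 h5
  obtain ⟨t, ht, h6⟩ := Metric.eventually_nhds_iff_ball.1
    (hpb.and (hA.differentiableAt.continuousAt.eventually
      (isOpen_ball.mem_nhds (mem_ball_self hr))))
  refine ⟨min s t, lt_min hs ht, ?_, fun w hw => ?_⟩
  · filter_upwards [hφ.eventually h1, h3, hpa] with n hn1 hn3 hna
    exact hn1.comp (hn3.mono (ball_subset_ball (min_le_left _ _)))
      fun x hx => hab hna (h6 x (ball_subset_ball (min_le_right _ _) hx)).1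
  · exact (h2 (A₀ w) (h6 w (ball_subset_ball (min_le_right _ _) hw)).2).comp
      ((hφ.comp tendsto_fst).prodMk (h4 w (ball_subset_ball (min_le_left _ _) hw)))

theorem deriv (h : HolTendstoAt F f z) :
    HolTendstoAt (fun n => deriv (F n)) (deriv f) z := by
  obtain ⟨r, hr, h1, h2⟩ := h
  exact of_tendstoLocallyUniformlyOn hr (h1.mono fun n hn => hn.deriv isOpen_ball)
    ((tendstoLocallyUniformlyOn_of_forall h2).deriv h1 isOpen_ball)

theorem iteratedDeriv (h : HolTendstoAt F f z) (k : ℕ) :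
    HolTendstoAt (fun n => iteratedDeriv k (F n)) (iteratedDeriv k f) z := by
  induction k with
  | zero => simpa using h
  | succ k ih => simpa only [iteratedDeriv_succ] using ih.deriv

/-- **Hurwitz's theorem**: zeros of a locally uniform limit that does not vanish identically are
limits of zeros of the approximating functions. -/
theorem exists_zeros (h : HolTendstoAt F f z) (hz : f z = 0) (hf : ¬ ∀ᶠ w in 𝓝 z, f w = 0) :
    ∃ (φ : ℕ → ℕ) (x : ℕ → ℂ), Tendsto φ atTop atTop ∧ Tendsto x atTop (𝓝 z) ∧
      ∀ j, F (φ j) (x j) = 0 := by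
  have key : ∀ ε > 0, ∀ᶠ n in atTop, ∃ x ∈ closedBall z ε, F n x = 0 := by
    intro ε hε
    obtain ⟨r, hr, h1, h2⟩ := id h
    have hne : ∀ᶠ w in 𝓝[≠] z, f w ≠ 0 :=
      (h.analyticAt.eventually_eq_zero_or_eventually_ne_zero).resolve_left hf
    rw [eventually_nhdsWithin_iff] at hne
    obtain ⟨s, hs, h3⟩ := Metric.eventually_nhds_iff_ball.1 hne
    obtain ⟨δ, hδ, hδ'⟩ : ∃ δ > 0, δ < min ε (min r s) :=
      ⟨_, half_pos (lt_min hε (lt_min hr hs)), half_lt_self (lt_min hε (lt_min hr hs))⟩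
    simp only [lt_min_iff] at hδ'
    have hcb : closedBall z δ ⊆ ball z r := closedBall_subset_ball hδ'.2.1
    have hfd : DifferentiableOn ℂ f (ball z r) :=
      (tendstoLocallyUniformlyOn_of_forall h2).differentiableOn h1 isOpen_ball
    have hfc : ContinuousOn f (sphere z δ) := hfd.continuousOn.mono
      (sphere_subset_closedBall.trans hcb)
    obtain ⟨w₀, hw₀, hmin⟩ := (isCompact_sphere z δ).exists_isMinOn
      (NormedSpace.sphere_nonempty.2 hδ.le) hfc.norm
    -- `m` is the minimum of `|f|` on a circle around `z` free of other zeros; once `F n` is within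
    -- `m / 8` of `f` there, the quantitative open mapping theorem puts `0` in the image of `F n`
    have hm : 0 < ‖f w₀‖ := by
      refine norm_pos_iff.2 (h3 w₀ ?_ ?_)
      · exact (closedBall_subset_ball hδ'.2.2) (sphere_subset_closedBall hw₀)
      · rintro rfl
        simp [hδ.ne] at hw₀
    set m := ‖f w₀‖
    have hu : TendstoUniformlyOn F f atTop (closedBall z δ) :=
      (tendstoLocallyUniformlyOn_iff_forall_isCompact isOpen_ball).1
        (tendstoLocallyUniformlyOn_of_forall h2) _ hcb (isCompact_closedBall z δ)
    filter_upwards [h1, Metric.tendstoUniformlyOn_iff.1 hu (m / 8) (by positivity)] with n hn hn2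
    have hz0 : ‖F n z‖ < m / 8 := by
      have := hn2 z (mem_closedBall_self hδ.le)
      rwa [hz, dist_zero_left] at this
    have hlow : ∀ w ∈ sphere z δ, m * (3 / 4) ≤ ‖F n w - F n z‖ := by
      intro w hw
      have a1 := hn2 w (sphere_subset_closedBall hw)
      have a2 : m ≤ ‖f w‖ := hmin hw
      rw [dist_eq_norm] at a1
      have a3 := norm_sub_norm_le (f w) (f w - F n w)
      have a4 := norm_sub_norm_le (F n w) (F n z)
      rw [sub_sub_cancel] at a3
      linarith
    have hdc : DiffContOnCl ℂ (F n) (ball z δ) :=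
      (hn.mono hcb).diffContOnCl_ball subset_rfl
    have hfreq : ∃ᶠ w in 𝓝 z, F n w ≠ F n z := by
      intro hev
      simp only [not_not] at hev
      have heq : EqOn (F n) (fun _ => F n z) (ball z r) :=
        (hn.analyticOnNhd isOpen_ball).eqOn_of_preconnected_of_eventuallyEq
          analyticOnNhd_const (convex_ball z r).isPreconnected (mem_ball_self hr) hev
      have := hlow w₀ hw₀
      rw [heq (hcb (sphere_subset_closedBall hw₀))] at this
      simp at this
      linarith
    have himg := hdc.ball_subset_image_closedBall hδ hlow hfreq
    obtain ⟨x, hx, hx0⟩ := himg (show (0 : ℂ) ∈ ball (F n z) (m * (3 / 4) / 2) by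
      rw [mem_ball, dist_zero_left]; linarith)
    exact ⟨x, closedBall_subset_closedBall hδ'.1.le hx, hx0⟩
  have key' : ∀ j : ℕ, ∃ n ≥ j, ∃ x ∈ closedBall z (1 / ((j : ℝ) + 1)), F n x = 0 := fun j =>
    ((eventually_ge_atTop j).and (key _ (by positivity))).exists
  choose φ hφ x hx hx0 using key'
  refine ⟨φ, x, tendsto_atTop_mono hφ tendsto_id, ?_, hx0⟩
  exact tendsto_iff_dist_tendsto_zero.2 (squeeze_zero (fun _ => dist_nonneg) hx
    tendsto_one_div_add_atTop_nhds_zero_nat)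

end HolTendstoAt

/-- No differentiability is required: for `d ≠ 0` both sides involve the same junk values, and for
`d = 0` the function on the left is constant. -/
theorem iteratedDeriv_comp_affine (k : ℕ) (f : ℂ → ℂ) (c d z : ℂ) :
    iteratedDeriv k (fun x => f (c + d * x)) z = d ^ k * iteratedDeriv k f (c + d * z) := by
  induction k generalizing z with
  | zero => simp
  | succ k ih =>
    have h1 : iteratedDeriv k (fun x => f (c + d * x)) =
        fun z => d ^ k * iteratedDeriv k f (c + d * z) := funext ih
    rw [iteratedDeriv_succ, h1, deriv_const_mul_field, iteratedDeriv_succ]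
    have h2 : deriv (fun x => iteratedDeriv k f (c + d * x)) z =
        d * deriv (iteratedDeriv k f) (c + d * z) := by
      have := deriv_comp_mul_left d (fun y => iteratedDeriv k f (c + y)) z
      rw [this, deriv_comp_const_add, smul_eq_mul]
    rw [h2]
    ring

theorem deriv_comp_affine (f : ℂ → ℂ) (c d z : ℂ) :
    deriv (fun x => f (c + d * x)) z = d * deriv f (c + d * z) := by
  simpa using iteratedDeriv_comp_affine 1 f c d z

/-! ### Spherical derivatives and Marty's theorem -/

/-- `SphericallyBoundedAt F z`: near `z` the functions `F n` are eventually holomorphic, with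
uniformly bounded spherical derivatives `‖F n'‖ / (1 + ‖F n‖ ^ 2)`. -/
def SphericallyBoundedAt (F : ℕ → ℂ → ℂ) (z : ℂ) : Prop :=
  ∃ r > 0, ∃ M : ℝ, ∀ᶠ n in atTop, DifferentiableOn ℂ (F n) (ball z r) ∧
    ∀ w ∈ ball z r, ‖deriv (F n) w‖ ≤ M * (1 + ‖F n w‖ ^ 2)

/-- The functions `F n` tend to `∞` uniformly near `z`. -/
def TendstoInftyAt (F : ℕ → ℂ → ℂ) (z : ℂ) : Prop :=
  ∃ r > 0, ∀ M : ℝ, ∀ᶠ n in atTop, ∀ w ∈ ball z r, M ≤ ‖F n w‖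

theorem tendsto_pt_of_tendsto_prod {X : Type*} {S : ℕ → ℂ → X} {z : ℂ} {l : Filter X}
    (h : Tendsto (fun p : ℕ × ℂ => S p.1 p.2) (atTop ×ˢ 𝓝 z) l) :
    Tendsto (fun n => S n z) atTop l :=
  h.comp (tendsto_id.prodMk tendsto_const_nhds)

/-- A diagonal argument: a locally equi-Lipschitz sequence with values in a compact set has a
locally uniformly convergent subsequence. -/
theorem exists_subseq_tendsto_of_lipschitz {X : Type*} [MetricSpace X] {Q : Set X}
    (hQ : IsCompact Q) (S : ℕ → ℂ → X) (hS : ∀ n w, S n w ∈ Q) (U : Set ℂ)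
    (hL : ∀ z ∈ U, ∃ r > 0, ∃ M : ℝ, ∀ᶠ n in atTop, ∀ w ∈ ball z r, ∀ w' ∈ ball z r,
      dist (S n w) (S n w') ≤ M * dist w w') :
    ∃ φ : ℕ → ℕ, StrictMono φ ∧ ∃ T : ℂ → X, ∀ z ∈ U,
      Tendsto (fun p : ℕ × ℂ => S (φ p.1) p.2) (atTop ×ˢ 𝓝 z) (𝓝 (T z)) := by
  classical
  set d := TopologicalSpace.denseSeq ℂ
  have hc : IsCompact (Set.pi Set.univ fun _ : ℕ => Q) := isCompact_univ_pi fun _ => hQ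
  obtain ⟨L, -, φ, hφ, hlim⟩ := hc.tendsto_subseq (x := fun n i => S n (d i))
    (fun n i _ => hS n _)
  rw [tendsto_pi_nhds] at hlim
  -- convergence on a dense sequence spreads to all of `U` by the Lipschitz bounds
  have hpt : ∀ z ∈ U, ∃ t, Tendsto (fun n => S (φ n) z) atTop (𝓝 t) := by
    intro z hz
    obtain ⟨r, hr, M, hM⟩ := hL z hz
    have hcau : CauchySeq fun n => S (φ n) z := by
      rw [Metric.cauchySeq_iff]
      intro ε hε
      have hδ : 0 < min r (ε / (3 * (|M| + 1))) := lt_min hr (by positivity)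
      obtain ⟨i, hi⟩ := (TopologicalSpace.denseRange_denseSeq ℂ).exists_dist_lt z hδ
      have hi' := lt_min_iff.1 hi
      have h1 : M * dist z (d i) < ε / 3 := by
        have h2 : dist z (d i) * (3 * (|M| + 1)) < ε := (lt_div_iff₀ (by positivity)).1 hi'.2
        have h3 : M * dist z (d i) ≤ |M| * dist z (d i) :=
          mul_le_mul_of_nonneg_right (le_abs_self M) dist_nonneg
        have h4 : 0 ≤ dist z (d i) := dist_nonneg
        linarith
      obtain ⟨N, hN⟩ := Metric.cauchySeq_iff.1 (hlim i).cauchySeq (ε / 3) (by positivity)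
      obtain ⟨N', hN'⟩ := eventually_atTop.1 (hφ.tendsto_atTop.eventually hM)
      refine ⟨max N N', fun m hm n hn => ?_⟩
      have hmem : d i ∈ ball z r := by rw [mem_ball, dist_comm]; exact hi'.1
      have a1 := hN' m (le_of_max_le_right hm) z (mem_ball_self hr) _ hmem
      have a2 := hN' n (le_of_max_le_right hn) z (mem_ball_self hr) _ hmem
      have a3 : dist (S (φ m) (d i)) (S (φ n) (d i)) < ε / 3 :=
        hN m (le_of_max_le_left hm) n (le_of_max_le_left hn)
      have a4 := dist_triangle4_right (S (φ m) z) (S (φ n) z) (S (φ m) (d i)) (S (φ n) (d i))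
      linarith
    obtain ⟨t, -, ht⟩ := cauchySeq_tendsto_of_isComplete hQ.isComplete (fun n => hS (φ n) z) hcau
    exact ⟨t, ht⟩
  have : Nonempty X := ⟨S 0 0⟩
  choose! T hT using hpt
  refine ⟨φ, hφ, T, fun z hz => ?_⟩
  obtain ⟨r, hr, M, hM⟩ := hL z hz
  rw [tendsto_iff_dist_tendsto_zero]
  have h1 : Tendsto (fun p : ℕ × ℂ => M * dist p.2 z + dist (S (φ p.1) z) (T z))
      (atTop ×ˢ 𝓝 z) (𝓝 (M * 0 + 0)) := by
    refine Tendsto.add (Tendsto.const_mul M ?_) ?_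
    · exact (tendsto_iff_dist_tendsto_zero.1 (tendsto_id (x := 𝓝 z))).comp tendsto_snd
    · exact (tendsto_iff_dist_tendsto_zero.1 (hT z hz)).comp tendsto_fst
  rw [mul_zero, add_zero] at h1
  refine squeeze_zero' (.of_forall fun _ => dist_nonneg) ?_ h1
  filter_upwards [(hφ.tendsto_atTop.eventually hM).prod_mk (isOpen_ball.mem_nhds (mem_ball_self hr))]
    with p hp
  have := hp.1 p.2 hp.2 z (mem_ball_self hr)
  linarith [dist_triangle (S (φ p.1) p.2) (S (φ p.1) z) (T z)]

/-- Stereographic projection onto the sphere `‖s‖ ^ 2 = t * (1 - t)` in `ℂ × ℝ`; the point `∞`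
corresponds to `(0, 0)`. It is irreducible so that unification never unfolds it. -/
@[irreducible]
noncomputable def stereo (w : ℂ) : ℂ × ℝ :=
  ((((1 + ‖w‖ ^ 2)⁻¹ : ℝ) : ℂ) * w, (1 + ‖w‖ ^ 2)⁻¹)

theorem stereo_mem (w : ℂ) : stereo w ∈ closedBall (0 : ℂ) 1 ×ˢ closedBall (0 : ℝ) 1 := by
  have h : 0 < 1 + ‖w‖ ^ 2 := by positivity
  refine ⟨?_, ?_⟩
  · rw [mem_closedBall_zero_iff, stereo, norm_mul, Complex.norm_real, Real.norm_of_nonneg (by positivity),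
      inv_mul_le_iff₀ h]
    nlinarith [sq_nonneg (‖w‖ - 1)]
  · rw [mem_closedBall_zero_iff, stereo, Real.norm_of_nonneg (by positivity)]
    exact inv_le_one_of_one_le₀ (by nlinarith [sq_nonneg ‖w‖])

/-- The Lipschitz constant of the spherical image of `f` is controlled by its spherical derivative. -/
theorem dist_stereo_le {f : ℂ → ℂ} {z : ℂ} {r M : ℝ} (hf : DifferentiableOn ℂ f (ball z r))
    (hM : ∀ w ∈ ball z r, ‖deriv f w‖ ≤ M * (1 + ‖f w‖ ^ 2)) {w w' : ℂ} (hw : w ∈ ball z r)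
    (hw' : w' ∈ ball z r) : dist (stereo (f w)) (stereo (f w')) ≤ (3 * M) * dist w w' := by
  have hd : ∀ x ∈ ball z r, ∃ (A : ℂ →L[ℝ] ℝ) (B : ℂ →L[ℝ] ℂ),
      HasFDerivAt (fun x => (1 + ‖f x‖ ^ 2)⁻¹) A x ∧
      HasFDerivAt (fun x => (1 + ‖f x‖ ^ 2)⁻¹ • f x) B x ∧ ‖A‖ ≤ 3 * M ∧ ‖B‖ ≤ 3 * M := by
    intro x hx
    have h0 : 0 < 1 + ‖f x‖ ^ 2 := by positivity
    have h1 : HasFDerivAt f (ContinuousLinearMap.restrictScalars ℝ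
        (ContinuousLinearMap.toSpanSingleton ℂ (deriv f x))) x :=
      ((hf.differentiableAt (isOpen_ball.mem_nhds hx)).hasDerivAt.hasFDerivAt).restrictScalars ℝ
    set D := ContinuousLinearMap.restrictScalars ℝ
        (ContinuousLinearMap.toSpanSingleton ℂ (deriv f x))
    have hD : ‖D‖ ≤ M * (1 + ‖f x‖ ^ 2) := by
      refine le_trans ?_ (hM x hx)
      rw [ContinuousLinearMap.norm_restrictScalars, ContinuousLinearMap.norm_toSpanSingleton]
    have h2 : HasFDerivAt (fun x => (1 + ‖f x‖ ^ 2)⁻¹)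
        ((-((1 + ‖f x‖ ^ 2) ^ 2)⁻¹) • (2 • (innerSL ℝ (f x)).comp D)) x :=
      (hasDerivAt_inv h0.ne').comp_hasFDerivAt x ((h1.norm_sq).const_add 1)
    set A := (-((1 + ‖f x‖ ^ 2) ^ 2)⁻¹) • (2 • (innerSL ℝ (f x)).comp D)
    have hA' : ‖A‖ ≤ ((1 + ‖f x‖ ^ 2) ^ 2)⁻¹ * (2 * (‖f x‖ * ‖D‖)) := by
      have e1 : ‖(innerSL ℝ (f x)).comp D‖ ≤ ‖f x‖ * ‖D‖ := by
        refine (ContinuousLinearMap.opNorm_comp_le _ _).trans ?_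
        rw [innerSL_apply_norm]
      rw [norm_smul, norm_neg, Real.norm_of_nonneg (by positivity), two_nsmul]
      gcongr
      exact (norm_add_le _ _).trans (by linarith)
    have hM0 : 0 ≤ M := by
      by_contra hneg
      have := (norm_nonneg _).trans (hM x hx)
      nlinarith
    have hA : ‖A‖ * (1 + ‖f x‖ ^ 2) ≤ 2 * ‖f x‖ * M := by
      calc ‖A‖ * (1 + ‖f x‖ ^ 2) ≤ ((1 + ‖f x‖ ^ 2) ^ 2)⁻¹ * (2 * (‖f x‖ *
            (M * (1 + ‖f x‖ ^ 2)))) * (1 + ‖f x‖ ^ 2) := by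
            gcongr
            exact hA'.trans (by gcongr)
        _ = 2 * ‖f x‖ * M := by field_simp
    refine ⟨A, _, h2, h2.smul h1, ?_, ?_⟩
    · nlinarith [norm_nonneg A, sq_nonneg (‖f x‖ - 1), norm_nonneg (f x)]
    · refine (norm_add_le _ _).trans ?_
      rw [norm_smul, Real.norm_of_nonneg (by positivity), ContinuousLinearMap.norm_smulRight_apply]
      have e1 : (1 + ‖f x‖ ^ 2)⁻¹ * ‖D‖ ≤ M := by
        rw [inv_mul_le_iff₀ h0]; linarith
      have e2 : ‖A‖ * ‖f x‖ ≤ 2 * M := by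
        by_contra! hcon
        have : 2 * M * (1 + ‖f x‖ ^ 2) < ‖A‖ * ‖f x‖ * (1 + ‖f x‖ ^ 2) := by gcongr
        nlinarith [norm_nonneg (f x)]
      linarith
  choose! A B hA hB hAn hBn using hd
  have k1 := (convex_ball z r).norm_image_sub_le_of_norm_hasFDerivWithin_le
    (fun x hx => (hA x hx).hasFDerivWithinAt) hAn hw' hw
  have k2 := (convex_ball z r).norm_image_sub_le_of_norm_hasFDerivWithin_le
    (fun x hx => (hB x hx).hasFDerivWithinAt) hBn hw' hw
  rw [Prod.dist_eq, dist_eq_norm, dist_eq_norm, dist_eq_norm]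
  simp only [stereo]
  refine max_le ?_ k1
  simpa only [Complex.real_smul] using k2

theorem norm_sq_stereo (w : ℂ) :
    ‖(stereo w).1‖ ^ 2 = (stereo w).2 * (1 - (stereo w).2) := by
  have h0 : 0 < 1 + ‖w‖ ^ 2 := by positivity
  simp only [stereo]
  rw [norm_mul, Complex.norm_real, Real.norm_of_nonneg (by positivity)]
  field_simp
  ring

theorem stereo_snd_pos (w : ℂ) : 0 < (stereo w).2 := by
  simp only [stereo]; positivity

theorem stereo_fst_div (w : ℂ) : (stereo w).1 / (stereo w).2 = w := by
  have := (stereo_snd_pos w).ne'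
  simp only [stereo] at this ⊢
  have h2 : (((1 + ‖w‖ ^ 2)⁻¹ : ℝ) : ℂ) ≠ 0 := by exact_mod_cast this
  exact mul_div_cancel_left₀ _ h2

theorem inv_eq_stereo {w : ℂ} (hw : w ≠ 0) :
    w⁻¹ = (starRingEnd ℂ) (stereo w).1 / (1 - (stereo w).2 : ℝ) := by
  have h0 : 0 < 1 + ‖w‖ ^ 2 := by positivity
  have h1 : 0 < ‖w‖ := norm_pos_iff.2 hw
  have h2 : 1 - (1 + ‖w‖ ^ 2)⁻¹ = (1 + ‖w‖ ^ 2)⁻¹ * ‖w‖ ^ 2 := by field_simp; ring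
  simp only [stereo]
  rw [h2, map_mul, Complex.conj_ofReal, Complex.inv_def, Complex.normSq_eq_norm_sq]
  have h3 : ((1 + ‖w‖ ^ 2 : ℝ) : ℂ) ≠ 0 := by exact_mod_cast h0.ne'
  have h4 : (‖w‖ : ℂ) ≠ 0 := by exact_mod_cast h1.ne'
  push_cast at h3 ⊢
  field_simp

/-- Limits of spherical images stay on the sphere. -/
theorem norm_sq_of_tendsto_stereo {x : ℕ → ℂ} {s : ℂ × ℝ}
    (h : Tendsto (fun n => stereo (x n)) atTop (𝓝 s)) : ‖s.1‖ ^ 2 = s.2 * (1 - s.2) := by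
  have h1 : Tendsto (fun n => ‖(stereo (x n)).1‖ ^ 2) atTop (𝓝 (‖s.1‖ ^ 2)) :=
    (h.fst_nhds.norm).pow 2
  have h2 : Tendsto (fun n => (stereo (x n)).2 * (1 - (stereo (x n)).2)) atTop
      (𝓝 (s.2 * (1 - s.2))) := h.snd_nhds.mul (h.snd_nhds.const_sub 1)
  exact tendsto_nhds_unique h1 (h2.congr fun n => (norm_sq_stereo _).symm)

/-- The set where a spherical limit of holomorphic functions equals `∞` is open: apply Hurwitz's
theorem to the reciprocals. -/
theorem eventually_stereo_limit_eq_infty {F : ℕ → ℂ → ℂ} {T : ℂ → ℂ × ℝ} {z : ℂ} {r : ℝ}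
    (hr : 0 < r) (hd : ∀ᶠ n in atTop, DifferentiableOn ℂ (F n) (ball z r))
    (hT : ∀ w ∈ ball z r,
      Tendsto (fun p : ℕ × ℂ => stereo (F p.1 p.2)) (atTop ×ˢ 𝓝 w) (𝓝 (T w)))
    (hz0 : (T z).2 = 0) : ∀ᶠ w in 𝓝 z, (T w).2 = 0 := by
  have hTpt : ∀ w ∈ ball z r, Tendsto (fun n => stereo (F n w)) atTop (𝓝 (T w)) := fun w hw =>
    tendsto_pt_of_tendsto_prod (S := fun n w => stereo (F n w)) (hT w hw)
  have h1 : Tendsto (fun p : ℕ × ℂ => (stereo (F p.1 p.2)).2) (atTop ×ˢ 𝓝 z) (𝓝 0) :=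
    hz0 ▸ (hT z (mem_ball_self hr)).snd_nhds
  obtain ⟨pa, hpa, pb, hpb, hab⟩ := eventually_prod_iff.1
    (h1.eventually (gt_mem_nhds (show (0:ℝ) < 1 / 2 by norm_num)))
  obtain ⟨s, hs, h2⟩ := Metric.eventually_nhds_iff_ball.1 hpb
  obtain ⟨δ, hδ, hδr, hδs⟩ : ∃ δ > 0, δ ≤ r ∧ δ ≤ s :=
    ⟨min r s, lt_min hr hs, min_le_left _ _, min_le_right _ _⟩
  have hδU : ball z δ ⊆ ball z r := ball_subset_ball hδr
  -- near `z` the images stay away from the origin of `ℂ`, so the reciprocals are holomorphic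
  have hlt : ∀ w ∈ ball z δ, (T w).2 ≤ 1 / 2 := fun w hw => by
    refine le_of_tendsto (hTpt w (hδU hw)).snd_nhds ?_
    filter_upwards [hpa] with n hn
    exact (hab hn (h2 w (ball_subset_ball hδs hw))).le
  have hne : ∀ᶠ n in atTop, ∀ w ∈ ball z δ, F n w ≠ 0 := by
    filter_upwards [hpa] with n hn w hw h0
    have := hab hn (h2 w (ball_subset_ball hδs hw))
    simp only [stereo, h0] at this
    norm_num at this
  have hH : HolTendstoAt (fun n w => (F n w)⁻¹)
      (fun w => (starRingEnd ℂ) (T w).1 / ((1 - (T w).2 : ℝ) : ℂ)) z := by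
    refine ⟨δ, hδ, ?_, fun w hw => ?_⟩
    · filter_upwards [hd, hne] with n hn hn'
      exact (hn.mono hδU).inv hn'
    · have hw' := hT w (hδU hw)
      have h3 : Tendsto (fun p : ℕ × ℂ => (starRingEnd ℂ) (stereo (F p.1 p.2)).1)
          (atTop ×ˢ 𝓝 w) (𝓝 ((starRingEnd ℂ) (T w).1)) :=
        (Complex.continuous_conj.tendsto _).comp hw'.fst_nhds
      have h4 : Tendsto (fun p : ℕ × ℂ => ((1 - (stereo (F p.1 p.2)).2 : ℝ) : ℂ))
          (atTop ×ˢ 𝓝 w) (𝓝 ((1 - (T w).2 : ℝ) : ℂ)) :=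
        (Complex.continuous_ofReal.tendsto _).comp (hw'.snd_nhds.const_sub 1)
      refine (h3.div h4 ?_).congr' ?_
      · have := hlt w hw
        exact_mod_cast (show (1:ℝ) - (T w).2 ≠ 0 by linarith)
      · filter_upwards [hne.prod_mk (isOpen_ball.mem_nhds hw)] with p hp
        exact (inv_eq_stereo (hp.1 _ hp.2)).symm
  have hs0 : (T z).1 = 0 := by
    have := norm_sq_of_tendsto_stereo (hTpt z (mem_ball_self hr))
    rw [hz0] at this
    simpa using this
  have hzero : ∀ᶠ w in 𝓝 z, (starRingEnd ℂ) (T w).1 / ((1 - (T w).2 : ℝ) : ℂ) = 0 := by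
    by_contra hcon
    obtain ⟨ψ, x, hψ, hx, hx0⟩ := hH.exists_zeros (by simp [hs0]) hcon
    obtain ⟨j, hj1, hj2⟩ := ((hψ.eventually hne).and
      (hx.eventually (isOpen_ball.mem_nhds (mem_ball_self hδ)))).exists
    exact hj1 _ hj2 (inv_eq_zero.1 (hx0 j))
  filter_upwards [hzero, isOpen_ball.mem_nhds (mem_ball_self hδ)] with w hw hwb
  have h5 := hlt w hwb
  have h6 := norm_sq_of_tendsto_stereo (hTpt w (hδU hwb))
  have h7 : (T w).1 = 0 := by
    rcases div_eq_zero_iff.1 hw with h | h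
    · simpa using h
    · have : (1:ℝ) - (T w).2 = 0 := by exact_mod_cast h
      linarith
  rw [h7, norm_zero, zero_pow two_ne_zero] at h6
  rcases mul_eq_zero.1 h6.symm with h | h
  · exact h
  · linarith

/-- **Marty's theorem**: on an open connected set, locally bounded spherical derivatives force a
subsequence to converge locally uniformly, to a finite limit or to `∞`. -/
theorem exists_subseq_of_sphericallyBoundedAt {F : ℕ → ℂ → ℂ} {U : Set ℂ} (hU : IsOpen U)
    (hUc : IsPreconnected U) (hF : ∀ z ∈ U, SphericallyBoundedAt F z) :
    ∃ φ : ℕ → ℕ, StrictMono φ ∧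
      ((∃ g : ℂ → ℂ, ∀ z ∈ U, HolTendstoAt (fun n => F (φ n)) g z) ∨
        ∀ z ∈ U, TendstoInftyAt (fun n => F (φ n)) z) := by
  obtain ⟨φ, hφ, T, hT⟩ := exists_subseq_tendsto_of_lipschitz
    ((isCompact_closedBall (0 : ℂ) 1).prod (isCompact_closedBall (0 : ℝ) 1))
    (fun n w => stereo (F n w)) (fun n w => stereo_mem _) U (by
      intro z hz
      obtain ⟨r, hr, M, hM⟩ := hF z hz
      exact ⟨r, hr, 3 * M, hM.mono fun n hn w hw w' hw' => dist_stereo_le hn.1 hn.2 hw hw'⟩)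
  refine ⟨φ, hφ, ?_⟩
  have hTpt : ∀ z ∈ U, Tendsto (fun n => stereo (F (φ n) z)) atTop (𝓝 (T z)) := fun z hz =>
    tendsto_pt_of_tendsto_prod (S := fun n z => stereo (F (φ n) z)) (hT z hz)
  have hdiff : ∀ z ∈ U, ∃ r > 0, ball z r ⊆ U ∧
      ∀ᶠ n in atTop, DifferentiableOn ℂ (F (φ n)) (ball z r) := by
    intro z hz
    obtain ⟨r, hr, M, hM⟩ := hF z hz
    obtain ⟨s, hs, hsU⟩ := Metric.mem_nhds_iff.1 (hU.mem_nhds hz)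
    refine ⟨min r s, lt_min hr hs, (ball_subset_ball (min_le_right _ _)).trans hsU, ?_⟩
    filter_upwards [hφ.tendsto_atTop.eventually hM] with n hn
    exact hn.1.mono (ball_subset_ball (min_le_left _ _))
  have hfin : ∀ z ∈ U, (T z).2 ≠ 0 → Tendsto (fun p : ℕ × ℂ => F (φ p.1) p.2) (atTop ×ˢ 𝓝 z)
      (𝓝 ((T z).1 / (T z).2)) := by
    intro z hz hz0
    have h2 : Tendsto (fun p : ℕ × ℂ => (((stereo (F (φ p.1) p.2)).2 : ℝ) : ℂ))
        (atTop ×ˢ 𝓝 z) (𝓝 ((T z).2 : ℂ)) :=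
      (Complex.continuous_ofReal.tendsto _).comp (hT z hz).snd_nhds
    have h1 := (hT z hz).fst_nhds.div h2 (by exact_mod_cast hz0)
    exact h1.congr fun p => stereo_fst_div _
  have hopen : ∀ z ∈ U, (T z).2 = 0 → ∀ᶠ w in 𝓝 z, (T w).2 = 0 := by
    intro z hz hz0
    obtain ⟨r, hr, hrU, hd⟩ := hdiff z hz
    exact eventually_stereo_limit_eq_infty hr hd (fun w hw => hT w (hrU hw)) hz0
  have hT2 : ∀ w ∈ U, Tendsto (fun p : ℕ × ℂ => (((stereo (F (φ p.1) p.2)).2 : ℝ) : ℂ))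
      (atTop ×ˢ 𝓝 w) (𝓝 ((T w).2 : ℂ)) := fun w hw =>
    (Complex.continuous_ofReal.tendsto _).comp (hT w hw).snd_nhds
  have hTc : ContinuousOn (fun z => (T z).2) U := by
    have h1 : TendstoLocallyUniformlyOn (fun n z => (((stereo (F (φ n) z)).2 : ℝ) : ℂ))
        (fun z => ((T z).2 : ℂ)) atTop U :=
      HolTendstoAt.tendstoLocallyUniformlyOn_of_forall fun w hw =>
        ((Complex.continuous_ofReal.comp continuous_snd).tendsto _).comp (hT w hw)
    intro z hz
    obtain ⟨r, hr, hrU, hd⟩ := hdiff z hz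
    have h2 : ContinuousOn (fun z => ((T z).2 : ℂ)) (ball z r) := by
      refine (h1.mono hrU).continuousOn (Eventually.frequently ?_)
      filter_upwards [hd] with n hn
      refine Complex.continuous_ofReal.comp_continuousOn ?_
      simp only [stereo]
      exact ContinuousOn.inv₀ (continuousOn_const.add (hn.continuousOn.norm.pow 2))
        fun x _ => by positivity
    have h3 := (h2.continuousAt (isOpen_ball.mem_nhds (mem_ball_self hr)))
    exact (Complex.continuous_re.continuousAt.comp h3).continuousWithinAt
  rcases U.eq_empty_or_nonempty with rfl | ⟨z₀, hz₀⟩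
  · exact Or.inr fun z hz => absurd hz (notMem_empty z)
  -- the set where the limit is `∞` is open and closed in `U`
  have hdich : (∀ z ∈ U, (T z).2 ≠ 0) ∨ ∀ z ∈ U, (T z).2 = 0 := by
    have hA : IsOpen {z ∈ U | (T z).2 = 0} := by
      rw [isOpen_iff_mem_nhds]
      rintro z ⟨hz, hz0⟩
      filter_upwards [hU.mem_nhds hz, hopen z hz hz0] with w h1 h2 using ⟨h1, h2⟩
    have hB : IsOpen {z ∈ U | (T z).2 ≠ 0} := by
      have := hTc.isOpen_inter_preimage hU (isOpen_ne (x := (0 : ℝ)))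
      exact this
    by_contra hcon
    push Not at hcon
    obtain ⟨⟨z₁, hz₁, h1⟩, z₂, hz₂, h2⟩ := hcon
    obtain ⟨w, -, hw1, hw2⟩ := hUc _ _ hA hB
      (fun z hz => (em ((T z).2 = 0)).imp (fun h => ⟨hz, h⟩) fun h => ⟨hz, h⟩)
      ⟨z₁, hz₁, hz₁, h1⟩ ⟨z₂, hz₂, hz₂, h2⟩
    exact hw2.2 hw1.2
  rcases hdich with h | h
  · refine Or.inl ⟨fun z => (T z).1 / (T z).2, fun z hz => ?_⟩
    obtain ⟨r, hr, hrU, hd⟩ := hdiff z hz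
    exact ⟨r, hr, hd, fun w hw => hfin w (hrU hw) (h w (hrU hw))⟩
  · refine Or.inr fun z hz => ?_
    obtain ⟨r, hr, hrU⟩ := Metric.mem_nhds_iff.1 (hU.mem_nhds hz)
    have h1 : TendstoUniformlyOn (fun n z => (((stereo (F (φ n) z)).2 : ℝ) : ℂ))
        (fun z => ((T z).2 : ℂ)) atTop (closedBall z (r / 2)) := by
      refine (tendstoLocallyUniformlyOn_iff_forall_isCompact hU).1
        (HolTendstoAt.tendstoLocallyUniformlyOn_of_forall hT2) _
        ((closedBall_subset_ball (half_lt_self hr)).trans hrU) (isCompact_closedBall _ _)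
    refine ⟨r / 2, half_pos hr, fun M => ?_⟩
    filter_upwards [Metric.tendstoUniformlyOn_iff.1 h1 (1 + M ^ 2)⁻¹ (by positivity)] with n hn w hw
    have h2 := hn w (ball_subset_closedBall hw)
    rw [h w (hrU (ball_subset_ball (half_le_self hr.le) hw)), Complex.ofReal_zero, dist_zero_left,
      Complex.norm_real, Real.norm_of_nonneg (stereo_snd_pos _).le] at h2
    simp only [stereo] at h2
    rw [inv_lt_inv₀ (by positivity) (by positivity)] at h2
    have h3 : M ^ 2 < ‖F (φ n) w‖ ^ 2 := by linarith
    exact (lt_of_pow_lt_pow_left₀ 2 (norm_nonneg _) h3).le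

/-! ### The Zalcman–Pang rescaling lemma -/

/-- Near a point where `F n → ∞`, the spherical derivatives tend to `0`. -/
theorem TendstoInftyAt.eventually_norm_deriv_lt {F : ℕ → ℂ → ℂ} {z : ℂ} (h : TendstoInftyAt F z)
    (hd : ∃ r > 0, ∀ᶠ n in atTop, DifferentiableOn ℂ (F n) (ball z r)) {N : ℝ} (hN : 0 < N) :
    ∀ᶠ n in atTop, ‖deriv (F n) z‖ < N * (1 + ‖F n z‖ ^ 2) := by
  obtain ⟨r, hr, h1⟩ := h
  obtain ⟨s, hs, h2⟩ := hd
  set δ := min r s / 2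
  have hm : 0 < min r s := lt_min hr hs
  have hδ : 0 < δ := half_pos hm
  have hδm : δ < min r s := half_lt_self hm
  filter_upwards [h1 (2 / (δ * N)), h2] with n hn hn2
  have hM : 0 < 2 / (δ * N) := by positivity
  have hcr : closedBall z δ ⊆ ball z r := closedBall_subset_ball (hδm.trans_le (min_le_left _ _))
  have hcs : closedBall z δ ⊆ ball z s := closedBall_subset_ball (hδm.trans_le (min_le_right _ _))
  have hne : ∀ w ∈ closedBall z δ, F n w ≠ 0 := fun w hw h0 => by
    have := hn w (hcr hw)
    rw [h0, norm_zero] at this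
    linarith
  have hz := mem_closedBall_self (x := z) hδ.le
  have hda : DifferentiableAt ℂ (F n) z := hn2.differentiableAt (isOpen_ball.mem_nhds (hcs hz))
  have h3 : DiffContOnCl ℂ (fun w => (F n w)⁻¹) (ball z δ) :=
    DifferentiableOn.diffContOnCl_ball ((hn2.mono hcs).inv hne) subset_rfl
  have h4 := Complex.norm_deriv_le_of_forall_mem_sphere_norm_le hδ h3 (C := δ * N / 2)
    fun w hw => by
      rw [norm_inv]
      have := hn w (hcr (sphere_subset_closedBall hw))
      rw [show δ * N / 2 = (2 / (δ * N))⁻¹ by rw [inv_div]]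
      exact inv_anti₀ hM this
  rw [deriv_fun_inv'' hda (hne z hz), norm_div, norm_neg, norm_pow,
    div_le_iff₀ (by have := norm_pos_iff.2 (hne z hz); positivity)] at h4
  have h5 : δ * N / 2 / δ = N / 2 := by field_simp
  rw [h5] at h4
  nlinarith [sq_nonneg ‖F n z‖]

/-- Among all pairs `(x, ρ)` with `0 < ρ ≤ 1` at which the function `ζ ↦ ρ⁻ᵏ f (x + ρ ζ)` has spherical derivative
at least `N` at the origin, some pair maximises `(r - ‖x - z₀‖) / ρ`. -/
theorem exists_extremal_rescaling {f : ℂ → ℂ} {z₀ w₀ : ℂ} {r N ε : ℝ} {k : ℕ} (hr : 0 < r)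
    (hf : DifferentiableOn ℂ f (ball z₀ (2 * r)))
    (hw₀ : w₀ ∈ closedBall z₀ r) (hε : 0 < ε) (hε1 : ε ≤ 1)
    (hbig : N * (ε ^ (2 * k) + ‖f w₀‖ ^ 2) ≤ ε ^ (k + 1) * ‖deriv f w₀‖)
    (hsmall : ∃ ρ₀ > 0, ∀ ρ : ℝ, 0 < ρ → ρ < ρ₀ → ∀ z ∈ closedBall z₀ r,
      ρ ^ (k + 1) * ‖deriv f z‖ < N * (ρ ^ (2 * k) + ‖f z‖ ^ 2)) :
    ∃ x ∈ closedBall z₀ r, ∃ ρ : ℝ, 0 < ρ ∧ ρ ≤ 1 ∧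
      (r - dist w₀ z₀) / ε ≤ (r - dist x z₀) / ρ ∧
      N * (ρ ^ (2 * k) + ‖f x‖ ^ 2) ≤ ρ ^ (k + 1) * ‖deriv f x‖ ∧
      ∀ x' ∈ closedBall z₀ r, ∀ ρ' : ℝ, 0 < ρ' → ρ' ≤ 1 →
        (r - dist x z₀) / ρ < (r - dist x' z₀) / ρ' →
        ρ' ^ (k + 1) * ‖deriv f x'‖ < N * (ρ' ^ (2 * k) + ‖f x'‖ ^ 2) := by
  obtain ⟨ρ₀, hρ₀, hsm⟩ := hsmall
  have hsub : closedBall z₀ r ⊆ ball z₀ (2 * r) := closedBall_subset_ball (by linarith)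
  have hc1 : ContinuousOn f (closedBall z₀ r) := hf.continuousOn.mono hsub
  have hc2 : ContinuousOn (deriv f) (closedBall z₀ r) :=
    (hf.deriv isOpen_ball).continuousOn.mono hsub
  -- by `hsm` only `ρ ≥ ρ₀` matters, so the maximum is over a compact set
  set K : Set (ℂ × ℝ) := closedBall z₀ r ×ˢ Icc ρ₀ 1
  have hK : IsCompact K := (isCompact_closedBall _ _).prod isCompact_Icc
  set E : Set (ℂ × ℝ) := {p ∈ K | N * (p.2 ^ (2 * k) + ‖f p.1‖ ^ 2) ≤ p.2 ^ (k + 1) * ‖deriv f p.1‖}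
  have hf1 : ContinuousOn (fun p : ℂ × ℝ => f p.1) K :=
    hc1.comp continuousOn_fst fun p hp => hp.1
  have hf2 : ContinuousOn (fun p : ℂ × ℝ => deriv f p.1) K :=
    hc2.comp continuousOn_fst fun p hp => hp.1
  have hE : IsCompact E := by
    refine hK.of_isClosed_subset ?_ fun p hp => hp.1
    refine hK.isClosed.isClosed_le ?_ ?_
    · exact continuousOn_const.mul ((continuousOn_snd.pow _).add (hf1.norm.pow 2))
    · exact (continuousOn_snd.pow _).mul hf2.norm
  have hmem : (w₀, ε) ∈ E := by
    refine ⟨⟨hw₀, ?_, hε1⟩, hbig⟩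
    by_contra! hlt
    exact absurd (hsm ε hε hlt w₀ hw₀) (not_lt.2 hbig)
  have hcont : ContinuousOn (fun p : ℂ × ℝ => (r - dist p.1 z₀) / p.2) E :=
    ContinuousOn.div (by fun_prop) continuousOn_snd fun p hp => (hρ₀.trans_le hp.1.2.1).ne'
  obtain ⟨⟨x, ρ⟩, ⟨⟨hx, hρ, hρ1⟩, hxρ⟩, hmax⟩ := hE.exists_isMaxOn ⟨_, hmem⟩ hcont
  refine ⟨x, hx, ρ, hρ₀.trans_le hρ, hρ1, hmax hmem, hxρ, fun x' hx' ρ' hρ' hρ'1 hlt => ?_⟩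
  by_contra! hcon
  have : (x', ρ') ∈ E := by
    refine ⟨⟨hx', ?_, hρ'1⟩, hcon⟩
    by_contra! hlt
    exact absurd (hsm ρ' hρ' hlt x' hx') (not_lt.2 hcon)
  exact absurd (hmax this) (not_le.2 hlt)

/-- At the extremal pair the rescaled function is holomorphic on a large disc and has spherical
derivative almost bounded by `N` there. -/
theorem norm_deriv_rescaling_le {f : ℂ → ℂ} {z₀ x : ℂ} {r N ρ R : ℝ} {k : ℕ} (hr : 0 < r)
    (hN : 0 < N) (hf : DifferentiableOn ℂ f (ball z₀ (2 * r)))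
    (hρ : 0 < ρ) (hρ1 : ρ ≤ 1) (hR : 0 < R) (hT : R + 1 < (r - dist x z₀) / ρ)
    (hmax : ∀ x' ∈ closedBall z₀ r, ∀ ρ' : ℝ, 0 < ρ' → ρ' ≤ 1 →
        (r - dist x z₀) / ρ < (r - dist x' z₀) / ρ' →
        ρ' ^ (k + 1) * ‖deriv f x'‖ < N * (ρ' ^ (2 * k) + ‖f x'‖ ^ 2)) :
    DifferentiableOn ℂ (fun ζ => ((ρ : ℂ) ^ k)⁻¹ * f (x + ρ * ζ)) (ball 0 R) ∧
    ∀ ζ ∈ ball (0 : ℂ) R,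
      (1 - (R + 1) / ((r - dist x z₀) / ρ)) ^ (k + 1) *
        ‖deriv (fun ζ => ((ρ : ℂ) ^ k)⁻¹ * f (x + ρ * ζ)) ζ‖ ≤
        N * (1 + ‖((ρ : ℂ) ^ k)⁻¹ * f (x + ρ * ζ)‖ ^ 2) := by
  set T := (r - dist x z₀) / ρ
  have hTρ : r - dist x z₀ = T * ρ := by simp only [T]; field_simp
  have hdist : ∀ ζ ∈ ball (0 : ℂ) R, dist (x + ρ * ζ) z₀ ≤ dist x z₀ + ρ * R := by
    intro ζ hζ
    rw [mem_ball_zero_iff] at hζ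
    refine (dist_triangle _ x _).trans ?_
    rw [dist_eq_norm (x + ρ * ζ), add_sub_cancel_left, norm_mul, Complex.norm_real,
      Real.norm_of_nonneg hρ.le]
    nlinarith
  have hin : ∀ ζ ∈ ball (0 : ℂ) R, dist (x + ρ * ζ) z₀ ≤ r := fun ζ hζ => by
    have := hdist ζ hζ
    nlinarith
  have hmaps : MapsTo (fun ζ : ℂ => x + ρ * ζ) (ball 0 R) (ball z₀ (2 * r)) := fun ζ hζ => by
    have := hin ζ hζ
    rw [mem_ball]; linarith
  refine ⟨(hf.comp (by fun_prop) hmaps).const_mul _, fun ζ hζ => ?_⟩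
  have hT0 : 0 < T := by linarith
  -- the scale `θ ρ` at the point `x + ρ ζ` beats the maximum, so the bound `N` holds there
  set θ := 1 - (R + 1) / T
  have hθ0 : 0 < θ := by
    simp only [θ, sub_pos]
    exact (div_lt_one hT0).2 hT
  have hθ1 : θ ≤ 1 := by
    simp only [θ, sub_le_self_iff]
    positivity
  have hTθ : T * θ = T - R - 1 := by simp only [θ]; field_simp; ring
  have h1 := hmax (x + ρ * ζ) (hin ζ hζ) (θ * ρ) (by positivity) (by nlinarith) (by
    rw [lt_div_iff₀ (by positivity), ← mul_assoc, hTθ]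
    have := hdist ζ hζ
    nlinarith)
  rw [deriv_const_mul_field, deriv_comp_affine, norm_mul, norm_mul, norm_mul, norm_inv, norm_pow,
    Complex.norm_real, Real.norm_of_nonneg hρ.le, mul_pow]
  have hpk : 0 < ρ ^ k := by positivity
  have h2 : θ ^ (2 * k) ≤ 1 := pow_le_one₀ hθ0.le hθ1
  have h3 : (θ * ρ) ^ (k + 1) * ‖deriv f (x + ρ * ζ)‖ ≤
      N * (ρ ^ (2 * k) + ‖f (x + ρ * ζ)‖ ^ 2) := by
    refine h1.le.trans ?_
    have : (θ * ρ) ^ (2 * k) ≤ ρ ^ (2 * k) := by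
      rw [mul_pow]
      exact mul_le_of_le_one_left (by positivity) h2
    gcongr
  calc θ ^ (k + 1) * ((ρ ^ k)⁻¹ * (ρ * ‖deriv f (x + ρ * ζ)‖))
      = ((θ * ρ) ^ (k + 1) * ‖deriv f (x + ρ * ζ)‖) * (ρ ^ (2 * k))⁻¹ := by
        rw [mul_pow, pow_succ ρ, two_mul, pow_add ρ k k]
        field_simp
    _ ≤ (N * (ρ ^ (2 * k) + ‖f (x + ρ * ζ)‖ ^ 2)) * (ρ ^ (2 * k))⁻¹ := by gcongr
    _ = N * (1 + ((ρ ^ k)⁻¹) ^ 2 * ‖f (x + ρ * ζ)‖ ^ 2) := by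
        rw [two_mul, pow_add ρ k k]
        field_simp

/-- The **Zalcman–Pang rescaling lemma** for holomorphic functions and an integral exponent `k`.
The hypothesis `hsmall` says that, for each fixed `n`, the function `ζ ↦ ρ⁻ᵏ F n (z + ρ ζ)` has
spherical derivative less than `N` at the origin for all sufficiently small `ρ`. -/
theorem exists_zalcman_rescaling {F : ℕ → ℂ → ℂ} {z₀ : ℂ} {r N : ℝ} {k : ℕ} (hr : 0 < r)
    (hN : 0 < N) (hF : ∀ n, DifferentiableOn ℂ (F n) (ball z₀ (2 * r)))
    {w : ℕ → ℂ} (hw : Tendsto w atTop (𝓝 z₀))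
    (hbig : ∀ M : ℝ, ∀ᶠ n in atTop, M * (1 + ‖F n (w n)‖ ^ 2) ≤ ‖deriv (F n) (w n)‖)
    (hsmall : ∀ n, ∃ ρ₀ > 0, ∀ ρ : ℝ, 0 < ρ → ρ < ρ₀ → ∀ z ∈ closedBall z₀ r,
      ρ ^ (k + 1) * ‖deriv (F n) z‖ < N * (ρ ^ (2 * k) + ‖F n z‖ ^ 2)) :
    ∃ (φ : ℕ → ℕ) (x : ℕ → ℂ) (ρ : ℕ → ℝ) (x₀ : ℂ) (g : ℂ → ℂ), Tendsto φ atTop atTop ∧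
      x₀ ∈ closedBall z₀ r ∧ Tendsto x atTop (𝓝 x₀) ∧ (∀ n, 0 < ρ n) ∧ Tendsto ρ atTop (𝓝 0) ∧
      (∀ ζ, HolTendstoAt
        (fun n ζ => ((ρ n : ℂ) ^ k)⁻¹ * F (φ n) (x n + ρ n * ζ)) g ζ) ∧
      (∀ ζ, ‖deriv g ζ‖ ≤ N * (1 + ‖g ζ‖ ^ 2)) ∧ N * (1 + ‖g 0‖ ^ 2) ≤ ‖deriv g 0‖ := by
  have step : ∀ j : ℕ, ∃ n ≥ j, ∃ x ∈ closedBall z₀ r, ∃ ρ : ℝ, 0 < ρ ∧ ρ ≤ 1 ∧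
      (j : ℝ) ≤ (r - dist x z₀) / ρ ∧
      N * (ρ ^ (2 * k) + ‖F n x‖ ^ 2) ≤ ρ ^ (k + 1) * ‖deriv (F n) x‖ ∧
      ∀ x' ∈ closedBall z₀ r, ∀ ρ' : ℝ, 0 < ρ' → ρ' ≤ 1 →
        (r - dist x z₀) / ρ < (r - dist x' z₀) / ρ' →
        ρ' ^ (k + 1) * ‖deriv (F n) x'‖ < N * (ρ' ^ (2 * k) + ‖F n x'‖ ^ 2) := by
    intro j
    obtain ⟨ε, hε, hε1, hεj⟩ : ∃ ε : ℝ, 0 < ε ∧ ε ≤ 1 ∧ j * ε ≤ r / 2 := by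
      refine ⟨min 1 (r / 2 / (j + 1)), lt_min one_pos (by positivity), min_le_left _ _, ?_⟩
      calc (j : ℝ) * min 1 (r / 2 / (j + 1)) ≤ (j + 1) * (r / 2 / (j + 1)) := by
            gcongr
            · linarith
            · exact min_le_right _ _
        _ = r / 2 := by field_simp
    obtain ⟨n, ⟨hn1, hn2⟩, hnj⟩ := (((hbig (N / ε ^ (k + 1))).and
      (hw.eventually (ball_mem_nhds z₀ (half_pos hr)))).and (eventually_ge_atTop j)).exists
    have hb : N * (ε ^ (2 * k) + ‖F n (w n)‖ ^ 2) ≤ ε ^ (k + 1) * ‖deriv (F n) (w n)‖ := by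
      calc N * (ε ^ (2 * k) + ‖F n (w n)‖ ^ 2) ≤ N * (1 + ‖F n (w n)‖ ^ 2) := by
            gcongr
            exact pow_le_one₀ hε.le hε1
        _ = ε ^ (k + 1) * (N / ε ^ (k + 1) * (1 + ‖F n (w n)‖ ^ 2)) := by field_simp
        _ ≤ _ := by gcongr
    obtain ⟨x, hx, ρ, hρ, hρ1, h1, h2, h3⟩ := exists_extremal_rescaling hr (hF n)
      (show w n ∈ closedBall z₀ r by rw [mem_closedBall]; linarith) hε hε1 hb (hsmall n)
    refine ⟨n, hnj, x, hx, ρ, hρ, hρ1, le_trans ?_ h1, h2, h3⟩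
    rw [le_div_iff₀ hε]
    linarith
  choose φ hφ x hx ρ hρ hρ1 hT hlow hmax using step
  set T : ℕ → ℝ := fun j => (r - dist (x j) z₀) / ρ j
  have hTt : Tendsto T atTop atTop := tendsto_atTop_mono hT tendsto_natCast_atTop_atTop
  have hρt : Tendsto ρ atTop (𝓝 0) := by
    have h1 : Tendsto (fun j : ℕ => r / (j : ℝ)) atTop (𝓝 0) :=
      tendsto_const_nhds.div_atTop tendsto_natCast_atTop_atTop
    refine squeeze_zero' (.of_forall fun j => (hρ j).le) ?_ h1
    filter_upwards [eventually_gt_atTop 0] with j hj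
    have hj' : (0 : ℝ) < j := by exact_mod_cast hj
    have h2 := hT j
    rw [le_div_iff₀ (hρ j)] at h2
    rw [le_div_iff₀ hj']
    have : 0 ≤ dist (x j) z₀ := dist_nonneg
    linarith
  set G : ℕ → ℂ → ℂ := fun j ζ => ((ρ j : ℂ) ^ k)⁻¹ * F (φ j) (x j + ρ j * ζ)
  have hG : ∀ R > 0, ∀ᶠ j in atTop, DifferentiableOn ℂ (G j) (ball 0 R) ∧
      ∀ ζ ∈ ball (0 : ℂ) R, (1 - (R + 1) / T j) ^ (k + 1) * ‖deriv (G j) ζ‖ ≤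
        N * (1 + ‖G j ζ‖ ^ 2) := by
    intro R hR
    filter_upwards [hTt.eventually_gt_atTop (R + 1)] with j hj
    exact norm_deriv_rescaling_le hr hN (hF _) (hρ j) (hρ1 j) hR hj (hmax j)
  have hθ : ∀ R : ℝ, Tendsto (fun j => (1 - (R + 1) / T j) ^ (k + 1)) atTop (𝓝 1) := by
    intro R
    have : Tendsto (fun j => (1 - (R + 1) / T j)) atTop (𝓝 (1 - 0)) :=
      (tendsto_const_nhds.div_atTop hTt).const_sub 1
    simpa using this.pow (k + 1)
  have hsb : ∀ ζ ∈ (univ : Set ℂ), SphericallyBoundedAt G ζ := by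
    intro ζ _
    have hR : (0 : ℝ) < ‖ζ‖ + 1 := by positivity
    refine ⟨1, one_pos, 2 * N, ?_⟩
    filter_upwards [hG _ hR, (hθ (‖ζ‖ + 1)).eventually (lt_mem_nhds (show (1 / 2 : ℝ) < 1 by norm_num))]
      with j hj1 hj2
    have hsub : ball ζ 1 ⊆ ball 0 (‖ζ‖ + 1) := ball_subset_ball' (by simp [add_comm])
    refine ⟨hj1.1.mono hsub, fun ξ hξ => ?_⟩
    have := hj1.2 ξ (hsub hξ)
    nlinarith [norm_nonneg (deriv (G j) ξ)]
  have hGlow : ∀ j, N * (1 + ‖G j 0‖ ^ 2) ≤ ‖deriv (G j) 0‖ := by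
    intro j
    have h1 := hlow j
    have h2 := hρ j
    simp only [G]
    rw [deriv_const_mul_field, deriv_comp_affine, norm_mul, norm_mul, norm_mul, norm_inv, norm_pow,
      Complex.norm_real, Real.norm_of_nonneg h2.le, mul_zero, add_zero, mul_pow]
    calc N * (1 + ((ρ j ^ k)⁻¹) ^ 2 * ‖F (φ j) (x j)‖ ^ 2)
        = (N * (ρ j ^ (2 * k) + ‖F (φ j) (x j)‖ ^ 2)) * (ρ j ^ (2 * k))⁻¹ := by
          rw [two_mul, pow_add (ρ j) k k]
          field_simp
      _ ≤ (ρ j ^ (k + 1) * ‖deriv (F (φ j)) (x j)‖) * (ρ j ^ (2 * k))⁻¹ := by gcongr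
      _ = (ρ j ^ k)⁻¹ * (ρ j * ‖deriv (F (φ j)) (x j)‖) := by
          rw [pow_succ (ρ j), two_mul, pow_add (ρ j) k k]
          field_simp
  obtain ⟨x₀, hx₀, ψ₁, hψ₁, hx₀lim⟩ := (isCompact_closedBall z₀ r).tendsto_subseq hx
  have hsb' : ∀ ζ ∈ (univ : Set ℂ), SphericallyBoundedAt (fun j => G (ψ₁ j)) ζ := by
    intro ζ hζ
    obtain ⟨s, hs, M, hM⟩ := hsb ζ hζ
    exact ⟨s, hs, M, hψ₁.tendsto_atTop.eventually hM⟩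
  obtain ⟨ψ₂, hψ₂, hlim⟩ := exists_subseq_of_sphericallyBoundedAt isOpen_univ
    isPreconnected_univ hsb'
  set ψ := fun n => ψ₁ (ψ₂ n)
  have hψ : Tendsto ψ atTop atTop := hψ₁.tendsto_atTop.comp hψ₂.tendsto_atTop
  rcases hlim with ⟨g, hg⟩ | hinf
  · have hgψ : ∀ ζ, HolTendstoAt (fun n => G (ψ n)) g ζ := fun ζ => hg ζ (mem_univ _)
    refine ⟨fun n => φ (ψ n), fun n => x (ψ n), fun n => ρ (ψ n), x₀, g,
      (tendsto_atTop_mono hφ tendsto_id).comp hψ, hx₀, hx₀lim.comp hψ₂.tendsto_atTop,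
      fun n => hρ _, hρt.comp hψ, hgψ, fun ζ => ?_, ?_⟩
    · have hR : (0 : ℝ) < ‖ζ‖ + 1 := by positivity
      have h1 := ((hθ (‖ζ‖ + 1)).comp hψ).mul (hgψ ζ).deriv.tendsto_pt.norm
      have h2 := (((hgψ ζ).tendsto_pt.norm.pow 2).const_add 1).const_mul N
      rw [one_mul] at h1
      refine le_of_tendsto_of_tendsto h1 h2 ?_
      filter_upwards [hψ.eventually (hG _ hR)] with n hn
      exact hn.2 ζ (by rw [mem_ball_zero_iff]; linarith)
    · have h2 := (((hgψ 0).tendsto_pt.norm.pow 2).const_add 1).const_mul N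
      exact le_of_tendsto_of_tendsto' h2 (hgψ 0).deriv.tendsto_pt.norm fun n => hGlow _
  · -- the limit `∞` would make the spherical derivatives at `0` tend to `0`
    exfalso
    have h1 := (hinf 0 (mem_univ _)).eventually_norm_deriv_lt
      ⟨1, one_pos, hψ.eventually ((hG 1 one_pos).mono fun n hn => hn.1)⟩ hN
    obtain ⟨n, hn⟩ := h1.exists
    exact absurd (hGlow _) (not_le.2 hn)

/-- If the spherical derivatives of `F n` are not bounded near `z`, they blow up along a
sequence of points tending to `z`. -/
theorem exists_seq_of_not_sphericallyBoundedAt {F : ℕ → ℂ → ℂ} {z : ℂ} {r : ℝ} (hr : 0 < r)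
    (hd : ∀ᶠ n in atTop, DifferentiableOn ℂ (F n) (ball z r)) (h : ¬ SphericallyBoundedAt F z) :
    ∃ (φ : ℕ → ℕ) (w : ℕ → ℂ), Tendsto φ atTop atTop ∧ Tendsto w atTop (𝓝 z) ∧
      ∀ M : ℝ, ∀ᶠ j in atTop, M * (1 + ‖F (φ j) (w j)‖ ^ 2) ≤ ‖deriv (F (φ j)) (w j)‖ := by
  have key : ∀ j : ℕ, ∃ n ≥ j, ∃ w ∈ ball z (1 / ((j : ℝ) + 1)),
      (j : ℝ) * (1 + ‖F n w‖ ^ 2) ≤ ‖deriv (F n) w‖ := by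
    intro j
    by_contra! hcon
    refine h ⟨min r (1 / ((j : ℝ) + 1)), lt_min hr (by positivity), j, ?_⟩
    filter_upwards [hd, eventually_ge_atTop j] with n hn hnj
    exact ⟨hn.mono (ball_subset_ball (min_le_left _ _)), fun w hw =>
      (hcon n hnj w (ball_subset_ball (min_le_right _ _) hw)).le⟩
  choose φ hφ w hw hbig using key
  refine ⟨φ, w, tendsto_atTop_mono hφ tendsto_id, ?_, fun M => ?_⟩
  · exact tendsto_iff_dist_tendsto_zero.2 (squeeze_zero (fun _ => dist_nonneg)
      (fun j => (mem_ball.1 (hw j)).le) tendsto_one_div_add_atTop_nhds_zero_nat)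
  · filter_upwards [tendsto_natCast_atTop_atTop.eventually_ge_atTop M] with j hj
    refine le_trans ?_ (hbig j)
    gcongr

/-- The derivative of `(w - z) ^ (l + 1) * v w` in factored form; it holds near `z` and can
therefore be iterated. -/
theorem deriv_eventuallyEq_of_eq_pow_mul {f v : ℂ → ℂ} {z : ℂ} {l : ℕ} (hv : AnalyticAt ℂ v z)
    (hf : ∀ᶠ w in 𝓝 z, f w = (w - z) ^ (l + 1) * v w) :
    ∀ᶠ w in 𝓝 z, deriv f w = (w - z) ^ l * ((l + 1 : ℕ) * v w + (w - z) * deriv v w) := by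
  filter_upwards [hf.eventually_nhds, hv.eventually_analyticAt] with w h1 h2
  rw [EventuallyEq.deriv_eq h1]
  have h3 := (((hasDerivAt_id w).sub_const z).pow (l + 1)).mul h2.differentiableAt.hasDerivAt
  refine (HasDerivAt.deriv (f := fun w => (w - z) ^ (l + 1) * v w) h3).trans ?_
  simp only [id, add_tsub_cancel_right, Pi.pow_apply]
  push_cast
  ring

theorem iteratedDeriv_eq_of_eq_pow_mul {f v : ℂ → ℂ} {z : ℂ} {k : ℕ} (hv : AnalyticAt ℂ v z)
    (hf : ∀ᶠ w in 𝓝 z, f w = (w - z) ^ k * v w) :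
    iteratedDeriv k f z = k.factorial * v z := by
  induction k generalizing f v with
  | zero => simpa using hf.self_of_nhds
  | succ k ih =>
    rw [iteratedDeriv_succ']
    rw [ih (v := fun w => (k + 1 : ℕ) * v w + (w - z) * deriv v w) (by have := hv.deriv; fun_prop)
      (deriv_eventuallyEq_of_eq_pow_mul hv hf)]
    rw [Nat.factorial_succ]
    push_cast
    ring

/-- Near a zero of order at least `k` whose `k`-th derivative is at most `A`, the rescaled
functions `ζ ↦ ρ⁻ᵏ f (z + ρ ζ)` have spherical derivative less than `(k + 1) ^ k * (A + 1) + 1` at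
the origin for all small `ρ`, uniformly in `z`. -/
theorem eventually_rescaled_spherical_lt {f : ℂ → ℂ} {z₁ : ℂ} {k : ℕ} {A : ℝ} (hk : 1 ≤ k)
    (hA : 0 ≤ A) (hf : AnalyticAt ℂ f z₁)
    (hz : f z₁ = 0 → (∀ j < k, iteratedDeriv j f z₁ = 0) ∧ ‖iteratedDeriv k f z₁‖ ≤ A) :
    ∃ ρ₀ > 0, ∀ᶠ z in 𝓝 z₁, ∀ ρ : ℝ, 0 < ρ → ρ < ρ₀ →
      ρ ^ (k + 1) * ‖deriv f z‖ <
        ((k + 1) ^ k * (A + 1) + 1) * (ρ ^ (2 * k) + ‖f z‖ ^ 2) := by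
  set N : ℝ := (k + 1) ^ k * (A + 1) + 1
  have hN : 1 < N := by
    have : (0 : ℝ) < (k + 1) ^ k * (A + 1) := by positivity
    simp only [N]; linarith
  by_cases h0 : f z₁ = 0
  swap
  · have hc : 0 < ‖f z₁‖ := norm_pos_iff.2 h0
    refine ⟨min 1 (N * (‖f z₁‖ / 2) ^ 2 / (‖deriv f z₁‖ + 1)), by positivity, ?_⟩
    filter_upwards [hf.continuousAt.norm.eventually (lt_mem_nhds (half_lt_self hc)),
      hf.deriv.continuousAt.norm.eventually (gt_mem_nhds (lt_add_one ‖deriv f z₁‖))]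
      with z h1 h2 ρ hρ hρ0
    have hρ1 := hρ0.trans_le (min_le_left _ _)
    have hρ2 := hρ0.trans_le (min_le_right _ _)
    rw [lt_div_iff₀ (by positivity)] at hρ2
    calc ρ ^ (k + 1) * ‖deriv f z‖ ≤ ρ * (‖deriv f z₁‖ + 1) := by
          gcongr
          exact pow_le_of_le_one hρ.le hρ1.le (by omega)
      _ < N * (‖f z₁‖ / 2) ^ 2 := hρ2
      _ ≤ N * (ρ ^ (2 * k) + ‖f z‖ ^ 2) := by
          have h3 : (‖f z₁‖ / 2) ^ 2 ≤ ‖f z‖ ^ 2 := by gcongr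
          have h4 : 0 ≤ ρ ^ (2 * k) := by positivity
          gcongr
          linarith
  obtain ⟨hz1, hz2⟩ := hz h0
  rw [← natCast_le_analyticOrderAt_iff_iteratedDeriv_eq_zero hf] at hz1
  -- `f` vanishes identically near `z₁`, or `f = (z - z₁) ^ (m + 1) * v` with `k ≤ m + 1`
  by_cases htop : analyticOrderAt f z₁ = ⊤
  · refine ⟨1, one_pos, ?_⟩
    filter_upwards [(analyticOrderAt_eq_top.1 htop).eventually_nhds] with z h1 ρ hρ _
    rw [EventuallyEq.deriv_eq (f := fun _ => (0 : ℂ)) h1, deriv_const, norm_zero, mul_zero]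
    positivity
  obtain ⟨l, hl⟩ := ENat.ne_top_iff_exists.1 htop
  rw [← hl, Nat.cast_le] at hz1
  obtain ⟨v, hv, hv0, hfv⟩ := (hf.analyticOrderAt_eq_natCast).1 hl.symm
  simp only [smul_eq_mul] at hfv
  obtain ⟨m, rfl⟩ : ∃ m, l = m + 1 := ⟨l - 1, by omega⟩
  have hvpos : 0 < ‖v z₁‖ := norm_pos_iff.2 hv0
  -- It remains to control the disc `‖z - z₁‖ ≤ (l + 1) * ρ`, where `l = m + 1` is the order.
  obtain ⟨V, hV, ρ₀, hρ₀, hρV⟩ : ∃ V : ℝ, ‖v z₁‖ < V ∧ ∃ ρ₀ > 0, ∀ ρ : ℝ, 0 < ρ → ρ < ρ₀ →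
      (m + 2 : ℝ) ^ (m + 1) * ρ ^ (k + (m + 1)) * V < N * ρ ^ (2 * k) := by
    -- if the order is exactly `k` then `|v z₁| ≤ A`, otherwise a spare factor `ρ` is available
    rcases hz1.eq_or_lt with rfl | hlt
    · refine ⟨A + 1, ?_, 1, one_pos, fun ρ hρ _ => ?_⟩
      · have h1 := iteratedDeriv_eq_of_eq_pow_mul hv hfv
        rw [h1, norm_mul, Complex.norm_natCast] at hz2
        have h2 : (1 : ℝ) ≤ (m + 1).factorial := by exact_mod_cast Nat.one_le_iff_ne_zero.2 (Nat.factorial_ne_zero _)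
        nlinarith
      · have h1 : (m + 2 : ℝ) ^ (m + 1) * (A + 1) < N := by
          simp only [N]
          push_cast
          rw [show (m + 1 + 1 : ℝ) = m + 2 by ring]
          linarith
        rw [two_mul]
        have : 0 < ρ ^ (m + 1 + (m + 1)) := by positivity
        nlinarith
    · refine ⟨‖v z₁‖ + 1, by linarith,
        min 1 ((m + 2 : ℝ) ^ (m + 1) * (‖v z₁‖ + 1))⁻¹, by positivity, fun ρ hρ hρ0 => ?_⟩
      have hρ1 := hρ0.trans_le (min_le_left _ _)
      have hρ2 := hρ0.trans_le (min_le_right _ _)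
      have h1 : (m + 2 : ℝ) ^ (m + 1) * (‖v z₁‖ + 1) * ρ < 1 := by
        rw [lt_inv_comm₀ hρ (by positivity)] at hρ2
        calc _ < ρ⁻¹ * ρ := by gcongr
          _ = 1 := inv_mul_cancel₀ hρ.ne'
      have h2 : ρ ^ (k + (m + 1)) ≤ ρ ^ (2 * k + 1) := pow_le_pow_of_le_one hρ.le hρ1.le (by omega)
      calc (m + 2 : ℝ) ^ (m + 1) * ρ ^ (k + (m + 1)) * (‖v z₁‖ + 1)
          ≤ (m + 2 : ℝ) ^ (m + 1) * ρ ^ (2 * k + 1) * (‖v z₁‖ + 1) := by gcongr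
        _ = ((m + 2 : ℝ) ^ (m + 1) * (‖v z₁‖ + 1) * ρ) * ρ ^ (2 * k) := by ring
        _ < N * ρ ^ (2 * k) := by gcongr; linarith
  refine ⟨ρ₀, hρ₀, ?_⟩
  have hvc : ∀ᶠ z in 𝓝 z₁, ‖(m + 1 : ℕ) * v z + (z - z₁) * deriv v z‖ < (m + 2) * ‖v z‖ := by
    have hdv := hv.deriv.continuousAt
    have hvc := hv.continuousAt
    have c1 : ContinuousAt (fun z => ‖(m + 1 : ℕ) * v z + (z - z₁) * deriv v z‖) z₁ := by fun_prop
    have c2 : ContinuousAt (fun z => (m + 2) * ‖v z‖) z₁ := by fun_prop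
    refine c1.eventually_lt c2 ?_
    rw [sub_self, zero_mul, add_zero, norm_mul, Complex.norm_natCast]
    push_cast
    nlinarith
  filter_upwards [hfv, deriv_eventuallyEq_of_eq_pow_mul hv hfv, hvc,
    hv.continuousAt.norm.eventually (gt_mem_nhds hV)] with z h1 h2 h3 h4 ρ hρ hρ0
  -- with `y = |z - z₁|`: for `y ≤ (m + 2) ρ` the left side is dominated by `ρ ^ (2 * k)`, for larger
  -- `y` it is dominated by `ρ ^ k * |f z|`
  set y := ‖z - z₁‖
  have hy : 0 ≤ y := norm_nonneg _
  have h5 : ‖deriv f z‖ ≤ y ^ m * ((m + 2) * ‖v z‖) := by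
    rw [h2, norm_mul, norm_pow]
    gcongr
  have h6 : ‖f z‖ = y ^ (m + 1) * ‖v z‖ := by rw [h1, norm_mul, norm_pow]
  rcases le_total y ((m + 2) * ρ) with hle | hge
  · calc ρ ^ (k + 1) * ‖deriv f z‖ ≤ ρ ^ (k + 1) * (((m + 2) * ρ) ^ m * ((m + 2) * V)) := by
          refine mul_le_mul_of_nonneg_left (h5.trans ?_) (by positivity)
          gcongr
      _ = (m + 2 : ℝ) ^ (m + 1) * ρ ^ (k + (m + 1)) * V := by rw [mul_pow]; ring
      _ < N * ρ ^ (2 * k) := hρV ρ hρ hρ0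
      _ ≤ _ := by gcongr; nlinarith [sq_nonneg ‖f z‖]
  · have h7 : ρ ^ (k + 1) * ‖deriv f z‖ ≤ ρ ^ k * ‖f z‖ := by
      calc ρ ^ (k + 1) * ‖deriv f z‖ ≤ ρ ^ (k + 1) * (y ^ m * ((m + 2) * ‖v z‖)) := by gcongr
        _ = ρ ^ k * (((m + 2) * ρ) * (y ^ m * ‖v z‖)) := by ring
        _ ≤ ρ ^ k * (y * (y ^ m * ‖v z‖)) := by gcongr
        _ = ρ ^ k * ‖f z‖ := by rw [h6]; ring
    have h8 : 0 < ρ ^ (2 * k) := by positivity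
    have h9 : ρ ^ (2 * k) = (ρ ^ k) ^ 2 := by rw [← pow_mul, mul_comm]
    have h10 : 0 ≤ ‖f z‖ ^ 2 := by positivity
    nlinarith [sq_nonneg (ρ ^ k - ‖f z‖)]

/-- The small-scale hypothesis of the Zalcman–Pang lemma, for functions whose zeros have
multiplicity at least `k` and at whose zeros the `k`-th derivative is at most `A`. -/
theorem exists_rescaled_spherical_lt {f : ℂ → ℂ} {z₀ : ℂ} {r : ℝ} {k : ℕ} {A : ℝ} (hr : 0 < r)
    (hk : 1 ≤ k) (hA : 0 ≤ A) (hf : DifferentiableOn ℂ f (ball z₀ (2 * r)))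
    (hz : ∀ z ∈ ball z₀ (2 * r), f z = 0 →
      (∀ j < k, iteratedDeriv j f z = 0) ∧ ‖iteratedDeriv k f z‖ ≤ A) :
    ∃ ρ₀ > 0, ∀ ρ : ℝ, 0 < ρ → ρ < ρ₀ → ∀ z ∈ closedBall z₀ r,
      ρ ^ (k + 1) * ‖deriv f z‖ <
        ((k + 1) ^ k * (A + 1) + 1) * (ρ ^ (2 * k) + ‖f z‖ ^ 2) := by
  refine (isCompact_closedBall z₀ r).induction_on
    (p := fun s => ∃ ρ₀ > 0, ∀ ρ : ℝ, 0 < ρ → ρ < ρ₀ → ∀ z ∈ s,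
      ρ ^ (k + 1) * ‖deriv f z‖ <
        ((k + 1) ^ k * (A + 1) + 1) * (ρ ^ (2 * k) + ‖f z‖ ^ 2)) ?_ ?_ ?_ ?_
  · exact ⟨1, one_pos, fun _ _ _ z hz => absurd hz (notMem_empty z)⟩
  · rintro s t hst ⟨ρ₀, hρ₀, h⟩
    exact ⟨ρ₀, hρ₀, fun ρ h1 h2 z hz => h ρ h1 h2 z (hst hz)⟩
  · rintro s t ⟨ρ₀, hρ₀, h⟩ ⟨ρ₁, hρ₁, h'⟩
    refine ⟨min ρ₀ ρ₁, lt_min hρ₀ hρ₁, fun ρ h1 h2 z hz => ?_⟩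
    rcases hz with hz | hz
    · exact h ρ h1 (h2.trans_le (min_le_left _ _)) z hz
    · exact h' ρ h1 (h2.trans_le (min_le_right _ _)) z hz
  · intro z hzr
    have hzb : z ∈ ball z₀ (2 * r) := closedBall_subset_ball (by linarith) hzr
    obtain ⟨ρ₀, hρ₀, h⟩ := eventually_rescaled_spherical_lt hk hA
      (hf.analyticAt (isOpen_ball.mem_nhds hzb)) (hz z hzb)
    exact ⟨_, mem_nhdsWithin_of_mem_nhds h, ρ₀, hρ₀, fun ρ h1 h2 w hw => hw ρ h1 h2⟩

/-- The small-scale hypothesis of the Zalcman–Pang lemma holds for the exponent `0`. -/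
theorem exists_rescaled_spherical_lt_zero {f : ℂ → ℂ} {z₀ : ℂ} {r : ℝ} (hr : 0 < r)
    (hf : DifferentiableOn ℂ f (ball z₀ (2 * r))) :
    ∃ ρ₀ > 0, ∀ ρ : ℝ, 0 < ρ → ρ < ρ₀ → ∀ z ∈ closedBall z₀ r,
      ρ ^ (0 + 1) * ‖deriv f z‖ < 1 * (ρ ^ (2 * 0) + ‖f z‖ ^ 2) := by
  have hsub : closedBall z₀ r ⊆ ball z₀ (2 * r) := closedBall_subset_ball (by linarith)
  obtain ⟨C, hC⟩ := (isCompact_closedBall z₀ r).exists_bound_of_continuousOn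
    ((hf.deriv isOpen_ball).continuousOn.mono hsub)
  have hC0 : 0 ≤ C := (norm_nonneg _).trans (hC z₀ (mem_closedBall_self hr.le))
  refine ⟨(C + 1)⁻¹, by positivity, fun ρ hρ hρ0 z hz => ?_⟩
  have h1 := hC z hz
  rw [lt_inv_comm₀ hρ (by positivity)] at hρ0
  have h2 : ρ * (C + 1) < 1 := by
    calc _ < ρ * ρ⁻¹ := by gcongr
      _ = 1 := mul_inv_cancel₀ hρ.ne'
  simp only [zero_add, pow_one, mul_zero, pow_zero, one_mul]
  nlinarith [sq_nonneg ‖f z‖]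

/-! ### Entire functions with bounded spherical derivative -/

/-- An entire function with `|f| ≤ C t ^ d` on circles `|z| = t` with `t → ∞` has vanishing
derivatives of order greater than `d` at the origin. -/
theorem iteratedDeriv_eq_zero_of_growth {f : ℂ → ℂ} (hf : Differentiable ℂ f) {t : ℕ → ℝ}
    (ht : Tendsto t atTop atTop) {C : ℝ} {d m : ℕ} (hdm : d < m)
    (hb : ∀ᶠ j in atTop, ∀ z ∈ sphere (0 : ℂ) (t j), ‖f z‖ ≤ C * t j ^ d) :
    iteratedDeriv m f 0 = 0 := by
  have h1 : Tendsto (fun j => m.factorial * C / t j ^ (m - d)) atTop (𝓝 0) :=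
    tendsto_const_nhds.div_atTop ((tendsto_pow_atTop (by omega)).comp ht)
  have h2 : ‖iteratedDeriv m f 0‖ ≤ 0 := by
    refine ge_of_tendsto h1 ?_
    filter_upwards [hb, ht.eventually_gt_atTop 0] with j hj hpos
    have h3 := Complex.norm_iteratedDeriv_le_of_forall_mem_sphere_norm_le m hpos
      hf.diffContOnCl hj
    refine h3.trans_eq ?_
    obtain ⟨e, rfl⟩ := Nat.exists_eq_add_of_lt hdm
    rw [show d + e + 1 - d = e + 1 by omega, show d + e + 1 = d + (e + 1) by ring, pow_add]
    field_simp
  exact norm_le_zero_iff.1 h2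

theorem eq_sum_of_iteratedDeriv_eq_zero {f : ℂ → ℂ} (hf : Differentiable ℂ f) {K : ℕ}
    (h : ∀ m ≥ K, iteratedDeriv m f 0 = 0) (z : ℂ) :
    f z = ∑ n ∈ Finset.range K, (n.factorial : ℂ)⁻¹ * iteratedDeriv n f 0 * z ^ n := by
  rw [← Complex.taylorSeries_eq_of_entire' 0 z hf, tsum_eq_sum (s := Finset.range K)]
  · simp
  · intro n hn
    rw [h n (by simpa using hn)]
    simp

theorem exists_polynomial_of_iteratedDeriv_eq_zero {f : ℂ → ℂ} (hf : Differentiable ℂ f) {K : ℕ}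
    (h : ∀ m ≥ K, iteratedDeriv m f 0 = 0) :
    ∃ p : Polynomial ℂ, (∀ z, f z = p.eval z) ∧
      ∀ n, p.coeff n = (n.factorial : ℂ)⁻¹ * iteratedDeriv n f 0 := by
  refine ⟨∑ n ∈ Finset.range K,
    Polynomial.C ((n.factorial : ℂ)⁻¹ * iteratedDeriv n f 0) * Polynomial.X ^ n, fun z => ?_,
    fun n => ?_⟩
  · rw [eq_sum_of_iteratedDeriv_eq_zero hf h, Polynomial.eval_finsetSum]
    simp
  · rw [Polynomial.finsetSum_coeff]
    simp only [Polynomial.coeff_C_mul_X_pow]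
    by_cases hn : n < K
    · rw [Finset.sum_eq_single n] <;> simp +contextual [hn, eq_comm]
    · rw [h n (not_lt.1 hn), Finset.sum_eq_zero, mul_zero]
      intro m hm
      rw [if_neg]
      rintro rfl
      exact hn (Finset.mem_range.1 hm)

theorem iteratedDeriv_eq_zero_of_le {f : ℂ → ℂ} {k m : ℕ} (h : ∀ z, iteratedDeriv k f z = 0)
    (hkm : k ≤ m) (z : ℂ) : iteratedDeriv m f z = 0 := by
  induction m, hkm using Nat.le_induction generalizing z with
  | base => exact h z
  | succ m _ ih =>
    rw [iteratedDeriv_succ, show iteratedDeriv m f = fun _ => 0 from funext ih, deriv_const]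

/-- A polynomial of degree less than `k` with a zero of multiplicity at least `k` vanishes. -/
theorem eq_zero_of_iteratedDeriv_eq_zero {f : ℂ → ℂ} (hf : Differentiable ℂ f) {k : ℕ} {z₁ : ℂ}
    (h : ∀ z, iteratedDeriv k f z = 0) (h1 : ∀ j < k, iteratedDeriv j f z₁ = 0) (z : ℂ) :
    f z = 0 := by
  rw [← Complex.taylorSeries_eq_of_entire' z₁ z hf]
  have h2 : ∀ n, iteratedDeriv n f z₁ = 0 := fun n =>
    (lt_or_ge n k).elim (h1 n) fun hn => iteratedDeriv_eq_zero_of_le h hn z₁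
  simp [h2]

/-- **Harnack's inequality** (lower bound) for the positive real part of a holomorphic function. -/
theorem harnack_re {h : ℂ → ℂ} {w z : ℂ} {R : ℝ} (hR : 0 < R)
    (hd : DifferentiableOn ℂ h (ball w R)) (hpos : ∀ x ∈ ball w R, 0 < (h x).re)
    (hz : z ∈ ball w R) :
    (R - dist z w) * (h w).re ≤ (R + dist z w) * (h z).re := by
  have hw := mem_ball_self (x := w) hR
  have hne : ∀ x ∈ ball w R, h x + (starRingEnd ℂ) (h w) ≠ 0 := fun x hx h0 => by
    have := congrArg Complex.re h0
    simp only [Complex.add_re, Complex.conj_re, Complex.zero_re] at this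
    linarith [hpos x hx, hpos w hw]
  set φ : ℂ → ℂ := fun x => (h x - h w) / (h x + (starRingEnd ℂ) (h w))
  have hφ : DifferentiableOn ℂ φ (ball w R) := (hd.sub_const _).div (hd.add_const _) hne
  -- `φ` is a Cayley transform of `h`, so Schwarz's lemma applies
  have hsq : ∀ x, ‖h x - h w‖ ^ 2 = ((h x).re - (h w).re) ^ 2 + ((h x).im - (h w).im) ^ 2 := by
    intro x
    rw [Complex.sq_norm, Complex.normSq_apply]
    simp only [Complex.sub_re, Complex.sub_im]; ring
  have hsq' : ∀ x, ‖h x + (starRingEnd ℂ) (h w)‖ ^ 2 =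
      ((h x).re + (h w).re) ^ 2 + ((h x).im - (h w).im) ^ 2 := by
    intro x
    rw [Complex.sq_norm, Complex.normSq_apply]
    simp only [Complex.add_re, Complex.add_im, Complex.conj_re, Complex.conj_im]; ring
  have hφw : φ w = 0 := by simp [φ]
  have hmaps : MapsTo φ (ball w R) (closedBall (φ w) 1) := by
    intro x hx
    rw [hφw, mem_closedBall_zero_iff, norm_div]
    refine div_le_one_of_le₀ ?_ (norm_nonneg _)
    refine le_of_sq_le_sq ?_ (norm_nonneg _)
    rw [hsq, hsq']
    nlinarith [mul_pos (hpos x hx) (hpos w hw)]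
  have hS := Complex.dist_le_div_mul_dist_of_mapsTo_ball hφ hmaps hz
  rw [hφw, dist_zero_right, norm_div, div_le_iff₀ (norm_pos_iff.2 (hne z hz))] at hS
  set s := 1 / R * dist z w
  have hs0 : 0 ≤ s := by positivity
  have hs1 : s < 1 := by
    simp only [s, one_div]
    rw [inv_mul_lt_iff₀ hR, mul_one]
    exact hz
  have h1 : ((h z).re - (h w).re) ^ 2 ≤ (s * ((h z).re + (h w).re)) ^ 2 := by
    have h2 : ‖h z - h w‖ ^ 2 ≤ (s * ‖h z + (starRingEnd ℂ) (h w)‖) ^ 2 := by gcongr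
    rw [mul_pow, hsq, hsq'] at h2
    have h3 : s ^ 2 ≤ 1 := by nlinarith
    have h4 := mul_nonneg (sub_nonneg.2 h3) (sq_nonneg ((h z).im - (h w).im))
    nlinarith
  have h5 := abs_le_of_sq_le_sq h1 (by have := hpos z hz; have := hpos w hw; positivity)
  have h6 : dist z w = s * R := by simp only [s]; field_simp
  rw [h6]
  nlinarith [(abs_le.1 h5).1]

/-- A zero-free holomorphic function whose logarithmic derivative has a primitive has a holomorphic
logarithm. -/
theorem exists_log {g : ℂ → ℂ} {U : Set ℂ} (hU : IsOpen U) (hUc : Convex ℝ U) {w : ℂ} (hw : w ∈ U)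
    (hg : DifferentiableOn ℂ g U) (h0 : ∀ z ∈ U, g z ≠ 0)
    (hex : Complex.IsExactOn (fun z => deriv g z / g z) U) :
    ∃ h : ℂ → ℂ, DifferentiableOn ℂ h U ∧ ∀ z ∈ U, Complex.exp (h z) = g z := by
  obtain ⟨h, hhw, hh⟩ := hex.with_val_at w (Complex.log (g w))
  refine ⟨h, fun z hz => (hh z hz).differentiableAt.differentiableWithinAt, ?_⟩
  set F : ℂ → ℂ := fun z => g z * Complex.exp (-h z)
  have hF : ∀ z ∈ U, HasDerivAt F 0 z := by
    intro z hz
    have h1 := (hg.differentiableAt (hU.mem_nhds hz)).hasDerivAt.mul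
      ((hh z hz).fun_neg.cexp)
    have h2 : deriv g z * Complex.exp (-h z) + g z * (Complex.exp (-h z) * -(deriv g z / g z)) = 0 := by
      have := h0 z hz
      field_simp
      ring
    rw [← h2]
    exact h1
  have hconst : ∀ z ∈ U, F z = F w := fun z hz =>
    hUc.is_const_of_fderivWithin_eq_zero (𝕜 := ℂ)
      (fun x hx => (hF x hx).differentiableAt.differentiableWithinAt)
      (fun x hx => by
        rw [fderivWithin_of_isOpen hU hx]
        have := (hF x hx).hasFDerivAt.fderiv
        simpa using this) hz hw
  intro z hz
  have h2 := hconst z hz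
  simp only [F, hhw] at h2
  rw [Complex.exp_neg, Complex.exp_neg, Complex.exp_log (h0 w hw), mul_inv_cancel₀ (h0 w hw)] at h2
  exact (mul_inv_eq_one₀ (Complex.exp_ne_zero _)).1 h2 |>.symm

/-- An entire function with spherical derivative at most `N` grows at most exponentially.
At a point `w` with `1 < ‖g w‖`, let `w'` be the nearest point with `‖g w'‖ ≤ 1`. On the disc around
`w` through `w'` the function `log ‖g‖` is positive and harmonic, so by Harnack's inequality it
leaves the boundary value `0` at `w'` with slope at least `log ‖g w‖ / (2 * dist w w')`, while its
slope there is at most `2 * N`. -/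
theorem norm_le_exp_of_spherical_deriv_le {g : ℂ → ℂ} {N : ℝ} (hg : Differentiable ℂ g)
    (hN : 0 ≤ N) (hb : ∀ z, ‖deriv g z‖ ≤ N * (1 + ‖g z‖ ^ 2)) {p₀ : ℂ} (hp₀ : ‖g p₀‖ ≤ 1) (w : ℂ) :
    ‖g w‖ ≤ Real.exp (4 * N * dist w p₀) := by
  rcases le_or_gt ‖g w‖ 1 with hw1 | hw1
  · exact hw1.trans (Real.one_le_exp (by positivity))
  set Z : Set ℂ := {z | ‖g z‖ ≤ 1}
  have hZ : IsClosed Z := isClosed_le hg.continuous.norm continuous_const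
  obtain ⟨w', hw'Z, hw'⟩ := hZ.exists_infDist_eq_dist ⟨p₀, hp₀⟩ w
  set R := dist w w'
  have hR : 0 < R := by
    refine dist_pos.2 ?_
    rintro rfl
    exact absurd hw'Z (not_le.2 hw1)
  have hRp : R ≤ dist w p₀ := hw' ▸ infDist_le_dist_of_mem hp₀
  have hout : ∀ z ∈ ball w R, 1 < ‖g z‖ := by
    intro z hz
    by_contra! hcon
    have h1 := infDist_le_dist_of_mem (x := w) (show z ∈ Z from hcon)
    rw [hw'] at h1
    rw [mem_ball, dist_comm] at hz
    linarith
  have hne0 : ∀ z ∈ ball w R, g z ≠ 0 := fun z hz h0 => by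
    have := hout z hz
    rw [h0, norm_zero] at this
    linarith
  obtain ⟨h, hhd, hh⟩ := exists_log isOpen_ball (convex_ball w R) (mem_ball_self hR)
    hg.differentiableOn hne0 (DifferentiableOn.isExactOn_ball
      ((hg.differentiableOn.deriv isOpen_ball).fun_div hg.differentiableOn hne0))
  have hre : ∀ z ∈ ball w R, Real.exp (h z).re = ‖g z‖ := fun z hz => by
    rw [← hh z hz, Complex.norm_exp]
  have hpos : ∀ z ∈ ball w R, 0 < (h z).re := fun z hz => by
    have := hout z hz
    rw [← hre z hz] at this
    exact Real.one_lt_exp_iff.1 this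
  have hww := mem_ball_self (x := w) hR
  set L := (h w).re
  have hLpos : 0 < L := hpos w hww
  have hv : ‖w - w'‖ = R := (dist_eq_norm _ _).symm
  have hslope : ∀ t : ℝ, 0 < t → t ≤ 1 → L / 2 ≤ ‖t⁻¹ • (g (w' + ((0 + t : ℝ) : ℂ) * (w - w')) -
      g (w' + ((0 : ℝ) : ℂ) * (w - w')))‖ := by
    intro t ht ht1
    set z := w' + (t : ℂ) * (w - w')
    have hzw : dist z w = (1 - t) * R := by
      rw [dist_eq_norm, show z - w = -(((1 - t : ℝ) : ℂ) * (w - w')) by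
        simp only [z]; push_cast; ring, norm_neg, norm_mul, hv, Complex.norm_real,
        Real.norm_of_nonneg (by linarith)]
    have hz : z ∈ ball w R := by rw [mem_ball, hzw]; nlinarith
    have h1 := harnack_re hR hhd hpos hz
    rw [hzw] at h1
    have h2 : t * L ≤ 2 * (h z).re := by
      have h3 : R * (t * L) ≤ R * ((2 - t) * (h z).re) := by
        calc R * (t * L) = (R - (1 - t) * R) * L := by ring
          _ ≤ _ := h1
          _ = _ := by ring
      have h4 := le_of_mul_le_mul_left h3 hR
      nlinarith [hpos z hz]
    have h5 : (h z).re ≤ ‖g z - g w'‖ := by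
      have h6 := Real.add_one_le_exp (h z).re
      rw [hre z hz] at h6
      have h7 := norm_sub_norm_le (g z) (g w')
      have h8 : ‖g w'‖ ≤ 1 := hw'Z
      linarith
    rw [norm_smul, Real.norm_of_nonneg (by positivity), zero_add, Complex.ofReal_zero, zero_mul,
      add_zero, le_inv_mul_iff₀ ht]
    linarith
  have hder : HasDerivAt (fun t : ℝ => g (w' + (t : ℂ) * (w - w'))) (deriv g w' * (w - w')) 0 := by
    have h1 : HasDerivAt (fun t : ℂ => w' + t * (w - w')) (w - w') ((0 : ℝ) : ℂ) := by
      simpa using ((hasDerivAt_id ((0 : ℝ) : ℂ)).mul_const (w - w')).const_add w'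
    have h2 : HasDerivAt g (deriv g w') (w' + ((0 : ℝ) : ℂ) * (w - w')) := by
      simpa using (hg w').hasDerivAt
    exact (HasDerivAt.comp ((0 : ℝ) : ℂ) (h := fun t : ℂ => w' + t * (w - w')) h2 h1).comp_ofReal
  have hlim := (hasDerivAt_iff_tendsto_slope_zero.1 hder).norm
  have hfin : L / 2 ≤ ‖deriv g w' * (w - w')‖ := by
    refine ge_of_tendsto (hlim.mono_left (nhdsWithin_mono (0 : ℝ) (s := Ioi 0)
      fun t (ht : 0 < t) => ht.ne')) ?_
    filter_upwards [Ioc_mem_nhdsGT (show (0 : ℝ) < 1 by norm_num)] with t ht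
    exact hslope t ht.1 ht.2
  rw [norm_mul, hv] at hfin
  have h9 : ‖deriv g w'‖ ≤ 2 * N := by
    refine (hb w').trans ?_
    have h8 : ‖g w'‖ ≤ 1 := hw'Z
    have : ‖g w'‖ ^ 2 ≤ 1 := by nlinarith [norm_nonneg (g w')]
    nlinarith
  have hL : L ≤ 4 * N * dist w p₀ := by
    have : ‖deriv g w'‖ * R ≤ 2 * N * dist w p₀ := by gcongr
    linarith
  rw [← hre w hww]
  exact Real.exp_le_exp.2 hL

/-- A version of `norm_le_exp_of_spherical_deriv_le` without a base point: if there is no point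
with `‖g p₀‖ ≤ 1`, then `g` is constant by Liouville's theorem. -/
theorem exists_exp_bound_of_spherical_deriv_le {g : ℂ → ℂ} {N : ℝ} (hg : Differentiable ℂ g)
    (hN : 0 ≤ N) (hb : ∀ z, ‖deriv g z‖ ≤ N * (1 + ‖g z‖ ^ 2)) :
    ∃ C > 0, ∀ z, ‖g z‖ ≤ Real.exp (C * (1 + ‖z‖)) := by
  by_cases hp : ∃ p₀, ‖g p₀‖ ≤ 1
  · obtain ⟨p₀, hp₀⟩ := hp
    refine ⟨4 * N * (1 + ‖p₀‖) + 1, by positivity, fun z => ?_⟩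
    refine (norm_le_exp_of_spherical_deriv_le hg hN hb hp₀ z).trans (Real.exp_le_exp.2 ?_)
    have h1 : dist z p₀ ≤ ‖z‖ + ‖p₀‖ := dist_le_norm_add_norm _ _
    have h2 : ‖z‖ + ‖p₀‖ ≤ (1 + ‖p₀‖) * (1 + ‖z‖) := by
      nlinarith [norm_nonneg z, norm_nonneg p₀]
    have h3 : 4 * N * dist z p₀ ≤ 4 * N * ((1 + ‖p₀‖) * (1 + ‖z‖)) := by gcongr; linarith
    nlinarith [norm_nonneg z]
  · push Not at hp
    have hne : ∀ z, g z ≠ 0 := fun z h0 => by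
      have := hp z
      rw [h0, norm_zero] at this
      linarith
    obtain ⟨c, hc⟩ := (hg.inv hne).exists_const_forall_eq_of_bounded (by
      rw [isBounded_iff_forall_norm_le]
      refine ⟨1, ?_⟩
      rintro _ ⟨z, rfl⟩
      simp only [Pi.inv_apply, norm_inv]
      exact inv_le_one_of_one_le₀ (hp z).le)
    refine ⟨‖c⁻¹‖ + 1, by positivity, fun z => ?_⟩
    have h1 : g z = c⁻¹ := by rw [← hc z, Pi.inv_apply, inv_inv]
    rw [h1]
    have h2 := Real.add_one_le_exp ((‖c⁻¹‖ + 1) * (1 + ‖z‖))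
    nlinarith [norm_nonneg z, norm_nonneg c⁻¹]

/-- A zero-free entire function of exponential type is the exponential of an affine function. -/
theorem eq_exp_of_exp_bound {f : ℂ → ℂ} (hf : Differentiable ℂ f) (h0 : ∀ z, f z ≠ 0) {C : ℝ}
    (hC : 0 < C) (hb : ∀ z, ‖f z‖ ≤ Real.exp (C * (1 + ‖z‖))) :
    ∃ c d : ℂ, ∀ z, f z = Complex.exp (c * z + d) := by
  obtain ⟨h, hh, hexp⟩ : ∃ h : ℂ → ℂ, Differentiable ℂ h ∧ ∀ z, Complex.exp (h z) = f z := by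
    have hfd : Differentiable ℂ (deriv f) := fun z => hf.analyticAt z |>.deriv.differentiableAt
    obtain ⟨h, hh, hexp⟩ := exists_log isOpen_univ convex_univ (mem_univ 0) hf.differentiableOn
      (fun z _ => h0 z) (hfd.fun_div hf h0).isExactOn_univ
    exact ⟨h, differentiableOn_univ.1 hh, fun z => hexp z (mem_univ z)⟩
  have hre : ∀ z, (h z).re ≤ C * (1 + ‖z‖) := fun z => by
    have := hb z
    rw [← hexp z, Complex.norm_exp] at this
    exact Real.exp_le_exp.1 this
  have hgrow : ∀ᶠ j : ℕ in atTop, ∀ z ∈ sphere (0 : ℂ) (j : ℝ),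
      ‖h z‖ ≤ (6 * C + 3 * ‖h 0‖) * (j : ℝ) ^ 1 := by
    filter_upwards [eventually_ge_atTop 1] with j hj z hz
    have hj' : (1 : ℝ) ≤ j := by exact_mod_cast hj
    rw [mem_sphere_zero_iff_norm] at hz
    have h1 := Complex.borelCaratheodory (f := h) (M := C * (1 + 2 * j)) (R := 2 * j) (z := z)
      (by positivity) hh.differentiableOn (fun x hx => (hre x).trans (by
        rw [mem_ball_zero_iff] at hx
        gcongr)) (by positivity) (by rw [mem_ball_zero_iff, hz]; linarith)
    rw [hz] at h1
    have e1 : (2 * j - j : ℝ) = j := by ring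
    have e2 : (2 * j + j : ℝ) = 3 * j := by ring
    rw [e1, e2] at h1
    have e3 : 2 * (C * (1 + 2 * j)) * j / (j : ℝ) = 2 * (C * (1 + 2 * j)) := by field_simp
    have e4 : ‖h 0‖ * (3 * j) / (j : ℝ) = 3 * ‖h 0‖ := by field_simp
    rw [e3, e4] at h1
    nlinarith [norm_nonneg (h 0)]
  have hlin := eq_sum_of_iteratedDeriv_eq_zero hh (K := 2) fun m hm =>
    iteratedDeriv_eq_zero_of_growth hh tendsto_natCast_atTop_atTop (show 1 < m by omega) hgrow
  refine ⟨deriv h 0, h 0, fun z => ?_⟩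
  rw [← hexp z, hlin z]
  simp [Finset.sum_range_succ]
  ring_nf

/-- An entire function that is bounded away from `0` near infinity is a polynomial, since its
reciprocal has a removable singularity at infinity. -/
theorem exists_polynomial_of_one_le_norm {g : ℂ → ℂ} (hg : Differentiable ℂ g) {R : ℝ}
    (hR : 0 < R) (h1 : ∀ z, R < ‖z‖ → 1 ≤ ‖g z‖) : ∃ p : Polynomial ℂ, ∀ z, g z = p.eval z := by
  set s := ball (0 : ℂ) R⁻¹
  have hs : s ∈ 𝓝 (0 : ℂ) := ball_mem_nhds _ (inv_pos.2 hR)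
  set v : ℂ → ℂ := fun z => (g z⁻¹)⁻¹
  have hlarge : ∀ z ∈ s \ {0}, 1 ≤ ‖g z⁻¹‖ := by
    rintro z ⟨hz, hz0⟩
    apply h1
    rw [mem_ball_zero_iff] at hz
    rw [norm_inv]
    exact (lt_inv_comm₀ (norm_pos_iff.2 hz0) hR).1 hz
  have hne : ∀ z ∈ s \ {0}, g z⁻¹ ≠ 0 := fun z hz h0 => by
    have := hlarge z hz
    rw [h0, norm_zero] at this
    linarith
  have hvd : DifferentiableOn ℂ v (s \ {0}) := by
    refine DifferentiableOn.inv ?_ hne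
    exact hg.comp_differentiableOn (differentiableOn_inv.mono fun z hz => hz.2)
  have hV := Complex.differentiableOn_update_limUnder_of_bddAbove hs hvd ⟨1, by
    rintro _ ⟨z, hz, rfl⟩
    simp only [v, Function.comp_apply, norm_inv]
    exact inv_le_one_of_one_le₀ (hlarge z hz)⟩
  set V := Function.update v 0 (limUnder (𝓝[≠] 0) v)
  have hVv : ∀ z, z ≠ 0 → V z = v z := fun z hz => Function.update_of_ne hz _ _
  have hVa : AnalyticAt ℂ V 0 := hV.analyticAt hs
  have hVne : ¬ ∀ᶠ z in 𝓝 (0 : ℂ), V z = 0 := by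
    intro hev
    have h2 : ∀ᶠ z in 𝓝[≠] (0 : ℂ), False := by
      filter_upwards [nhdsWithin_le_nhds hev, nhdsWithin_le_nhds hs, self_mem_nhdsWithin]
        with z hz hzs hz0
      rw [hVv z hz0] at hz
      exact hne z ⟨hzs, hz0⟩ (inv_eq_zero.1 hz)
    exact h2.exists.elim fun _ h => h
  -- the order `n` of the zero of `1 / g (1 / z)` at `0` bounds the growth of `g`
  obtain ⟨n, u, hu, hu0, hVu⟩ := hVa.exists_eventuallyEq_pow_smul_nonzero_iff.2 hVne
  have hup : 0 < ‖u 0‖ := norm_pos_iff.2 hu0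
  have hev := hVu.and (hu.continuousAt.norm.eventually (lt_mem_nhds (half_lt_self hup)))
  obtain ⟨δ, hδ, hδ'⟩ := Metric.eventually_nhds_iff_ball.1 hev
  have hgrow : ∀ᶠ j : ℕ in atTop, ∀ z ∈ sphere (0 : ℂ) (j : ℝ),
      ‖g z‖ ≤ (2 / ‖u 0‖) * (j : ℝ) ^ n := by
    filter_upwards [tendsto_natCast_atTop_atTop.eventually_gt_atTop δ⁻¹,
      eventually_gt_atTop 0] with j hj hj0 z hz
    rw [mem_sphere_zero_iff_norm] at hz
    have hj' : (0 : ℝ) < j := by exact_mod_cast hj0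
    have hz0 : z ≠ 0 := by rintro rfl; rw [norm_zero] at hz; linarith
    have hzi : z⁻¹ ∈ ball (0 : ℂ) δ := by
      rw [mem_ball_zero_iff, norm_inv, hz]
      exact (inv_lt_comm₀ hδ hj').1 hj
    obtain ⟨h2, h3⟩ := hδ' _ hzi
    rw [hVv _ (inv_ne_zero hz0), sub_zero, smul_eq_mul] at h2
    simp only [v, inv_inv] at h2
    have h4 : ‖g z‖⁻¹ = (j : ℝ)⁻¹ ^ n * ‖u z⁻¹‖ := by
      rw [← norm_inv, h2, norm_mul, norm_pow, norm_inv, hz]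
    have h5 : (j : ℝ)⁻¹ ^ n * (‖u 0‖ / 2) ≤ ‖g z‖⁻¹ := by rw [h4]; gcongr
    have h6 := inv_anti₀ (by positivity) h5
    rw [inv_inv] at h6
    refine h6.trans_eq ?_
    rw [mul_inv, inv_pow, inv_inv, inv_div]
    ring
  obtain ⟨p, hp, -⟩ := exists_polynomial_of_iteratedDeriv_eq_zero hg (K := n + 1) fun m hm =>
    iteratedDeriv_eq_zero_of_growth hg tendsto_natCast_atTop_atTop (show n < m by omega) hgrow
  exact ⟨p, hp⟩

theorem iteratedDeriv_exp_affine (k : ℕ) (c d z : ℂ) :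
    iteratedDeriv k (fun x => Complex.exp (c * x + d)) z = c ^ k * Complex.exp (c * z + d) := by
  have h := iteratedDeriv_comp_affine k Complex.exp d c z
  have h2 : iteratedDeriv k Complex.exp = Complex.exp := by
    rw [iteratedDeriv_eq_iterate, Complex.iter_deriv_exp]
  rw [h2] at h
  simpa only [add_comm] using h

/-- An entire function with bounded spherical derivative cannot satisfy
`g⁽ᵏ⁾ = B + exp (c z + d)` with `B, c ≠ 0`: where `|g| ≤ 1`, the nonconstant polynomial
`c Q - Q' = c g - g'` is bounded, `Q` being the polynomial part of `g`. Hence `|g| > 1` off a disc,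
so `g` is a polynomial. -/
theorem not_iteratedDeriv_eq_const_add_exp {g : ℂ → ℂ} (hg : Differentiable ℂ g) {N : ℝ}
    (hb : ∀ z, ‖deriv g z‖ ≤ N * (1 + ‖g z‖ ^ 2)) {k : ℕ} (hk : 1 ≤ k) {B c d : ℂ} (hB : B ≠ 0)
    (hc : c ≠ 0) (h : ∀ z, iteratedDeriv k g z = B + Complex.exp (c * z + d)) : False := by
  -- `g = Q + e` with `e` the `k`-fold primitive of `exp (c z + d)` and `Q` a polynomial
  set e : ℂ → ℂ := fun z => (c ^ k)⁻¹ * Complex.exp (c * z + d)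
  have he : Differentiable ℂ e := by fun_prop
  have hf1 : Differentiable ℂ (fun z => g z - e z) := hg.sub he
  have hke : ∀ z, iteratedDeriv k (fun z => g z - e z) z = B := by
    intro z
    rw [iteratedDeriv_fun_sub hg.contDiff.contDiffAt he.contDiff.contDiffAt, h]
    simp only [e]
    rw [iteratedDeriv_const_mul_field, iteratedDeriv_exp_affine,
      inv_mul_cancel_left₀ (pow_ne_zero k hc)]
    ring
  have hk1 : ∀ z, iteratedDeriv (k + 1) (fun z => g z - e z) z = 0 := by
    intro z
    rw [iteratedDeriv_succ, show iteratedDeriv k (fun z => g z - e z) = fun _ => B from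
      funext hke, deriv_const]
  obtain ⟨Q, hQ, hQc⟩ := exists_polynomial_of_iteratedDeriv_eq_zero hf1 (K := k + 1)
    fun m hm => iteratedDeriv_eq_zero_of_le hk1 hm 0
  have hgQ : ∀ z, g z = Q.eval z + e z := fun z => by rw [← hQ]; ring
  have hed : ∀ z, HasDerivAt e (c * e z) z := by
    intro z
    have h1 : HasDerivAt (fun z : ℂ => c * z + d) (c * 1) z :=
      ((hasDerivAt_id z).const_mul c).add_const d
    refine (h1.cexp.const_mul ((c ^ k)⁻¹)).congr_deriv ?_
    ring
  set R : Polynomial ℂ := Polynomial.C c * Q - Polynomial.derivative Q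
  have hRe : ∀ z, R.eval z = c * g z - deriv g z := by
    intro z
    have h1 : HasDerivAt g (Q.derivative.eval z + c * e z) z := by
      rw [show g = fun z => Q.eval z + e z from funext hgQ]
      exact (Q.hasDerivAt z).add (hed z)
    rw [h1.deriv, hgQ z]
    simp only [R, Polynomial.eval_sub, Polynomial.eval_mul, Polynomial.eval_C]
    ring
  -- the coefficient of `z ^ k` in `R = c Q - Q'` is `c B / k!`
  have hRk : R.coeff k ≠ 0 := by
    simp only [R, Polynomial.coeff_sub, Polynomial.coeff_C_mul, Polynomial.coeff_derivative, hQc,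
      hk1, hke]
    simp [hc, hB, Nat.factorial_ne_zero]
  have hRd : 0 < R.degree := by
    refine lt_of_lt_of_le ?_ (Polynomial.le_degree_of_ne_zero hRk)
    exact_mod_cast hk
  have hRt := R.tendsto_norm_atTop hRd (tendsto_norm_cocompact_atTop (E := ℂ))
  have hev := hRt.eventually_gt_atTop (‖c‖ + N * 2)
  rw [← Metric.cobounded_eq_cocompact, ← comap_norm_atTop, eventually_comap,
    eventually_atTop] at hev
  obtain ⟨r, hr⟩ := hev
  have hN : 0 ≤ N := nonneg_of_mul_nonneg_left ((norm_nonneg _).trans (hb 0)) (by positivity)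
  have hbig : ∀ z, max r 1 < ‖z‖ → 1 ≤ ‖g z‖ := by
    intro z hz
    by_contra! hlt
    have h1 : ‖c‖ + N * 2 < ‖R.eval z‖ := hr _ (le_of_lt ((le_max_left r 1).trans_lt hz)) z rfl
    rw [hRe z] at h1
    have h2 : ‖g z‖ ^ 2 ≤ 1 := pow_le_one₀ (norm_nonneg _) hlt.le
    have h3 : N * (1 + ‖g z‖ ^ 2) ≤ N * 2 := by gcongr; linarith
    have h4 : ‖c * g z‖ ≤ ‖c‖ := by
      rw [norm_mul]; exact mul_le_of_le_one_right (norm_nonneg _) hlt.le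
    linarith [norm_sub_le (c * g z) (deriv g z), hb z]
  obtain ⟨p, hp⟩ := exists_polynomial_of_one_le_norm hg (lt_max_of_lt_right one_pos) hbig
  -- now `e` is a zero-free polynomial, hence constant, against `e (π I / c) = -e 0`
  have hpe : ∀ z, (p - Q).eval z = e z := by
    intro z
    rw [Polynomial.eval_sub, ← hp, hgQ]; ring
  have hdeg : (p - Q).degree ≤ 0 := by
    by_contra! hlt
    obtain ⟨z, hz⟩ := Complex.exists_root hlt
    rw [Polynomial.IsRoot.def, hpe] at hz
    simp [e, hc, Complex.exp_ne_zero] at hz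
  rw [Polynomial.degree_le_zero_iff] at hdeg
  have h1 : e 0 = e (Real.pi * Complex.I / c) := by
    rw [← hpe, ← hpe, hdeg]
    simp only [Polynomial.eval_C]
  simp only [e] at h1
  rw [mul_div_cancel₀ _ hc, mul_zero, Complex.exp_add, Complex.exp_add, Complex.exp_pi_mul_I,
    Complex.exp_zero] at h1
  have h2 := Complex.exp_ne_zero d
  have h3 : (c ^ k)⁻¹ ≠ 0 := inv_ne_zero (pow_ne_zero k hc)
  have h4 := mul_left_cancel₀ h3 h1
  have h5 : Complex.exp d * 2 = 0 := by linear_combination h4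
  simp [h2] at h5

/-! ### A normality criterion with bounded derivatives at the zeros -/

/-- Closed conditions on derivatives at zeros pass to locally uniform limits. -/
theorem HolTendstoAt.iteratedDeriv_mem {G : ℕ → ℂ → ℂ} {g : ℂ → ℂ} {ζ : ℂ} (h : HolTendstoAt G g ζ)
    (h0 : g ζ = 0) {C : Set ℂ} (hC : IsClosed C) (hC0 : (0 : ℂ) ∈ C) {r : ℝ} (hr : 0 < r) {j : ℕ}
    (hG : ∀ᶠ n in atTop, ∀ x ∈ ball ζ r, G n x = 0 → _root_.iteratedDeriv j (G n) x ∈ C) :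
    _root_.iteratedDeriv j g ζ ∈ C := by
  by_cases hloc : ∀ᶠ w in 𝓝 ζ, g w = 0
  · have h1 : g =ᶠ[𝓝 ζ] fun _ => (0 : ℂ) := hloc
    rw [h1.iteratedDeriv_eq j, iteratedDeriv_const]
    simpa using hC0
  · obtain ⟨φ, x, hφ, hx, hz⟩ := h.exists_zeros h0 hloc
    refine hC.mem_of_tendsto ((h.iteratedDeriv j).tendsto_seq_comp hφ hx) ?_
    filter_upwards [hφ.eventually hG, hx.eventually (ball_mem_nhds ζ hr)] with n hn hxn
      using hn _ hxn (hz n)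

theorem iteratedDeriv_const_mul_comp_affine (j : ℕ) (f : ℂ → ℂ) (e c d z : ℂ) :
    iteratedDeriv j (fun x => e * f (c + d * x)) z = e * (d ^ j * iteratedDeriv j f (c + d * z)) := by
  rw [iteratedDeriv_const_mul_field, iteratedDeriv_comp_affine]

/-- A nonconstant polynomial of degree at most `k` all of whose zeros have multiplicity at least `k`
is `m (z - z₁)ᵏ / k!`; if `|m| ≤ A`, its spherical derivative at `0` is smaller than the constant
of `exists_rescaled_spherical_lt`. -/
theorem norm_deriv_lt_of_iteratedDeriv_eq_const {g : ℂ → ℂ} (hg : Differentiable ℂ g) {k : ℕ}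
    (hk : 1 ≤ k) {A : ℝ} (hA : 0 ≤ A) {m : ℂ} (hm : ∀ z, iteratedDeriv k g z = m)
    (hz : ∀ z, g z = 0 → (∀ j < k, iteratedDeriv j g z = 0) ∧ ‖iteratedDeriv k g z‖ ≤ A) :
    ‖deriv g 0‖ < ((k + 1) ^ k * (A + 1) + 1) * (1 + ‖g 0‖ ^ 2) := by
  have hN : (1 : ℝ) ≤ (k + 1) ^ k * (A + 1) + 1 := by
    have : (0 : ℝ) ≤ (k + 1) ^ k * (A + 1) := by positivity
    linarith
  by_cases hroot : ∃ z₁, g z₁ = 0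
  · obtain ⟨z₁, hz₁⟩ := hroot
    obtain ⟨l, rfl⟩ : ∃ l, k = l + 1 := ⟨k - 1, by omega⟩
    have hmA : ‖m‖ ≤ A := hm z₁ ▸ (hz z₁ hz₁).2
    have hf : (((l + 1).factorial : ℕ) : ℂ) ≠ 0 := by exact_mod_cast Nat.factorial_ne_zero _
    set q : ℂ → ℂ := fun z => (m / (l + 1).factorial) * (-z₁ + 1 * z) ^ (l + 1)
    have hq : Differentiable ℂ q := by fun_prop
    have hqj : ∀ j z, iteratedDeriv j q z = (m / (l + 1).factorial) *
        ((l + 1).descFactorial j * (-z₁ + z) ^ (l + 1 - j)) := by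
      intro j z
      have := iteratedDeriv_const_mul_comp_affine j (fun x => x ^ (l + 1)) (m / (l + 1).factorial)
        (-z₁) 1 z
      rw [iteratedDeriv_pow] at this
      simpa [q] using this
    have hgq : ∀ z, g z - q z = 0 := by
      refine eq_zero_of_iteratedDeriv_eq_zero (hg.sub hq) (k := l + 1) (z₁ := z₁) ?_ ?_
      · intro z
        rw [iteratedDeriv_fun_sub hg.contDiff.contDiffAt hq.contDiff.contDiffAt, hm, hqj,
          Nat.descFactorial_self]
        simp [hf]
      · intro j hj
        rw [iteratedDeriv_fun_sub hg.contDiff.contDiffAt hq.contDiff.contDiffAt,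
          (hz z₁ hz₁).1 j hj, hqj]
        simp [show l + 1 - j ≠ 0 by omega]
    have hgq' : g = q := funext fun z => sub_eq_zero.1 (hgq z)
    have hd : ‖deriv g 0‖ = ‖m‖ / (l + 1).factorial * ((l + 1) * ‖z₁‖ ^ l) := by
      rw [hgq', ← iteratedDeriv_one, hqj, norm_mul, norm_div, norm_mul, norm_pow, Nat.descFactorial_one,
        Complex.norm_natCast, Complex.norm_natCast, add_zero, norm_neg, Nat.add_sub_cancel]
      push_cast
      rfl
    have h0 : ‖g 0‖ = ‖m‖ / (l + 1).factorial * ‖z₁‖ ^ (l + 1) := by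
      rw [hgq']
      simp [q]
    have hfac : (1 : ℝ) ≤ (l + 1).factorial := by exact_mod_cast Nat.factorial_pos _
    -- for `|z₁| ≤ k` the derivative itself is bounded, for `|z₁| > k` one has `|g' 0| ≤ |g 0|`
    rcases le_or_gt ‖z₁‖ (l + 1) with hle | hgt
    · have h1 : ‖deriv g 0‖ ≤ A * ((l + 1 + 1) ^ (l + 1)) := by
        rw [hd]
        calc ‖m‖ / (l + 1).factorial * ((l + 1) * ‖z₁‖ ^ l)
            ≤ A * ((l + 1 + 1) * (l + 1 + 1) ^ l) := by
              gcongr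
              · exact (div_le_self (norm_nonneg _) hfac).trans hmA
              · linarith
              · linarith
          _ = _ := by ring
      push_cast at hN ⊢
      have h2 : (0 : ℝ) < (l + 1 + 1) ^ (l + 1) := by positivity
      nlinarith [sq_nonneg ‖g 0‖]
    · have h1 : ‖deriv g 0‖ ≤ ‖g 0‖ := by
        rw [hd, h0, pow_succ']
        gcongr
      nlinarith [sq_nonneg (‖g 0‖ - 1 / 2), sq_nonneg ‖g 0‖]
  · -- a zero-free polynomial is constant
    have h0 : deriv g 0 = 0 := by
      have hk1 : ∀ z, iteratedDeriv (k + 1) g z = 0 := by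
        intro z
        rw [iteratedDeriv_succ, show iteratedDeriv k g = fun _ => m from funext hm, deriv_const]
      obtain ⟨p, hp, -⟩ := exists_polynomial_of_iteratedDeriv_eq_zero hg (K := k + 1)
        fun n hn => iteratedDeriv_eq_zero_of_le hk1 hn 0
      have hdeg : p.degree ≤ 0 := by
        by_contra! hlt
        obtain ⟨z, hz'⟩ := Complex.exists_root hlt
        exact hroot ⟨z, (hp z).trans hz'⟩
      rw [Polynomial.degree_le_zero_iff] at hdeg
      rw [hdeg] at hp
      rw [show g = fun _ => p.coeff 0 from funext fun z => by simpa using hp z, deriv_const]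
    rw [h0, norm_zero]
    positivity

/-- Let `g` be entire with bounded spherical derivative and `B ≠ 0`. If `g⁽ᵏ⁾` omits `B` or is
identically `B` (the hypothesis `h`, which is what Hurwitz's theorem yields), then `g⁽ᵏ⁾` is
constant: otherwise `g⁽ᵏ⁾ - B` is a zero-free function of exponential type. -/
theorem exists_iteratedDeriv_eq_const {g : ℂ → ℂ} (hg : Differentiable ℂ g) {N : ℝ} (hN : 0 ≤ N)
    (hb : ∀ z, ‖deriv g z‖ ≤ N * (1 + ‖g z‖ ^ 2)) {k : ℕ} (hk : 1 ≤ k) {B : ℂ} (hB : B ≠ 0)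
    (h : ∀ z, iteratedDeriv k g z = B → ∀ᶠ w in 𝓝 z, iteratedDeriv k g w = B) :
    ∃ m, ∀ z, iteratedDeriv k g z = m := by
  have hgk : Differentiable ℂ (iteratedDeriv k g) :=
    (hg.contDiff (n := ⊤)).differentiable_iteratedDeriv k (by exact_mod_cast WithTop.coe_lt_top _)
  by_cases hex : ∃ z, iteratedDeriv k g z = B
  · obtain ⟨z, hz⟩ := hex
    have := AnalyticOnNhd.eq_of_eventuallyEq (𝕜 := ℂ) (f := iteratedDeriv k g) (g := fun _ => B)
      (fun x _ => hgk.analyticAt x) (fun x _ => analyticAt_const) (h z hz)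
    exact ⟨B, fun w => congrFun this w⟩
  · obtain ⟨C, hC, hbd⟩ := exists_exp_bound_of_spherical_deriv_le hg hN hb
    set K : ℝ := k.factorial + ‖B‖
    have hK : 0 ≤ K := by positivity
    have hEb : ∀ z, ‖iteratedDeriv k g z - B‖ ≤ Real.exp ((K + 2 * C) * (1 + ‖z‖)) := by
      intro z
      have h1 : ‖iteratedDeriv k g z‖ ≤ k.factorial * Real.exp (2 * C * (1 + ‖z‖)) := by
        refine (Complex.norm_iteratedDeriv_le_of_forall_mem_sphere_norm_le k one_pos
          hg.diffContOnCl (C := Real.exp (2 * C * (1 + ‖z‖))) fun w hw => ?_).trans_eq (by simp)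
        refine (hbd w).trans (Real.exp_le_exp.2 ?_)
        rw [mem_sphere_iff_norm] at hw
        have h2 : ‖w‖ ≤ 1 + ‖z‖ := by
          have := norm_sub_norm_le w z
          linarith
        nlinarith [norm_nonneg z]
      have h3 : (1 : ℝ) ≤ Real.exp (2 * C * (1 + ‖z‖)) := Real.one_le_exp (by positivity)
      calc ‖iteratedDeriv k g z - B‖ ≤ ‖iteratedDeriv k g z‖ + ‖B‖ := norm_sub_le _ _
        _ ≤ k.factorial * Real.exp (2 * C * (1 + ‖z‖)) + ‖B‖ * Real.exp (2 * C * (1 + ‖z‖)) := by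
            gcongr
            exact le_mul_of_one_le_right (norm_nonneg _) h3
        _ = K * Real.exp (2 * C * (1 + ‖z‖)) := by ring
        _ ≤ Real.exp (K * (1 + ‖z‖)) * Real.exp (2 * C * (1 + ‖z‖)) := by
            gcongr
            have := Real.add_one_le_exp (K * (1 + ‖z‖))
            nlinarith [norm_nonneg z]
        _ = _ := by rw [← Real.exp_add]; ring_nf
    push Not at hex
    obtain ⟨c, d, hcd⟩ := eq_exp_of_exp_bound (hgk.sub_const B)
      (fun z => sub_ne_zero.2 (hex z)) (by positivity) hEb
    by_cases hc : c = 0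
    · refine ⟨B + Complex.exp d, fun z => ?_⟩
      have := hcd z
      rw [hc, zero_mul, zero_add] at this
      rw [← this]; ring
    · exfalso
      refine not_iteratedDeriv_eq_const_add_exp hg hb hk hB hc (d := d) fun z => ?_
      rw [← hcd z]; ring

/-- **Normality criterion.** If the zeros of `F n` have multiplicity at least `k`, the `k`-th
derivatives are bounded at the zeros, and `F n = γ₃` wherever `(F n)⁽ᵏ⁾ + γ₁ F n = γ₂`, then the
spherical derivatives of `F n` are locally bounded. After Zalcman–Pang rescaling with exponent `k`
the values `γ₃` escape to infinity, so the `k`-th derivative of the limit omits `γ₂ (x₀)`. -/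
theorem sphericallyBoundedAt_of_iteratedDeriv_add_mul {F : ℕ → ℂ → ℂ} {z₀ : ℂ} {R A : ℝ} {k : ℕ}
    (hR : 0 < R) (hk : 1 ≤ k) (hA : 0 ≤ A) {γ₁ γ₂ γ₃ : ℂ → ℂ}
    (hγ₁ : DifferentiableOn ℂ γ₁ (ball z₀ R)) (hγ₂ : DifferentiableOn ℂ γ₂ (ball z₀ R))
    (hγ₃ : DifferentiableOn ℂ γ₃ (ball z₀ R)) (hγ₂0 : ∀ z ∈ ball z₀ R, γ₂ z ≠ 0)
    (hγ₃0 : ∀ z ∈ ball z₀ R, γ₃ z ≠ 0) (hF : ∀ n, DifferentiableOn ℂ (F n) (ball z₀ R))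
    (hz : ∀ n, ∀ z ∈ ball z₀ R, F n z = 0 →
      (∀ j < k, iteratedDeriv j (F n) z = 0) ∧ ‖iteratedDeriv k (F n) z‖ ≤ A)
    (hs : ∀ n, ∀ z ∈ ball z₀ R, iteratedDeriv k (F n) z + γ₁ z * F n z = γ₂ z → F n z = γ₃ z) :
    SphericallyBoundedAt F z₀ := by
  by_contra hnot
  obtain ⟨r, hr, rfl⟩ : ∃ r > 0, R = 2 * r := ⟨R / 2, half_pos hR, by ring⟩
  obtain ⟨φ₀, w, -, hw, hbig⟩ := exists_seq_of_not_sphericallyBoundedAt hR (.of_forall hF) hnot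
  obtain ⟨φ, x, ρ, x₀, g, -, hx₀, hx, hρ, hρ0, hG, hgb, hg0⟩ :=
    exists_zalcman_rescaling (F := fun n => F (φ₀ n)) (k := k)
      (N := (k + 1) ^ k * (A + 1) + 1) hr (by positivity) (fun n => hF _) hw hbig
      fun n => exists_rescaled_spherical_lt hr hk hA (hF _) (hz _)
  have hx₀b : x₀ ∈ ball z₀ (2 * r) := closedBall_subset_ball (by linarith) hx₀
  set f : ℕ → ℂ → ℂ := fun n => F (φ₀ (φ n))
  have hρc : Tendsto (fun n => (ρ n : ℂ)) atTop (𝓝 0) := by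
    exact_mod_cast (Complex.continuous_ofReal.tendsto 0).comp hρ0
  have hρne : ∀ n, (ρ n : ℂ) ≠ 0 := fun n => by exact_mod_cast (hρ n).ne'
  have haff : ∀ ζ, HolTendstoAt (fun n ζ => x n + ρ n * ζ) (fun _ => x₀) ζ := fun ζ =>
    (HolTendstoAt.affine hx hρc ζ).congr_right (.of_forall fun _ => by simp)
  have hmem : ∀ ζ, ∃ t > 0, ∀ᶠ n in atTop, ∀ y ∈ ball ζ t, x n + ρ n * y ∈ ball z₀ (2 * r) := by
    intro ζ
    have := (haff ζ).tendsto.eventually (isOpen_ball.mem_nhds hx₀b)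
    obtain ⟨pa, hpa, pb, hpb, hab⟩ := eventually_prod_iff.1 this
    obtain ⟨t, ht, h2⟩ := Metric.eventually_nhds_iff_ball.1 hpb
    exact ⟨t, ht, hpa.mono fun n hn y hy => hab hn (h2 y hy)⟩
  have hγ : ∀ {γ : ℂ → ℂ}, DifferentiableOn ℂ γ (ball z₀ (2 * r)) → ∀ ζ,
      HolTendstoAt (fun n ζ => γ (x n + ρ n * ζ)) (fun _ => γ x₀) ζ := fun hd ζ =>
    (HolTendstoAt.of_analyticAt (hd.analyticAt (isOpen_ball.mem_nhds hx₀b))).comp (haff ζ)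
      tendsto_id
  have hg : Differentiable ℂ g := fun ζ => (hG ζ).differentiableAt
  have hGd : ∀ j n ζ, iteratedDeriv j (fun ζ => ((ρ n : ℂ) ^ k)⁻¹ * f n (x n + ρ n * ζ)) ζ =
      ((ρ n : ℂ) ^ k)⁻¹ * ((ρ n : ℂ) ^ j * iteratedDeriv j (f n) (x n + ρ n * ζ)) :=
    fun j n ζ => iteratedDeriv_const_mul_comp_affine j (f n) _ _ _ ζ
  -- the unscaled functions tend to `0`
  have hf0 : ∀ ζ, HolTendstoAt (fun n ζ => f n (x n + ρ n * ζ)) (fun _ => 0) ζ := by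
    intro ζ
    have h1 := (HolTendstoAt.of_const_seq (hρc.pow k) ζ).mul (hG ζ)
    refine (h1.congr_left one_pos (.of_forall fun n y _ => ?_)).congr_right
      (.of_forall fun _ => by simp [show k ≠ 0 by omega])
    exact (mul_inv_cancel_left₀ (pow_ne_zero k (hρne n)) _).symm
  have hfk : ∀ ζ, HolTendstoAt (fun n ζ => iteratedDeriv k (f n) (x n + ρ n * ζ))
      (iteratedDeriv k g) ζ := by
    intro ζ
    refine ((hG ζ).iteratedDeriv k).congr_left one_pos (.of_forall fun n y _ => ?_)
    beta_reduce
    rw [hGd, inv_mul_cancel_left₀ (pow_ne_zero k (hρne n))]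
  have hval : ∀ ζ, iteratedDeriv k g ζ = γ₂ x₀ → ∀ᶠ w in 𝓝 ζ, iteratedDeriv k g w = γ₂ x₀ := by
    intro ζ hζ
    have hL := ((hfk ζ).add ((hγ hγ₁ ζ).mul (hf0 ζ))).sub (hγ hγ₂ ζ)
    by_contra hloc
    obtain ⟨ψ, y, hψ, hy, hyz⟩ := hL.exists_zeros (by simp [hζ])
      (by simpa [sub_eq_zero] using hloc)
    obtain ⟨t, ht, hmt⟩ := hmem ζ
    have h1 : γ₃ x₀ = 0 := by
      refine tendsto_nhds_unique ((hγ hγ₃ ζ).tendsto_seq_comp hψ hy)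
        (((hf0 ζ).tendsto_seq_comp hψ hy).congr' ?_)
      filter_upwards [hψ.eventually hmt, hy.eventually (ball_mem_nhds ζ ht)] with j hj hyj
      exact hs _ _ (hj _ hyj) (sub_eq_zero.1 (hyz j))
    exact hγ₃0 x₀ hx₀b h1
  obtain ⟨m, hm⟩ := exists_iteratedDeriv_eq_const hg (by positivity) hgb hk (hγ₂0 x₀ hx₀b) hval
  refine absurd hg0 (not_le.2 (norm_deriv_lt_of_iteratedDeriv_eq_const hg hk hA hm fun ζ hζ => ?_))
  obtain ⟨t, ht, hmt⟩ := hmem ζ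
  constructor
  · intro j hj
    refine (hG ζ).iteratedDeriv_mem hζ (isClosed_singleton (x := (0 : ℂ))) rfl ht ?_
    filter_upwards [hmt] with n hn y hy h0
    have h1 : f n (x n + ρ n * y) = 0 := by
      simpa [hρne n] using h0
    rw [hGd, (hz _ _ (hn y hy) h1).1 j hj]
    simp
  · rw [← mem_closedBall_zero_iff]
    refine (hG ζ).iteratedDeriv_mem hζ isClosed_closedBall (mem_closedBall_self hA) ht ?_
    filter_upwards [hmt] with n hn y hy h0
    have h1 : f n (x n + ρ n * y) = 0 := by
      simpa [hρne n] using h0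
    rw [hGd, inv_mul_cancel_left₀ (pow_ne_zero k (hρne n)), mem_closedBall_zero_iff]
    exact (hz _ _ (hn y hy) h1).2

/-! ### Quasi-sharing sequences -/

/-- `QuasiSharing k G q ζ`: near `ζ` the zeros of `G n` have multiplicity at least `k`, and the
`k`-th derivatives satisfy the rescaled form of the sharing hypotheses: up to terms tending to `0`
(`β n`, `s n`, `t n`), `G n = p n` exactly where the `k`-th derivative equals `s n`, while `G n`
stays away from `p n` where the `k`-th derivative equals `t n`; here `p n` tends to `q`. -/
def QuasiSharing (k : ℕ) (G : ℕ → ℂ → ℂ) (q : ℂ → ℂ) (ζ : ℂ) : Prop :=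
  ∃ p β s t : ℕ → ℂ → ℂ, HolTendstoAt p q ζ ∧ HolTendstoAt β (fun _ => 0) ζ ∧
    HolTendstoAt s (fun _ => 0) ζ ∧ HolTendstoAt t (fun _ => 0) ζ ∧
    ∃ r > 0, ∃ ε > 0, ∀ᶠ n in atTop, ∀ x ∈ ball ζ r,
      (G n x = 0 → ∀ j < k, iteratedDeriv j (G n) x = 0) ∧
      (G n x = p n x ↔ iteratedDeriv k (G n) x + β n x * G n x = s n x) ∧
      (iteratedDeriv k (G n) x + β n x * G n x = t n x → ε ≤ ‖G n x - p n x‖)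

namespace QuasiSharing

variable {k : ℕ} {G : ℕ → ℂ → ℂ} {q g : ℂ → ℂ} {ζ : ℂ}

theorem eventually_nhds (h : QuasiSharing k G q ζ) : ∀ᶠ w in 𝓝 ζ, QuasiSharing k G q w := by
  obtain ⟨p, β, s, t, hp, hβ, hs, ht, r, hr, ε, hε, hG⟩ := h
  filter_upwards [hp.eventually_nhds, hβ.eventually_nhds, hs.eventually_nhds, ht.eventually_nhds,
    isOpen_ball.mem_nhds (mem_ball_self hr)] with w hp' hβ' hs' ht' hw
  obtain ⟨r', hr', hsub⟩ := Metric.mem_nhds_iff.1 (isOpen_ball.mem_nhds hw)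
  exact ⟨p, β, s, t, hp', hβ', hs', ht', r', hr', ε, hε,
    hG.mono fun n hn x hx => hn x (hsub hx)⟩

theorem comp_tendsto (h : QuasiSharing k G q ζ) {φ : ℕ → ℕ} (hφ : Tendsto φ atTop atTop) :
    QuasiSharing k (fun n => G (φ n)) q ζ := by
  obtain ⟨p, β, s, t, hp, hβ, hs, ht, r, hr, ε, hε, hG⟩ := h
  exact ⟨_, _, _, _, hp.comp_tendsto hφ, hβ.comp_tendsto hφ, hs.comp_tendsto hφ,
    ht.comp_tendsto hφ, r, hr, ε, hε, hφ.eventually hG⟩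

/-- Rescaling a quasi-sharing sequence about a convergent sequence of points freezes the target
function at the limit point. -/
theorem rescale {x₀ : ℂ} (h : QuasiSharing k G q x₀) {φ : ℕ → ℕ} (hφ : Tendsto φ atTop atTop)
    {x : ℕ → ℂ} (hx : Tendsto x atTop (𝓝 x₀)) {ρ : ℕ → ℂ} (hρ : Tendsto ρ atTop (𝓝 0))
    (hρ0 : ∀ n, ρ n ≠ 0) (ζ : ℂ) :
    QuasiSharing k (fun n ζ => G (φ n) (x n + ρ n * ζ)) (fun _ => q x₀) ζ := by
  obtain ⟨p, β, s, t, hp, hβ, hs, ht, r, hr, ε, hε, hG⟩ := h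
  have haff : HolTendstoAt (fun n ζ => x n + ρ n * ζ) (fun _ => x₀) ζ :=
    (HolTendstoAt.affine hx hρ ζ).congr_right (.of_forall fun _ => by simp)
  have hρk : ∃ c, Tendsto (fun n => ρ n ^ k) atTop (𝓝 c) := ⟨_, hρ.pow k⟩
  obtain ⟨c, hc⟩ := hρk
  have key : ∀ {v : ℕ → ℂ → ℂ}, HolTendstoAt v (fun _ => 0) x₀ →
      HolTendstoAt (fun n ζ => ρ n ^ k * v (φ n) (x n + ρ n * ζ)) (fun _ => 0) ζ := fun hv =>
    ((HolTendstoAt.of_const_seq hc ζ).mul (HolTendstoAt.comp hv haff hφ)).congr_right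
      (.of_forall fun _ => by simp)
  have hmem := haff.tendsto.eventually (isOpen_ball.mem_nhds (mem_ball_self hr))
  obtain ⟨pa, hpa, pb, hpb, hab⟩ := eventually_prod_iff.1 hmem
  obtain ⟨r', hr', h2⟩ := Metric.eventually_nhds_iff_ball.1 hpb
  refine ⟨_, _, _, _, HolTendstoAt.comp hp haff hφ, key hβ, key hs, key ht, r', hr', ε, hε, ?_⟩
  filter_upwards [hφ.eventually hG, hpa] with n hn hna y hy
  obtain ⟨h3, h4, h5⟩ := hn _ (hab hna (h2 y hy))
  have hρn := pow_ne_zero k (hρ0 n)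
  have hcancel : ∀ A B C : ℂ, ρ n ^ k * A + ρ n ^ k * B * C = ρ n ^ k * (A + B * C) :=
    fun A B C => by ring
  simp only [iteratedDeriv_comp_affine, hcancel, mul_right_inj' hρn]
  exact ⟨fun h0 j hj => by rw [h3 h0 j hj, mul_zero], h4, h5⟩

/-- Zeros of the limit of a quasi-sharing sequence have multiplicity at least `k`. -/
theorem iteratedDeriv_eq_zero (h : QuasiSharing k G q ζ) (hg : HolTendstoAt G g ζ)
    (h0 : g ζ = 0) {j : ℕ} (hj : j < k) : iteratedDeriv j g ζ = 0 := by
  obtain ⟨p, β, s, t, hp, hβ, hs, ht, r, hr, ε, hε, hG⟩ := h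
  exact hg.iteratedDeriv_mem h0 (isClosed_singleton (x := (0 : ℂ))) rfl hr
    (hG.mono fun n hn x hx hx0 => (hn x hx).1 hx0 j hj)

/-- The limit `g` of a quasi-sharing sequence has zero-free `k`-th derivative (unless that
derivative vanishes identically): near a zero there would be both points with `G n = p n` and
points where `G n` stays away from `p n`. -/
theorem iteratedDeriv_ne_zero (h : QuasiSharing k G q ζ) (hg : HolTendstoAt G g ζ)
    (hk : ¬ ∀ᶠ w in 𝓝 ζ, iteratedDeriv k g w = 0) : iteratedDeriv k g ζ ≠ 0 := by
  intro h0
  obtain ⟨p, β, s, t, hp, hβ, hs, ht, r, hr, ε, hε, hG⟩ := h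
  have hL := (hg.iteratedDeriv k).add (hβ.mul hg)
  have hGp := hg.sub hp
  obtain ⟨φ, x, hφ, hx, hz⟩ := (hL.sub hs).exists_zeros (by simp [h0]) (by simpa using hk)
  obtain ⟨ψ, y, hψ, hy, hz'⟩ := (hL.sub ht).exists_zeros (by simp [h0]) (by simpa using hk)
  have h1 : g ζ - q ζ = 0 := by
    refine tendsto_nhds_unique (hGp.tendsto_seq_comp hφ hx) (tendsto_const_nhds.congr' ?_)
    filter_upwards [hφ.eventually hG, hx.eventually (ball_mem_nhds ζ hr)] with n hn hxn
    exact (sub_eq_zero.2 ((hn _ hxn).2.1.2 (sub_eq_zero.1 (hz n)))).symm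
  have h2 : ε ≤ ‖g ζ - q ζ‖ := by
    refine ge_of_tendsto (hGp.tendsto_seq_comp hψ hy).norm ?_
    filter_upwards [hψ.eventually hG, hy.eventually (ball_mem_nhds ζ hr)] with n hn hyn
    exact (hn _ hyn).2.2 (sub_eq_zero.1 (hz' n))
  rw [h1, norm_zero] at h2
  linarith

/-- The limit of a quasi-sharing sequence omits the target function, unless it coincides with it
or its `k`-th derivative vanishes identically. -/
theorem eventually_eq (h : QuasiSharing k G q ζ) (hg : HolTendstoAt G g ζ)
    (hk : ¬ ∀ᶠ w in 𝓝 ζ, iteratedDeriv k g w = 0) (h0 : g ζ = q ζ) : ∀ᶠ w in 𝓝 ζ, g w = q w := by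
  have hne := h.iteratedDeriv_ne_zero hg hk
  obtain ⟨p, β, s, t, hp, hβ, hs, ht, r, hr, ε, hε, hG⟩ := h
  by_contra hloc
  obtain ⟨φ, x, hφ, hx, hz⟩ := (hg.sub hp).exists_zeros (by simp [h0])
    (by simpa [sub_eq_zero] using hloc)
  apply hne
  have hL := ((hg.iteratedDeriv k).add (hβ.mul hg)).sub hs
  have h1 := hL.tendsto_seq_comp hφ hx
  simp only [zero_mul, add_zero, sub_zero] at h1
  refine tendsto_nhds_unique h1 (tendsto_const_nhds.congr' ?_)
  filter_upwards [hφ.eventually hG, hx.eventually (ball_mem_nhds ζ hr)] with n hn hxn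
  exact (sub_eq_zero.2 ((hn _ hxn).2.1.1 (sub_eq_zero.1 (hz n)))).symm

end QuasiSharing

theorem eq_of_eventually_eq {f g : ℂ → ℂ} (hf : Differentiable ℂ f) (hg : Differentiable ℂ g)
    {ζ : ℂ} (h : ∀ᶠ w in 𝓝 ζ, f w = g w) : f = g :=
  AnalyticOnNhd.eq_of_eventuallyEq (𝕜 := ℂ) (fun x _ => hf.analyticAt x)
    (fun x _ => hg.analyticAt x) h

theorem differentiable_iteratedDeriv {f : ℂ → ℂ} (hf : Differentiable ℂ f) (k : ℕ) :
    Differentiable ℂ (iteratedDeriv k f) :=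
  (hf.contDiff (n := ⊤)).differentiable_iteratedDeriv k (by exact_mod_cast WithTop.coe_lt_top _)

/-- For `k ≥ 2`, quasi-sharing of a target that does not vanish at `ζ` bounds the spherical
derivatives: a Zalcman limit would have the form `q₀ + exp (c z + d)`, whose zeros are simple. -/
theorem QuasiSharing.sphericallyBoundedAt {k : ℕ} (hk : 2 ≤ k) {G : ℕ → ℂ → ℂ} {q : ℂ → ℂ} {ζ₀ : ℂ}
    (h : QuasiSharing k G q ζ₀) (hq : q ζ₀ ≠ 0) {R : ℝ} (hR : 0 < R)
    (hG : ∀ᶠ n in atTop, DifferentiableOn ℂ (G n) (ball ζ₀ R)) : SphericallyBoundedAt G ζ₀ := by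
  by_contra hnot
  have hqc : ∀ᶠ w in 𝓝 ζ₀, q w ≠ 0 := by
    obtain ⟨p, β, s, t, hp, -⟩ := h
    exact hp.differentiableAt.continuousAt.eventually_ne hq
  obtain ⟨δ, hδ, hδ'⟩ := Metric.eventually_nhds_iff_ball.1 (h.eventually_nhds.and hqc)
  set r := min δ R / 2
  have hr : 0 < r := half_pos (lt_min hδ hR)
  have hrδ : r < δ := (half_lt_self (lt_min hδ hR)).trans_le (min_le_left _ _)
  have h2r : 2 * r ≤ R := by
    simp only [r]
    rw [mul_div_cancel₀ _ two_ne_zero]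
    exact min_le_right _ _
  obtain ⟨φ₀, w, hφ₀, hw, hbig⟩ := exists_seq_of_not_sphericallyBoundedAt hR hG hnot
  -- discard the finitely many terms that are not holomorphic
  obtain ⟨n₀, hn₀⟩ := eventually_atTop.1 (hφ₀.eventually hG)
  have hshift : Tendsto (fun n => n + n₀) atTop atTop := tendsto_add_atTop_nat n₀
  have hd : ∀ n, DifferentiableOn ℂ (G (φ₀ (n + n₀))) (ball ζ₀ (2 * r)) := fun n =>
    (hn₀ _ (Nat.le_add_left _ _)).mono (ball_subset_ball h2r)
  obtain ⟨φ, x, ρ, x₀, g, hφ, hx₀, hx, hρ, hρ0, hg, hgb, hg0⟩ :=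
    exists_zalcman_rescaling (F := fun n => G (φ₀ (n + n₀))) (k := 0) (N := 1) hr one_pos hd
      (hw.comp hshift) (fun M => hshift.eventually (hbig M))
      fun n => exists_rescaled_spherical_lt_zero hr (hd n)
  obtain ⟨hQ, hqx⟩ := hδ' x₀ (closedBall_subset_ball hrδ hx₀)
  have hρc : Tendsto (fun n => (ρ n : ℂ)) atTop (𝓝 0) := by
    exact_mod_cast (Complex.continuous_ofReal.tendsto 0).comp hρ0
  simp only [pow_zero, inv_one, one_mul] at hg
  have hQS : ∀ ζ, QuasiSharing k (fun n ζ => G (φ₀ (φ n + n₀)) (x n + ρ n * ζ))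
      (fun _ => q x₀) ζ := fun ζ =>
    hQ.rescale (φ := fun n => φ₀ (φ n + n₀)) (hφ₀.comp (hshift.comp hφ)) hx hρc
      (fun n => by exact_mod_cast (hρ n).ne') ζ
  have hgd : Differentiable ℂ g := fun ζ => (hg ζ).differentiableAt
  have hg'0 : deriv g 0 ≠ 0 := by
    intro h0
    rw [h0, norm_zero] at hg0
    nlinarith [sq_nonneg ‖g 0‖]
  have hgconst : ∀ c, g ≠ fun _ => c := fun c hc => hg'0 (by rw [hc, deriv_const])
  -- otherwise `g` is a nonconstant polynomial of degree less than `k` with a zero of order `k`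
  have hgk : ¬ ∀ z, iteratedDeriv k g z = 0 := by
    intro h0
    obtain ⟨p, hp, -⟩ := exists_polynomial_of_iteratedDeriv_eq_zero hgd (K := k)
      fun n hn => iteratedDeriv_eq_zero_of_le h0 hn 0
    have hdeg : 0 < p.degree := by
      by_contra! hle
      rw [Polynomial.degree_le_zero_iff] at hle
      refine hgconst (p.coeff 0) (funext fun z => ?_)
      rw [hp z, hle]
      simp
    obtain ⟨z, hz⟩ := Complex.exists_root hdeg
    have hgz : g z = 0 := (hp z).trans hz
    exact hgconst 0 (funext fun w => eq_zero_of_iteratedDeriv_eq_zero hgd h0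
      (fun j hj => (hQS z).iteratedDeriv_eq_zero (hg z) hgz hj) w)
  have hgk' : ∀ ζ, ¬ ∀ᶠ w in 𝓝 ζ, iteratedDeriv k g w = 0 := fun ζ hζ =>
    hgk fun z => congrFun (eq_of_eventually_eq (differentiable_iteratedDeriv hgd k)
      (differentiable_const 0) hζ) z
  have homit : ∀ ζ, g ζ - q x₀ ≠ 0 := fun ζ h0 =>
    hgconst (q x₀) (eq_of_eventually_eq hgd (differentiable_const _)
      ((hQS ζ).eventually_eq (hg ζ) (hgk' ζ) (sub_eq_zero.1 h0)))
  obtain ⟨C, hC, hbd⟩ := exists_exp_bound_of_spherical_deriv_le hgd zero_le_one hgb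
  obtain ⟨c, d, hcd⟩ := eq_exp_of_exp_bound (hgd.sub_const (q x₀)) homit
    (C := C + ‖q x₀‖) (by positivity) fun z => by
      have h1 : (1 : ℝ) ≤ Real.exp (C * (1 + ‖z‖)) := Real.one_le_exp (by positivity)
      calc ‖g z - q x₀‖ ≤ ‖g z‖ + ‖q x₀‖ := norm_sub_le _ _
        _ ≤ Real.exp (C * (1 + ‖z‖)) + ‖q x₀‖ * Real.exp (C * (1 + ‖z‖)) := by
            gcongr
            · exact hbd z
            · exact le_mul_of_one_le_right (norm_nonneg _) h1
        _ = (‖q x₀‖ + 1) * Real.exp (C * (1 + ‖z‖)) := by ring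
        _ ≤ Real.exp (‖q x₀‖ * (1 + ‖z‖)) * Real.exp (C * (1 + ‖z‖)) := by
            gcongr
            have := Real.add_one_le_exp (‖q x₀‖ * (1 + ‖z‖))
            nlinarith [norm_nonneg z, norm_nonneg (q x₀), mul_nonneg (norm_nonneg (q x₀)) (norm_nonneg z)]
        _ = _ := by rw [← Real.exp_add]; ring_nf
  have hgf : g = fun z => q x₀ + Complex.exp (c * z + d) := funext fun z => by
    rw [← hcd z]; ring
  have hc : c ≠ 0 := by
    rintro rfl
    refine hgconst (q x₀ + Complex.exp d) ?_
    rw [hgf]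
    simp
  set z₁ := (Complex.log (-q x₀) - d) / c
  have hz₁ : Complex.exp (c * z₁ + d) = -q x₀ := by
    rw [mul_div_cancel₀ _ hc, sub_add_cancel, Complex.exp_log (neg_ne_zero.2 hqx)]
  have hgz₁ : g z₁ = 0 := by rw [hgf]; simp [hz₁]
  have h1 := (hQS z₁).iteratedDeriv_eq_zero (hg z₁) hgz₁ (show 1 < k by omega)
  have h2 : iteratedDeriv 1 g z₁ = c * -q x₀ := by
    have h3 := iteratedDeriv_exp_affine 1 c d z₁
    rw [iteratedDeriv_one] at h3 ⊢
    rw [hgf, deriv_const_add, h3, hz₁, pow_one]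
  rw [h2] at h1
  exact mul_ne_zero hc (neg_ne_zero.2 hqx) h1

/-! ### Blowing down, and the choice of the rescaling radius -/

theorem TendstoInftyAt.eventually_of_isCompact {F : ℕ → ℂ → ℂ} {K : Set ℂ} (hK : IsCompact K)
    (h : ∀ z ∈ K, TendstoInftyAt F z) (M : ℝ) : ∀ᶠ n in atTop, ∀ z ∈ K, M ≤ ‖F n z‖ := by
  refine hK.induction_on (p := fun s => ∀ᶠ n in atTop, ∀ z ∈ s, M ≤ ‖F n z‖) (by simp)
    (fun s t hst ht => ht.mono fun n hn z hz => hn z (hst hz)) ?_ ?_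
  · intro s t hs ht
    filter_upwards [hs, ht] with n h1 h2 z hz using hz.elim (h1 z) (h2 z)
  · intro z hz
    obtain ⟨r, hr, h1⟩ := h z hz
    exact ⟨_, mem_nhdsWithin_of_mem_nhds (ball_mem_nhds z hr), h1 M⟩

theorem HolTendstoAt.exists_norm_le_of_isCompact {F : ℕ → ℂ → ℂ} {g : ℂ → ℂ} {K : Set ℂ}
    (hK : IsCompact K) (h : ∀ z ∈ K, HolTendstoAt F g z) :
    ∃ C : ℝ, ∀ᶠ n in atTop, ∀ z ∈ K, ‖F n z‖ ≤ C := by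
  refine hK.induction_on (p := fun s => ∃ C : ℝ, ∀ᶠ n in atTop, ∀ z ∈ s, ‖F n z‖ ≤ C)
    ⟨0, by simp⟩ (fun s t hst ⟨C, ht⟩ => ⟨C, ht.mono fun n hn z hz => hn z (hst hz)⟩) ?_ ?_
  · rintro s t ⟨C, hs⟩ ⟨C', ht⟩
    refine ⟨max C C', ?_⟩
    filter_upwards [hs, ht] with n h1 h2 z hz
    exact hz.elim (fun hz => (h1 z hz).trans (le_max_left _ _))
      fun hz => (h2 z hz).trans (le_max_right _ _)
  · intro z hz
    have h1 := (h z hz).tendsto.norm.eventually (gt_mem_nhds (lt_add_one ‖g z‖))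
    obtain ⟨pa, hpa, pb, hpb, hab⟩ := eventually_prod_iff.1 h1
    exact ⟨{y | pb y}, mem_nhdsWithin_of_mem_nhds hpb, _, hpa.mono fun n hn y hy => (hab hn hy).le⟩

theorem SphericallyBoundedAt.comp_tendsto {F : ℕ → ℂ → ℂ} {z : ℂ} (h : SphericallyBoundedAt F z)
    {φ : ℕ → ℕ} (hφ : Tendsto φ atTop atTop) : SphericallyBoundedAt (fun n => F (φ n)) z := by
  obtain ⟨r, hr, M, h1⟩ := h
  exact ⟨r, hr, M, hφ.eventually h1⟩

/-- Convergence on a punctured neighbourhood gives, by the maximum principle, bounded spherical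
derivatives at the puncture. -/
theorem sphericallyBoundedAt_of_punctured {F : ℕ → ℂ → ℂ} {g : ℂ → ℂ} {e : ℂ} {r : ℝ} (hr : 0 < r)
    (hd : ∀ᶠ n in atTop, DifferentiableOn ℂ (F n) (ball e r))
    (h : ∀ z ≠ e, HolTendstoAt F g z) : SphericallyBoundedAt F e := by
  obtain ⟨C, hC⟩ := HolTendstoAt.exists_norm_le_of_isCompact (isCompact_sphere e (r / 2))
    fun z hz => h z (ne_of_mem_sphere hz (half_pos hr).ne')
  refine ⟨r / 4, by positivity, C / (r / 4), ?_⟩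
  filter_upwards [hd, hC] with n hn hnC
  refine ⟨hn.mono (ball_subset_ball (by linarith)), fun w hw => ?_⟩
  have hcl : closedBall e (r / 2) ⊆ ball e r := closedBall_subset_ball (by linarith)
  have hle : ∀ y ∈ closedBall e (r / 2), ‖F n y‖ ≤ C := by
    intro y hy
    refine Complex.norm_le_of_forall_mem_frontier_norm_le (U := ball e (r / 2)) isBounded_ball
      ((hn.mono hcl).diffContOnCl_ball subset_rfl) (fun x hx => ?_)
      (by rwa [closure_ball _ (half_pos hr).ne'])
    rw [frontier_ball _ (half_pos hr).ne'] at hx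
    exact hnC x hx
  have hsub : closedBall w (r / 4) ⊆ closedBall e (r / 2) := by
    refine closedBall_subset_closedBall' ?_
    have := mem_ball.1 hw
    linarith
  have h1 := Complex.norm_deriv_le_of_forall_mem_sphere_norm_le (by positivity : 0 < r / 4)
    ((hn.mono (hsub.trans hcl)).diffContOnCl_ball subset_rfl)
    fun y hy => hle y (hsub (sphere_subset_closedBall hy))
  have hC0 : 0 ≤ C := (norm_nonneg _).trans (hle e (mem_closedBall_self (by positivity)))
  refine h1.trans (le_mul_of_one_le_right (by positivity) ?_)
  nlinarith [sq_nonneg ‖F n w‖]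

theorem isPreconnected_compl_singleton (e : ℂ) : IsPreconnected ({e}ᶜ : Set ℂ) :=
  (isConnected_compl_singleton_of_one_lt_rank (by simp [Complex.rank_real_complex]) e).isPreconnected

/-- Blowing down an entire function `G` with zero-free `k`-th derivative and zeros of multiplicity
at least `k` that omits a function `P` of polynomial growth of order `d < k` gives a normal family
off the origin. Finite limits make `G` a polynomial of degree less than `k`; infinite limits make
`1 / (G - P)` vanish, by the maximum principle. -/
theorem false_of_blow_down {k : ℕ} (hk : 2 ≤ k) {G P Q : ℂ → ℂ} (hG : Differentiable ℂ G)
    (hP : Differentiable ℂ P) {d : ℕ} (hd : d < k)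
    (hQ : ∀ ζ, HolTendstoAt (fun (j : ℕ) ζ => (((j : ℂ) + 1) ^ d)⁻¹ * P (0 + ((j : ℂ) + 1) * ζ)) Q ζ)
    (hQ0 : ∀ ζ ≠ 0, Q ζ ≠ 0) (hz : ∀ z, G z = 0 → ∀ j < k, iteratedDeriv j G z = 0)
    (hGk : ∀ z, iteratedDeriv k G z ≠ 0) (hGP : ∀ z, G z ≠ P z) : False := by
  set t : ℕ → ℂ := fun j => (j : ℂ) + 1
  have ht : ∀ j, t j ≠ 0 := fun j => Nat.cast_add_one_ne_zero j
  have htn : ∀ j, ‖t j‖ = (j : ℝ) + 1 := fun j => by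
    simp only [t]; rw [← Nat.cast_add_one, Complex.norm_natCast]; simp
  have htd : ∀ j, (t j ^ d)⁻¹ ≠ 0 := fun j => inv_ne_zero (pow_ne_zero d (ht j))
  set H : ℕ → ℂ → ℂ := fun j ζ => (t j ^ d)⁻¹ * G (0 + t j * ζ)
  have hHd : ∀ j, Differentiable ℂ (H j) := fun j =>
    (hG.comp ((differentiable_id.const_mul (t j)).const_add 0)).const_mul _
  have hHk : ∀ i j ζ, iteratedDeriv i (H j) ζ =
      (t j ^ d)⁻¹ * (t j ^ i * iteratedDeriv i G (0 + t j * ζ)) := fun i j ζ =>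
    iteratedDeriv_const_mul_comp_affine i G _ _ _ ζ
  have h0 : ∀ ζ, HolTendstoAt (fun _ _ => 0) (fun _ => 0) ζ := fun ζ =>
    HolTendstoAt.of_const_seq tendsto_const_nhds ζ
  have hQS : ∀ ζ, QuasiSharing k H Q ζ := by
    refine fun ζ => ⟨_, _, _, _, hQ ζ, h0 ζ, h0 ζ, h0 ζ, 1, one_pos, 1, one_pos,
      .of_forall fun j x _ => ?_⟩
    have hne : iteratedDeriv k (H j) x + 0 * H j x ≠ 0 := by
      rw [zero_mul, add_zero, hHk]
      exact mul_ne_zero (htd j) (mul_ne_zero (pow_ne_zero k (ht j)) (hGk _))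
    refine ⟨fun hx i hi => ?_, ⟨fun hx => ?_, fun hx => absurd hx hne⟩, fun hx => absurd hx hne⟩
    · rw [hHk, hz _ ((mul_eq_zero.1 hx).resolve_left (htd j)) i hi, mul_zero, mul_zero]
    · exact absurd (mul_left_cancel₀ (htd j) hx) (hGP _)
  obtain ⟨φ, hφ, hlim⟩ := exists_subseq_of_sphericallyBoundedAt isOpen_compl_singleton
    (isPreconnected_compl_singleton 0) fun ζ hζ =>
      (hQS ζ).sphericallyBoundedAt hk (hQ0 ζ hζ) one_pos
        (.of_forall fun j => (hHd j).differentiableOn)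
  have hS : IsCompact (sphere (0 : ℂ) 1) := isCompact_sphere 0 1
  have hS0 : ∀ ζ ∈ sphere (0 : ℂ) 1, ζ ≠ 0 := fun ζ hζ => ne_of_mem_sphere hζ one_ne_zero
  -- points of the circle `|z| = |t j|`, rescaled to the unit circle
  have hscale : ∀ j : ℕ, ∀ z ∈ sphere (0 : ℂ) ((j : ℝ) + 1),
      z / t j ∈ sphere (0 : ℂ) 1 ∧ 0 + t j * (z / t j) = z := by
    intro j z hz'
    rw [mem_sphere_zero_iff_norm] at hz' ⊢
    refine ⟨?_, by rw [mul_div_cancel₀ _ (ht j), zero_add]⟩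
    rw [norm_div, htn, hz', div_self (by positivity)]
  rcases hlim with ⟨h, hh⟩ | hinf
  · obtain ⟨C, hC⟩ := HolTendstoAt.exists_norm_le_of_isCompact hS fun ζ hζ => hh ζ (hS0 ζ hζ)
    refine hGk 0 (iteratedDeriv_eq_zero_of_growth hG (t := fun j => (φ j : ℝ) + 1) (C := C)
      (tendsto_atTop_add_const_right _ _ (tendsto_natCast_atTop_atTop.comp hφ.tendsto_atTop)) hd ?_)
    filter_upwards [hC] with j hj z hz'
    obtain ⟨h1, h2⟩ := hscale _ z hz'
    have h3 := hj _ h1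
    simp only [H] at h3
    rw [h2, norm_mul, norm_inv, norm_pow, htn, inv_mul_le_iff₀ (by positivity)] at h3
    rwa [mul_comm]
  · obtain ⟨C, hC⟩ := HolTendstoAt.exists_norm_le_of_isCompact hS
      fun ζ _ => (hQ ζ).comp_tendsto hφ.tendsto_atTop
    set M := ‖G 0 - P 0‖ + 1
    have hM : 0 < M := by positivity
    obtain ⟨j, hj1, hj2⟩ := ((TendstoInftyAt.eventually_of_isCompact hS
      (fun ζ hζ => hinf ζ (hS0 ζ hζ)) (C + M)).and hC).exists
    have hj0 : (0 : ℝ) < (φ j : ℝ) + 1 := by positivity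
    have hlow : ∀ z ∈ sphere (0 : ℂ) ((φ j : ℝ) + 1), M ≤ ‖G z - P z‖ := by
      intro z hz'
      obtain ⟨h1, h2⟩ := hscale _ z hz'
      have h3 := hj1 _ h1
      have h4 := hj2 _ h1
      simp only [H] at h3
      change ‖(t (φ j) ^ d)⁻¹ * P (0 + t (φ j) * (z / t (φ j)))‖ ≤ C at h4
      rw [h2] at h3 h4
      have h5 : M ≤ ‖(t (φ j) ^ d)⁻¹ * (G z - P z)‖ := by
        rw [mul_sub]
        linarith [norm_sub_norm_le ((t (φ j) ^ d)⁻¹ * G z) ((t (φ j) ^ d)⁻¹ * P z)]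
      refine h5.trans ?_
      rw [norm_mul, norm_inv, norm_pow, htn]
      refine mul_le_of_le_one_left (norm_nonneg _) (inv_le_one_of_one_le₀ (one_le_pow₀ ?_))
      linarith [Nat.cast_nonneg (α := ℝ) (φ j)]
    have hdiff : Differentiable ℂ fun z => (G z - P z)⁻¹ :=
      (hG.sub hP).inv fun z => sub_ne_zero.2 (hGP z)
    have h1 := Complex.norm_le_of_forall_mem_frontier_norm_le
      (U := ball (0 : ℂ) ((φ j : ℝ) + 1)) (C := M⁻¹) isBounded_ball hdiff.diffContOnCl
      (fun z hz' => by
        rw [frontier_ball _ hj0.ne'] at hz'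
        rw [norm_inv]
        exact inv_anti₀ hM (hlow z hz'))
      (subset_closure (mem_ball_self hj0))
    rw [norm_inv] at h1
    have h2 := (inv_le_inv₀ (norm_pos_iff.2 (sub_ne_zero.2 (hGP 0))) hM).1 h1
    linarith

/-- The case `P = u (l + μ z)ᵐ` of `false_of_blow_down`: the blow-down has order `m` if `μ ≠ 0`,
while `P` is constant if `μ = 0`. -/
theorem false_of_omits_pow_affine {k : ℕ} (hk : 2 ≤ k) {G : ℂ → ℂ} (hG : Differentiable ℂ G)
    {u l μ : ℂ} {m : ℕ} (hu : u ≠ 0) (hl : μ = 0 → l ≠ 0) (hm : μ ≠ 0 → m < k)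
    (hz : ∀ z, G z = 0 → ∀ j < k, iteratedDeriv j G z = 0)
    (hGk : ∀ z, iteratedDeriv k G z ≠ 0) (hGP : ∀ z, G z ≠ u * (l + μ * z) ^ m) : False := by
  have hP : Differentiable ℂ fun z => u * (l + μ * z) ^ m := by fun_prop
  by_cases hμ : μ = 0
  · refine false_of_blow_down hk hG hP (d := 0) (by omega) (Q := fun _ => u * l ^ m) (fun ζ => ?_)
      (fun _ _ => mul_ne_zero hu (pow_ne_zero m (hl hμ))) hz hGk hGP
    refine (HolTendstoAt.of_const_seq tendsto_const_nhds ζ).congr_left one_pos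
      (.of_forall fun j y _ => ?_)
    simp [hμ]
  · refine false_of_blow_down hk hG hP (d := m) (hm hμ) (Q := fun z => u * (0 + μ * z) ^ m)
      (fun ζ => ?_) (fun ζ hζ => ?_) hz hGk hGP
    · have h1 : Tendsto (fun j : ℕ => l / ((j : ℂ) + 1)) atTop (𝓝 0) := by
        have := (tendsto_one_div_add_atTop_nhds_zero_nat (𝕜 := ℂ)).const_mul l
        simpa [mul_one_div, div_eq_mul_inv] using this
      have h2 := HolTendstoAt.affine h1 (tendsto_const_nhds (x := μ)) ζ
      have h3 : AnalyticAt ℂ (fun x : ℂ => u * x ^ m) (0 + μ * ζ) := by fun_prop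
      refine (HolTendstoAt.comp (A₀ := fun x => 0 + μ * x) (HolTendstoAt.of_analyticAt h3) h2 tendsto_id).congr_left one_pos
        (.of_forall fun j y _ => ?_)
      have hj : (j : ℂ) + 1 ≠ 0 := Nat.cast_add_one_ne_zero j
      beta_reduce
      rw [mul_left_comm, ← inv_pow, ← mul_pow]
      congr 2
      field_simp
      ring
    · simp [hu, hμ, hζ]

/-- The radius of the rescaling disc: the least `σ` for which `|f|` reaches `(|z₁ - z₀| + σ) ^ m`
on the closed disc about `z₁`; it is small if the `k`-th derivative at `z₁` is large. -/
theorem exists_radius {f : ℂ → ℂ} {z₀ z₁ : ℂ} {δ : ℝ} {k m : ℕ} (hδ : 0 < δ)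
    (hf : DifferentiableOn ℂ f (ball z₁ (2 * δ))) (hf0 : f z₁ = 0) (hc : 0 < dist z₁ z₀ ^ m)
    (h1 : dist z₁ z₀ + δ ≤ 1) (hA : k.factorial < ‖iteratedDeriv k f z₁‖ * δ ^ k) :
    ∃ σ > 0, σ ≤ δ ∧ (∀ z ∈ closedBall z₁ σ, ‖f z‖ ≤ (dist z₁ z₀ + σ) ^ m) ∧
      (∃ z ∈ closedBall z₁ σ, (dist z₁ z₀ + σ) ^ m ≤ ‖f z‖) ∧
      ‖iteratedDeriv k f z₁‖ * σ ^ k ≤ k.factorial * (dist z₁ z₀ + σ) ^ m := by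
  have hsub : closedBall z₁ δ ⊆ ball z₁ (2 * δ) := closedBall_subset_ball (by linarith)
  have hcont : ContinuousOn f (closedBall z₁ δ) := hf.continuousOn.mono hsub
  have cauchy : ∀ σ > 0, σ ≤ δ → ∀ C, (∀ z ∈ sphere z₁ σ, ‖f z‖ ≤ C) →
      ‖iteratedDeriv k f z₁‖ * σ ^ k ≤ k.factorial * C := by
    intro σ hσ hσδ C hC
    have h2 := Complex.norm_iteratedDeriv_le_of_forall_mem_sphere_norm_le k hσ
      ((hf.mono ((closedBall_subset_closedBall hσδ).trans hsub)).diffContOnCl_ball subset_rfl) hC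
    rwa [le_div_iff₀ (by positivity)] at h2
  -- the required point is the one of `T` nearest to `z₁`
  set T := closedBall z₁ δ ∩ {z | 0 ≤ ‖f z‖ - (dist z₁ z₀ + dist z z₁) ^ m}
  have hgc : ContinuousOn (fun z => ‖f z‖ - (dist z₁ z₀ + dist z z₁) ^ m) (closedBall z₁ δ) :=
    hcont.norm.sub (by fun_prop)
  have hT : IsCompact T := by
    refine (isCompact_closedBall z₁ δ).of_isClosed_subset ?_ inter_subset_left
    exact hgc.preimage_isClosed_of_isClosed isClosed_closedBall isClosed_Ici
  have hTne : T.Nonempty := by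
    by_contra hemp
    rw [not_nonempty_iff_eq_empty] at hemp
    have h2 := cauchy δ hδ le_rfl 1 fun z hz => by
      by_contra! hlt
      have hzT : z ∈ T := by
        refine ⟨sphere_subset_closedBall hz, ?_⟩
        rw [mem_ofPred_eq, mem_sphere.1 hz]
        have : (dist z₁ z₀ + δ) ^ m ≤ 1 := pow_le_one₀ (by positivity) h1
        linarith
      rw [hemp] at hzT
      exact hzT
    linarith
  obtain ⟨z, hzT, hmin⟩ := hT.exists_isMinOn hTne
    (f := fun z => dist z z₁) (by fun_prop)
  have hz1 : z ≠ z₁ := by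
    rintro rfl
    have h2 := hzT.2
    rw [mem_ofPred_eq, hf0, norm_zero, dist_self, add_zero] at h2
    linarith
  have hσ : 0 < dist z z₁ := dist_pos.2 hz1
  have hσδ : dist z z₁ ≤ δ := hzT.1
  have hle : ∀ y ∈ closedBall z₁ (dist z z₁), ‖f y‖ ≤ (dist z₁ z₀ + dist z z₁) ^ m := by
    intro y hy
    rw [← closure_ball z₁ hσ.ne'] at hy
    refine closure_minimal (s := ball z₁ (dist z z₁))
      (t := closedBall z₁ δ ∩ {y | ‖f y‖ ≤ (dist z₁ z₀ + dist z z₁) ^ m}) (fun y hy => ?_)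
      (hcont.norm.preimage_isClosed_of_isClosed isClosed_closedBall isClosed_Iic) hy |>.2
    have hyδ : y ∈ closedBall z₁ δ := (mem_ball.1 hy).le.trans hσδ
    refine ⟨hyδ, ?_⟩
    by_contra hlt
    have hlt' : (dist z₁ z₀ + dist z z₁) ^ m < ‖f y‖ := not_le.1 hlt
    have hyT : y ∈ T := by
      refine ⟨hyδ, sub_nonneg.2 (le_trans ?_ hlt'.le)⟩
      gcongr
      exact (mem_ball.1 hy).le
    exact absurd (hmin hyT) (not_le.2 (mem_ball.1 hy))
  exact ⟨_, hσ, hσδ, hle, ⟨z, mem_closedBall.2 le_rfl, sub_nonneg.1 hzT.2⟩,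
    cauchy _ hσ hσδ _ fun y hy => hle y (sphere_subset_closedBall hy)⟩

/-! ### Bounding the derivatives at the zeros -/

/-- The rescaling contradiction behind `exists_norm_iteratedDeriv_le`. The functions `f n` vanish
at `z n → z₀`, satisfy the sharing hypotheses with target `a = (z - z₀)ᵐ u` and reach the size
`s nᵐ`, `s n = |z n - z₀| + σ n`, on the disc of radius `σ n` about `z n`. Then
`f n (z n + σ n ζ) / s nᵐ` is a quasi-sharing sequence with target `u (z₀) (l + μ ζ)ᵐ`; it
converges to an entire function to which `false_of_omits_pow_affine` applies. -/
theorem false_of_rescaled_sharing {k m : ℕ} (hk : 2 ≤ k) {z₀ : ℂ} {R ε : ℝ} (hR : 0 < R)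
    (hε : 0 < ε) {a b u γ κ : ℂ → ℂ} (hu : DifferentiableOn ℂ u (ball z₀ R))
    (hb : DifferentiableOn ℂ b (ball z₀ R)) (hγ : DifferentiableOn ℂ γ (ball z₀ R))
    (hκ : DifferentiableOn ℂ κ (ball z₀ R)) (hu0 : u z₀ ≠ 0)
    (hau : ∀ z ∈ ball z₀ R, a z = (z - z₀) ^ m * u z) (hab : ∀ z ∈ ball z₀ R, ε ≤ ‖b z - a z‖)
    {f : ℕ → ℂ → ℂ} (hf : ∀ n, DifferentiableOn ℂ (f n) (ball z₀ R))
    (hfz : ∀ n, ∀ z ∈ ball z₀ R, f n z = 0 → ∀ j < k, iteratedDeriv j (f n) z = 0)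
    (hfa : ∀ n, ∀ z ∈ ball z₀ R,
      f n z = a z ↔ iteratedDeriv k (f n) z + γ z * f n z = κ z * a z)
    (hfb : ∀ n, ∀ z ∈ ball z₀ R,
      iteratedDeriv k (f n) z + γ z * f n z = κ z * b z → f n z = b z)
    {z : ℕ → ℂ} (hz : Tendsto z atTop (𝓝 z₀)) (hf0 : ∀ n, f n (z n) = 0)
    {σ : ℕ → ℝ} (hσ : ∀ n, 0 < σ n) (hσ0 : Tendsto σ atTop (𝓝 0))
    (hle : ∀ n, ∀ y ∈ closedBall (z n) (σ n), ‖f n y‖ ≤ (dist (z n) z₀ + σ n) ^ m)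
    (hτ : Tendsto (fun n => σ n ^ k / (dist (z n) z₀ + σ n) ^ m) atTop (𝓝 0))
    {w : ℕ → ℂ} {w₀ : ℂ} (hw : Tendsto w atTop (𝓝 w₀))
    (hge : ∀ n, (dist (z n) z₀ + σ n) ^ m ≤ ‖f n (z n + σ n * w n)‖)
    {l : ℂ} {μ : ℝ}
    (hl : Tendsto (fun n => (z n - z₀) / (dist (z n) z₀ + σ n : ℝ)) atTop (𝓝 l))
    (hμ : Tendsto (fun n => σ n / (dist (z n) z₀ + σ n)) atTop (𝓝 μ)) : False := by
  set s : ℕ → ℝ := fun n => dist (z n) z₀ + σ n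
  have hs : ∀ n, 0 < s n := fun n => add_pos_of_nonneg_of_pos dist_nonneg (hσ n)
  have hsc : ∀ n, (s n : ℂ) ≠ 0 := fun n => by exact_mod_cast (hs n).ne'
  have hs0 : Tendsto s atTop (𝓝 0) := by
    simpa using (tendsto_iff_dist_tendsto_zero.1 hz).add hσ0
  have hs1 : ∀ᶠ n in atTop, s n ≤ 1 := hs0.eventually_le_const one_pos
  have hofReal : ∀ {v : ℕ → ℝ} {v₀ : ℝ}, Tendsto v atTop (𝓝 v₀) →
      Tendsto (fun n => (v n : ℂ)) atTop (𝓝 v₀) := fun hv =>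
    (Complex.continuous_ofReal.tendsto _).comp hv
  have hσc : Tendsto (fun n => (σ n : ℂ)) atTop (𝓝 0) := by exact_mod_cast hofReal hσ0
  have hσne : ∀ n, (σ n : ℂ) ≠ 0 := fun n => by exact_mod_cast (hσ n).ne'
  set c : ℕ → ℂ := fun n => ((s n : ℂ) ^ m)⁻¹
  have hc : ∀ n, c n ≠ 0 := fun n => inv_ne_zero (pow_ne_zero m (hsc n))
  have hcn : ∀ n, ‖c n‖ = (s n ^ m)⁻¹ := fun n => by
    simp only [c]
    rw [norm_inv, norm_pow, Complex.norm_real, Real.norm_of_nonneg (hs n).le]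
  -- the limiting data: `|l| + μ = 1`, and `m < k` unless `μ = 0`
  have hlμ : μ = 0 → l ≠ 0 := by
    rintro rfl rfl
    have h1 : Tendsto (fun n => ‖(z n - z₀) / (s n : ℝ)‖ + σ n / s n) atTop (𝓝 0) := by
      have := hl.norm.add hμ
      rwa [norm_zero, add_zero] at this
    have h2 : (fun n => ‖(z n - z₀) / (s n : ℝ)‖ + σ n / s n) = fun _ => (1 : ℝ) := by
      funext n
      rw [norm_div, Complex.norm_real, Real.norm_of_nonneg (hs n).le, ← add_div, ← dist_eq_norm]
      exact div_self (hs n).ne'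
    rw [h2] at h1
    exact one_ne_zero (tendsto_nhds_unique tendsto_const_nhds h1)
  have hmk : μ ≠ 0 → m < k := by
    intro hμ0
    by_contra! hkm
    have h1 : Tendsto (fun n => (σ n / s n) ^ k) atTop (𝓝 0) := by
      refine squeeze_zero' (.of_forall fun n => by have := hs n; have := hσ n; positivity) ?_ hτ
      filter_upwards [hs1] with n hn
      rw [div_pow]
      have h2 := pow_le_pow_of_le_one (hs n).le hn hkm
      have := hs n
      have := hσ n
      gcongr
    exact pow_ne_zero k hμ0 (tendsto_nhds_unique (hμ.pow k) h1)
  -- the rescaled functions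
  have haff : ∀ ζ, HolTendstoAt (fun n ζ => z n + σ n * ζ) (fun _ => z₀) ζ := fun ζ =>
    (HolTendstoAt.affine hz hσc ζ).congr_right (.of_forall fun _ => by simp)
  have hz₀ : z₀ ∈ ball z₀ R := mem_ball_self hR
  have hmem : ∀ ζ, ∃ t > 0, ∀ᶠ n in atTop, ∀ y ∈ ball ζ t, z n + σ n * y ∈ ball z₀ R := by
    intro ζ
    obtain ⟨pa, hpa, pb, hpb, hab⟩ := eventually_prod_iff.1
      ((haff ζ).tendsto.eventually (isOpen_ball.mem_nhds hz₀))
    obtain ⟨t, ht, h2⟩ := Metric.eventually_nhds_iff_ball.1 hpb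
    exact ⟨t, ht, hpa.mono fun n hn y hy => hab hn (h2 y hy)⟩
  have hcomp : ∀ {v : ℂ → ℂ}, DifferentiableOn ℂ v (ball z₀ R) → ∀ ζ,
      HolTendstoAt (fun n ζ => v (z n + σ n * ζ)) (fun _ => v z₀) ζ := fun hd ζ =>
    (HolTendstoAt.of_analyticAt (hd.analyticAt (isOpen_ball.mem_nhds hz₀))).comp (haff ζ)
      tendsto_id
  set G : ℕ → ℂ → ℂ := fun n ζ => c n * f n (z n + σ n * ζ)
  have hGd : ∀ ζ, ∃ t > 0, ∀ᶠ n in atTop, DifferentiableOn ℂ (G n) (ball ζ t) := by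
    intro ζ
    obtain ⟨t, ht, h1⟩ := hmem ζ
    refine ⟨t, ht, h1.mono fun n hn => ?_⟩
    exact ((hf n).comp (by fun_prop) hn).const_mul _
  have hGk : ∀ j n ζ, iteratedDeriv j (G n) ζ =
      c n * ((σ n : ℂ) ^ j * iteratedDeriv j (f n) (z n + σ n * ζ)) := fun j n ζ =>
    iteratedDeriv_const_mul_comp_affine j (f n) _ _ _ ζ
  have hG1 : ∀ n, ∀ ζ ∈ closedBall (0 : ℂ) 1, ‖G n ζ‖ ≤ 1 := by
    intro n ζ hζ
    rw [mem_closedBall_zero_iff] at hζ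
    have h1 := hle n (z n + σ n * ζ) (by
      rw [mem_closedBall_iff_norm, add_sub_cancel_left, norm_mul, Complex.norm_real,
        Real.norm_of_nonneg (hσ n).le]
      exact mul_le_of_le_one_right (hσ n).le hζ)
    simp only [G]
    rw [norm_mul, hcn, inv_mul_le_iff₀ (pow_pos (hs n) m), mul_one]
    exact h1
  have hp : ∀ ζ, HolTendstoAt (fun n ζ => c n * a (z n + σ n * ζ))
      (fun ζ => u z₀ * (l + μ * ζ) ^ m) ζ := by
    intro ζ
    have h1 := HolTendstoAt.affine hl (hofReal hμ) ζ
    have h2 : AnalyticAt ℂ (fun x : ℂ => x ^ m) (l + μ * ζ) := by fun_prop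
    have h3 := (hcomp hu ζ).mul
      (HolTendstoAt.comp (A₀ := fun x => l + μ * x) (HolTendstoAt.of_analyticAt h2) h1 tendsto_id)
    obtain ⟨t, ht, hmt⟩ := hmem ζ
    refine h3.congr_left ht (hmt.mono fun n hn y hy => ?_)
    have h4 := hsc n
    simp only [c]
    rw [hau _ (hn y hy), mul_comm (u _), ← mul_assoc, ← inv_pow, ← mul_pow]
    congr 2
    push_cast
    have h5 : ((dist (z n) z₀ : ℝ) : ℂ) + σ n ≠ 0 := by exact_mod_cast h4
    simp only [s]
    push_cast
    field_simp
    ring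
  have hτc : Tendsto (fun n => c n * (σ n : ℂ) ^ k) atTop (𝓝 0) := by
    have := hofReal hτ
    refine (by simpa using this : Tendsto _ _ (𝓝 (0 : ℂ))).congr fun n => ?_
    simp only [c, s]
    push_cast
    rw [div_eq_inv_mul]
  have hQS : ∀ ζ, QuasiSharing k G (fun ζ => u z₀ * (l + μ * ζ) ^ m) ζ := by
    intro ζ
    obtain ⟨t, ht, hmt⟩ := hmem ζ
    have hσk : Tendsto (fun n => (σ n : ℂ) ^ k) atTop (𝓝 0) := by
      simpa [show k ≠ 0 by omega] using hσc.pow k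
    have h1 := (HolTendstoAt.of_const_seq hσk ζ).mul (hcomp hγ ζ)
    have h2 := (HolTendstoAt.of_const_seq hσk ζ).mul ((hcomp hκ ζ).mul (hp ζ))
    have h3 := (HolTendstoAt.of_const_seq hτc ζ).mul ((hcomp hκ ζ).mul (hcomp hb ζ))
    refine ⟨_, _, _, _, hp ζ, h1.congr_right (.of_forall fun _ => by simp),
      h2.congr_right (.of_forall fun _ => by simp), h3.congr_right (.of_forall fun _ => by simp),
      t, ht, ε, hε, ?_⟩
    filter_upwards [hmt, hs1] with n hn hsn x hx
    set y := z n + σ n * x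
    have hy : y ∈ ball z₀ R := hn x hx
    have hσkn := pow_ne_zero k (hσne n)
    have hid : iteratedDeriv k (G n) x + (σ n : ℂ) ^ k * γ y * G n x =
        (c n * (σ n : ℂ) ^ k) * (iteratedDeriv k (f n) y + γ y * f n y) := by
      rw [hGk]; simp only [G, y]; ring
    refine ⟨fun h0 j hj => ?_, ?_, ?_⟩
    · rw [hGk, hfz n y hy ((mul_eq_zero.1 h0).resolve_left (hc n)) j hj, mul_zero, mul_zero]
    · rw [hid, show (σ n : ℂ) ^ k * (κ y * (c n * a y)) = (c n * (σ n : ℂ) ^ k) * (κ y * a y) by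
        ring, mul_right_inj' (mul_ne_zero (hc n) hσkn)]
      exact (mul_right_inj' (hc n)).trans (hfa n y hy)
    · rw [hid, mul_right_inj' (mul_ne_zero (hc n) hσkn)]
      intro h0
      have h4 : G n x - c n * a y = c n * (b y - a y) := by
        simp only [G]
        rw [hfb n y hy h0, mul_sub]
      rw [h4, norm_mul, hcn]
      have h5 : 1 ≤ (s n ^ m)⁻¹ :=
        (one_le_inv₀ (pow_pos (hs n) m)).2 (pow_le_one₀ (hs n).le hsn)
      exact (hab y hy).trans (le_mul_of_one_le_left (norm_nonneg _) h5)
  -- normality off the zero `e` of the target, then on the whole plane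
  -- (for `μ = 0` the target has no zero and `e = 0` is an arbitrary point)
  set e : ℂ := -l / μ
  have hPe : ∀ ζ ≠ e, u z₀ * (l + μ * ζ) ^ m ≠ 0 := by
    intro ζ hζ
    refine mul_ne_zero hu0 (pow_ne_zero m fun h0 => ?_)
    by_cases hμ0 : μ = 0
    · rw [hμ0] at h0
      exact hlμ hμ0 (by simpa using h0)
    · have hμc : (μ : ℂ) ≠ 0 := by exact_mod_cast hμ0
      refine hζ ?_
      simp only [e]
      rw [eq_div_iff hμc]
      linear_combination h0
  have hSB : ∀ ζ ≠ e, SphericallyBoundedAt G ζ := by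
    intro ζ hζ
    obtain ⟨t, ht, h1⟩ := hGd ζ
    exact (hQS ζ).sphericallyBoundedAt hk (hPe ζ hζ) ht h1
  have hninf : ∀ (φ : ℕ → ℕ), ∀ ζ ∈ closedBall (0 : ℂ) 1,
      ¬ TendstoInftyAt (fun n => G (φ n)) ζ := by
    rintro φ ζ hζ ⟨r, hr, h1⟩
    obtain ⟨n, hn⟩ := (h1 2).exists
    linarith [hn ζ (mem_ball_self hr), hG1 (φ n) ζ hζ]
  obtain ⟨ζ₁, hζ₁, hζ₁e⟩ : ∃ ζ ∈ closedBall (0 : ℂ) 1, ζ ≠ e := by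
    by_cases he : (0 : ℂ) = e
    · exact ⟨1, by simp, by rw [← he]; exact one_ne_zero⟩
    · exact ⟨0, by simp, he⟩
  obtain ⟨φ, hφ, hlim⟩ := exists_subseq_of_sphericallyBoundedAt isOpen_compl_singleton
    (isPreconnected_compl_singleton e) fun ζ hζ => hSB ζ hζ
  obtain ⟨g₁, hg₁⟩ := hlim.resolve_right fun h => hninf φ ζ₁ hζ₁ (h ζ₁ hζ₁e)
  have hSB' : ∀ ζ, SphericallyBoundedAt (fun n => G (φ n)) ζ := by
    intro ζ
    by_cases hζ : ζ = e
    · obtain ⟨t, ht, h1⟩ := hGd ζ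
      subst hζ
      exact sphericallyBoundedAt_of_punctured ht (hφ.tendsto_atTop.eventually h1) hg₁
    · exact (hSB ζ hζ).comp_tendsto hφ.tendsto_atTop
  obtain ⟨ψ, hψ, hlim'⟩ := exists_subseq_of_sphericallyBoundedAt isOpen_univ isPreconnected_univ
    fun ζ _ => hSB' ζ
  obtain ⟨g, hg'⟩ := hlim'.resolve_right fun h => hninf _ ζ₁ hζ₁ (h ζ₁ (mem_univ _))
  have hχ : Tendsto (fun n => φ (ψ n)) atTop atTop := hφ.tendsto_atTop.comp hψ.tendsto_atTop
  have hg : ∀ ζ, HolTendstoAt (fun n => G (φ (ψ n))) g ζ := fun ζ => hg' ζ (mem_univ ζ)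
  have hQS' := fun ζ => (hQS ζ).comp_tendsto hχ
  have hgd : Differentiable ℂ g := fun ζ => (hg ζ).differentiableAt
  -- the limit vanishes at `0` but not identically
  have hg0 : g 0 = 0 := by
    refine tendsto_nhds_unique (hg 0).tendsto_pt (tendsto_const_nhds.congr fun n => ?_)
    simp [G, hf0]
  have hgw : 1 ≤ ‖g w₀‖ := by
    refine ge_of_tendsto ((hg w₀).tendsto_seq (hw.comp hχ)).norm (.of_forall fun n => ?_)
    simp only [G, Function.comp_apply]
    rw [norm_mul, hcn, le_inv_mul_iff₀ (pow_pos (hs _) m), mul_one]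
    exact hge _
  have hgk : ∀ ζ, ¬ ∀ᶠ y in 𝓝 ζ, iteratedDeriv k g y = 0 := by
    intro ζ hζ
    have h1 := eq_of_eventually_eq (differentiable_iteratedDeriv hgd k)
      (differentiable_const 0) hζ
    have h2 := eq_zero_of_iteratedDeriv_eq_zero hgd (fun y => congrFun h1 y)
      (fun j hj => (hQS' 0).iteratedDeriv_eq_zero (hg 0) hg0 hj) w₀
    rw [h2, norm_zero] at hgw
    linarith
  have hgk0 : ∀ ζ, iteratedDeriv k g ζ ≠ 0 := fun ζ =>
    (hQS' ζ).iteratedDeriv_ne_zero (hg ζ) (hgk ζ)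
  refine false_of_omits_pow_affine hk hgd (l := l) (μ := μ) (m := m) hu0
    (fun h => hlμ (by exact_mod_cast h)) (fun h => hmk (by exact_mod_cast h))
    (fun ζ h0 j hj => (hQS' ζ).iteratedDeriv_eq_zero (hg ζ) h0 hj) hgk0 fun ζ h0 => ?_
  have h1 := eq_of_eventually_eq hgd (by fun_prop)
    ((hQS' ζ).eventually_eq (hg ζ) (hgk ζ) h0)
  refine hgk0 0 ?_
  rw [h1, iteratedDeriv_const_mul_comp_affine k (fun x => x ^ m), iteratedDeriv_pow]
  by_cases hμ0 : μ = 0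
  · simp [hμ0, show k ≠ 0 by omega]
  · rw [Nat.descFactorial_eq_zero_iff_lt.2 (hmk hμ0)]
    simp

/-- For `k ≥ 2` the sharing of `a` and `b` bounds the `k`-th derivatives at the zeros of the
functions, locally uniformly. -/
theorem exists_norm_iteratedDeriv_le {k : ℕ} (hk : 2 ≤ k) {D : Set ℂ} (hD : IsOpen D)
    {F : Set (ℂ → ℂ)} {a b γ κ : ℂ → ℂ} (ha : DifferentiableOn ℂ a D)
    (hb : DifferentiableOn ℂ b D) (hγ : DifferentiableOn ℂ γ D) (hκ : DifferentiableOn ℂ κ D)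
    (hab : ∀ z ∈ D, a z ≠ b z) (hF : ∀ f ∈ F, DifferentiableOn ℂ f D)
    (hFz : ∀ f ∈ F, ∀ z ∈ D, f z = 0 → ∀ j < k, iteratedDeriv j f z = 0)
    (hFa : ∀ f ∈ F, ∀ z ∈ D, f z = a z ↔ iteratedDeriv k f z + γ z * f z = κ z * a z)
    (hFb : ∀ f ∈ F, ∀ z ∈ D, iteratedDeriv k f z + γ z * f z = κ z * b z → f z = b z)
    {z₀ : ℂ} (hz₀ : z₀ ∈ D) :
    ∃ r > 0, ∃ A : ℝ, ∀ f ∈ F, ∀ z ∈ ball z₀ r, f z = 0 → ‖iteratedDeriv k f z‖ ≤ A := by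
  by_contra! hcon
  choose f hfF z hz hf0 hfA using fun j : ℕ => hcon (1 / ((j : ℝ) + 1)) (by positivity) j
  have hzt : Tendsto z atTop (𝓝 z₀) := tendsto_iff_dist_tendsto_zero.2
    (squeeze_zero (fun _ => dist_nonneg) (fun j => (mem_ball.1 (hz j)).le)
      tendsto_one_div_add_atTop_nhds_zero_nat)
  have hzD : ∀ᶠ n in atTop, z n ∈ D := hzt.eventually (hD.mem_nhds hz₀)
  -- at a common zero of `f` and `a` the `k`-th derivative of `f` vanishes
  have hane : ∀ n, z n ∈ D → a (z n) ≠ 0 := by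
    intro n hn h0
    have h1 := (hFa (f n) (hfF n) (z n) hn).1 (by rw [hf0, h0])
    rw [hf0, h0, mul_zero, mul_zero, add_zero] at h1
    have h2 := hfA n
    rw [h1, norm_zero] at h2
    exact absurd h2 (not_lt.2 n.cast_nonneg)
  have haan := ha.analyticAt (hD.mem_nhds hz₀)
  have hanot : ¬ ∀ᶠ y in 𝓝 z₀, a y = 0 := by
    intro hev
    obtain ⟨n, h1, h2⟩ := ((hzt.eventually hev).and hzD).exists
    exact hane n h2 h1
  obtain ⟨m, u, hu, hu0, hau⟩ := haan.exists_eventuallyEq_pow_smul_nonzero_iff.2 hanot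
  have hcd : ∀ᶠ y in 𝓝 z₀, ‖b z₀ - a z₀‖ / 2 < ‖b y - a y‖ := by
    have h1 : ContinuousAt (fun y => ‖b y - a y‖) z₀ :=
      ((hb.analyticAt (hD.mem_nhds hz₀)).continuousAt.sub haan.continuousAt).norm
    exact h1.eventually (lt_mem_nhds (half_lt_self
      (norm_pos_iff.2 (sub_ne_zero.2 (hab z₀ hz₀).symm))))
  obtain ⟨R, hR, hRb⟩ := Metric.eventually_nhds_iff_ball.1
    (((Complex.analyticAt_iff_eventually_differentiableAt.1 hu).and hau).and
      (hcd.and (hD.mem_nhds hz₀)))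
  have hRD : ball z₀ R ⊆ D := fun y hy => (hRb y hy).2.2
  -- the rescaling radii; they exist as soon as `k! < |f n⁽ᵏ⁾ (z n)| * δ ^ k`
  obtain ⟨δ, hδ, hδR, hδ1⟩ : ∃ δ > 0, 3 * δ ≤ R ∧ 2 * δ ≤ 1 := by
    refine ⟨min R 1 / 3, by positivity, ?_, ?_⟩
    · have := min_le_left R 1; linarith
    · have := min_le_right R 1; linarith
  have hev : ∀ᶠ n in atTop, dist (z n) z₀ < δ ∧ k.factorial < (n : ℝ) * δ ^ k := by
    refine (hzt.eventually (ball_mem_nhds z₀ hδ)).and ?_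
    exact (tendsto_natCast_atTop_atTop.atTop_mul_const (pow_pos hδ k)).eventually_gt_atTop _
  obtain ⟨n₀, hn₀⟩ := eventually_atTop.1 hev
  have hrad : ∀ n, ∃ σ > 0, σ ≤ δ ∧
      (∀ y ∈ closedBall (z (n + n₀)) σ, ‖f (n + n₀) y‖ ≤ (dist (z (n + n₀)) z₀ + σ) ^ m) ∧
      (∃ y ∈ closedBall (z (n + n₀)) σ, (dist (z (n + n₀)) z₀ + σ) ^ m ≤ ‖f (n + n₀) y‖) ∧
      ‖iteratedDeriv k (f (n + n₀)) (z (n + n₀))‖ * σ ^ k ≤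
        k.factorial * (dist (z (n + n₀)) z₀ + σ) ^ m := by
    intro n
    obtain ⟨h1, h2⟩ := hn₀ (n + n₀) (Nat.le_add_left _ _)
    have h3 : z (n + n₀) ∈ ball z₀ R := mem_ball.2 (by linarith)
    refine exists_radius hδ ((hF _ (hfF _)).mono (subset_trans ?_ hRD)) (hf0 _) ?_ (by linarith) ?_
    · exact ball_subset_ball' (by linarith)
    · rcases eq_or_ne m 0 with rfl | hm
      · simp
      · refine pow_pos (dist_pos.2 fun h0 => ?_) m
        refine hane _ (hRD h3) ?_
        rw [(hRb _ h3).1.2, h0]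
        simp [hm]
    · refine h2.trans_le ?_
      gcongr
      exact (hfA _).le
  choose σ hσ hσδ hle hex hcau using hrad
  choose y hy hge using hex
  set s : ℕ → ℝ := fun n => dist (z (n + n₀)) z₀ + σ n
  have hs : ∀ n, 0 < s n := fun n => add_pos_of_nonneg_of_pos dist_nonneg (hσ n)
  have hs1 : ∀ n, s n ≤ 1 := fun n => by
    have := (hn₀ (n + n₀) (Nat.le_add_left _ _)).1
    have := hσδ n
    simp only [s]
    linarith
  have hshift : Tendsto (fun n => n + n₀) atTop atTop := tendsto_add_atTop_nat n₀
  have hτ : Tendsto (fun n => σ n ^ k / s n ^ m) atTop (𝓝 0) := by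
    refine squeeze_zero' (.of_forall fun n => by have := hs n; have := hσ n; positivity) ?_
      (tendsto_const_div_atTop_nhds_zero_nat (k.factorial : ℝ))
    filter_upwards [eventually_gt_atTop 0] with n hn
    have hn' : (0 : ℝ) < n := by exact_mod_cast hn
    rw [div_le_div_iff₀ (pow_pos (hs n) m) hn', mul_comm]
    refine le_trans ?_ (hcau n)
    have h1 := hσ n
    have h2 := (hfA (n + n₀)).le
    push_cast at h2
    gcongr
    linarith [n₀.cast_nonneg (α := ℝ)]
  have hσ0 : Tendsto σ atTop (𝓝 0) := by
    refine tendsto_order.2 ⟨fun x hx => .of_forall fun n => hx.trans (hσ n), fun x hx => ?_⟩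
    filter_upwards [hτ.eventually (gt_mem_nhds (pow_pos hx k))] with n hn
    refine lt_of_pow_lt_pow_left₀ k hx.le (lt_of_le_of_lt ?_ hn)
    have := hσ n
    exact le_div_self (by positivity) (pow_pos (hs n) m) (pow_le_one₀ (hs n).le (hs1 n))
  -- extraction of convergent parameters
  set w : ℕ → ℂ := fun n => (y n - z (n + n₀)) / σ n
  obtain ⟨⟨l, μ, w₀⟩, -, φ, hφ, hlim⟩ :=
    ((isCompact_closedBall (0 : ℂ) 1).prod
      ((isCompact_Icc (a := (0 : ℝ)) (b := 1)).prod (isCompact_closedBall (0 : ℂ) 1))).tendsto_subseq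
      (x := fun n => ((z (n + n₀) - z₀) / (s n : ℝ), σ n / s n, w n)) fun n => by
        refine ⟨?_, ⟨?_, ?_⟩, ?_⟩
        · rw [mem_closedBall_zero_iff, norm_div, Complex.norm_real,
            Real.norm_of_nonneg (hs n).le, ← dist_eq_norm]
          exact div_le_one_of_le₀ (le_add_of_nonneg_right (hσ n).le) (hs n).le
        · exact div_nonneg (hσ n).le (hs n).le
        · exact div_le_one_of_le₀ (le_add_of_nonneg_left dist_nonneg) (hs n).le
        · rw [mem_closedBall_zero_iff, norm_div, Complex.norm_real,
            Real.norm_of_nonneg (hσ n).le, ← dist_eq_norm]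
          exact div_le_one_of_le₀ (hy n) (hσ n).le
  have hφt := hφ.tendsto_atTop
  refine false_of_rescaled_sharing (m := m) hk hR (ε := ‖b z₀ - a z₀‖ / 2)
    (half_pos (norm_pos_iff.2 (sub_ne_zero.2 (hab z₀ hz₀).symm))) (a := a) (u := u)
    (fun x hx => (hRb x hx).1.1.differentiableWithinAt) (hb.mono hRD) (hγ.mono hRD)
    (hκ.mono hRD) hu0 (fun x hx => (hRb x hx).1.2) (fun x hx => (hRb x hx).2.1.le)
    (f := fun n => f (φ n + n₀)) (fun n => (hF _ (hfF _)).mono hRD)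
    (fun n x hx => hFz _ (hfF _) x (hRD hx)) (fun n x hx => hFa _ (hfF _) x (hRD hx))
    (fun n x hx => hFb _ (hfF _) x (hRD hx)) (z := fun n => z (φ n + n₀))
    (hzt.comp (hshift.comp hφt)) (fun n => hf0 _) (σ := fun n => σ (φ n)) (fun n => hσ _)
    (hσ0.comp hφt) (fun n => hle _) (hτ.comp hφt) (w := fun n => w (φ n)) (w₀ := w₀)
    hlim.snd_nhds.snd_nhds (fun n => ?_) (l := l) (μ := μ) hlim.fst_nhds hlim.snd_nhds.fst_nhds
  have h1 : (σ (φ n) : ℂ) ≠ 0 := by exact_mod_cast (hσ _).ne'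
  simp only [w]
  rw [mul_div_cancel₀ _ h1, add_sub_cancel]
  exact hge _

/-! ### Normality of the family -/

theorem isNormalFamilyOn_of_sphericallyBoundedAt {F : Set (ℂ → ℂ)} {D : Set ℂ} (hDo : IsOpen D)
    (hDc : IsPreconnected D)
    (h : ∀ u : ℕ → ℂ → ℂ, (∀ n, u n ∈ F) → ∀ z ∈ D, SphericallyBoundedAt u z) :
    IsNormalFamilyOn F D := by
  intro u hu
  obtain ⟨φ, hφ, hlim⟩ := exists_subseq_of_sphericallyBoundedAt hDo hDc (h u hu)
  refine ⟨φ, hφ, hlim.imp ?_ ?_⟩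
  · rintro ⟨g, hg⟩
    exact ⟨g, (tendstoLocallyUniformlyOn_iff_forall_isCompact hDo).1
      (HolTendstoAt.tendstoLocallyUniformlyOn hg)⟩
  · exact fun hinf K hKD hK M =>
      TendstoInftyAt.eventually_of_isCompact hK (fun z hz => hinf z (hKD hz)) M

theorem SphericallyBoundedAt.add_analyticAt {F : ℕ → ℂ → ℂ} {a : ℂ → ℂ} {z : ℂ}
    (h : SphericallyBoundedAt F z) (ha : AnalyticAt ℂ a z) :
    SphericallyBoundedAt (fun n x => F n x + a x) z := by
  obtain ⟨r, hr, M, h1⟩ := h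
  obtain ⟨δ, hδ, h2⟩ := Metric.eventually_nhds_iff_ball.1
    ((Complex.analyticAt_iff_eventually_differentiableAt.1 ha).and
      ((ha.continuousAt.norm.eventually (gt_mem_nhds (lt_add_one ‖a z‖))).and
        (ha.deriv.continuousAt.norm.eventually (gt_mem_nhds (lt_add_one ‖deriv a z‖)))))
  set A := ‖a z‖ + 1
  set B := ‖deriv a z‖ + 1
  have hB : 0 < B := by positivity
  refine ⟨min r δ, lt_min hr hδ, |M| * (2 + 2 * A ^ 2) + B, ?_⟩
  filter_upwards [h1] with n hn
  refine ⟨fun w hw => ?_, fun w hw => ?_⟩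
  · refine ((hn.1.differentiableAt (isOpen_ball.mem_nhds
      (ball_subset_ball (min_le_left _ _) hw))).add
        (h2 w (ball_subset_ball (min_le_right _ _) hw)).1).differentiableWithinAt
  · have hw1 := ball_subset_ball (min_le_left r δ) hw
    obtain ⟨h3, h4, h5⟩ := h2 w (ball_subset_ball (min_le_right _ _) hw)
    rw [deriv_fun_add (hn.1.differentiableAt (isOpen_ball.mem_nhds hw1)) h3]
    have h6 : ‖F n w‖ ≤ ‖F n w + a w‖ + A := by
      have := norm_sub_le (F n w + a w) (a w)
      rw [add_sub_cancel_right] at this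
      linarith
    have h7 : ‖F n w‖ ^ 2 ≤ 2 * ‖F n w + a w‖ ^ 2 + 2 * A ^ 2 := by
      have := pow_le_pow_left₀ (norm_nonneg _) h6 2
      nlinarith [sq_nonneg (‖F n w + a w‖ - A)]
    have h8 : ‖deriv (F n) w‖ ≤ |M| * (1 + ‖F n w‖ ^ 2) :=
      (hn.2 w hw1).trans (by gcongr; exact le_abs_self M)
    have h9 : |M| * (1 + ‖F n w‖ ^ 2) ≤ |M| * (2 + 2 * A ^ 2) * (1 + ‖F n w + a w‖ ^ 2) := by
      rw [mul_assoc]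
      gcongr
      nlinarith [sq_nonneg ‖F n w + a w‖, sq_nonneg A, mul_nonneg (sq_nonneg A) (sq_nonneg ‖F n w + a w‖)]
    calc _ ≤ ‖deriv (F n) w‖ + ‖deriv a w‖ := norm_add_le _ _
      _ ≤ |M| * (2 + 2 * A ^ 2) * (1 + ‖F n w + a w‖ ^ 2) + B := by linarith
      _ ≤ _ := by nlinarith [sq_nonneg ‖F n w + a w‖, mul_nonneg hB.le (sq_nonneg ‖F n w + a w‖)]

/-- For `k = 1` the functions `f - a` satisfy the normality criterion directly: at a zero of
`f - a` the sharing hypothesis determines `f'`, hence bounds the derivative. -/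
theorem sphericallyBoundedAt_of_deriv_sharing {D : Set ℂ} (hD : IsOpen D) {a b γ κ : ℂ → ℂ}
    (ha : DifferentiableOn ℂ a D) (hb : DifferentiableOn ℂ b D) (hγ : DifferentiableOn ℂ γ D)
    (hκ : DifferentiableOn ℂ κ D) (hab : ∀ z ∈ D, a z ≠ b z)
    (hbab : ∀ z ∈ D, κ z * b z - γ z * a z - deriv a z ≠ 0) {u : ℕ → ℂ → ℂ}
    (hu : ∀ n, DifferentiableOn ℂ (u n) D)
    (hua : ∀ n, ∀ z ∈ D, u n z = a z → deriv (u n) z + γ z * u n z = κ z * a z)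
    (hub : ∀ n, ∀ z ∈ D, deriv (u n) z + γ z * u n z = κ z * b z → u n z = b z)
    {z₀ : ℂ} (hz₀ : z₀ ∈ D) : SphericallyBoundedAt u z₀ := by
  have haD := ha.deriv hD
  set v : ℂ → ℂ := fun z => κ z * a z - γ z * a z - deriv a z
  have hv : DifferentiableOn ℂ v D := ((hκ.mul ha).sub (hγ.mul ha)).sub haD
  obtain ⟨R, hR, hRb⟩ := Metric.eventually_nhds_iff_ball.1
    (((hv.continuousOn.continuousAt (hD.mem_nhds hz₀)).norm.eventually
      (gt_mem_nhds (lt_add_one ‖v z₀‖))).and (hD.mem_nhds hz₀))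
  have hRD : ball z₀ R ⊆ D := fun z hz => (hRb z hz).2
  have hder : ∀ n, ∀ z ∈ D, deriv (fun z => u n z - a z) z = deriv (u n) z - deriv a z :=
    fun n z hz => deriv_fun_sub ((hu n).differentiableAt (hD.mem_nhds hz))
      (ha.differentiableAt (hD.mem_nhds hz))
  have hh : SphericallyBoundedAt (fun n z => u n z - a z) z₀ := by
    refine sphericallyBoundedAt_of_iteratedDeriv_add_mul (k := 1) (A := ‖v z₀‖ + 1) hR le_rfl
      (by positivity) (hγ.mono hRD) ((((hκ.mul hb).sub (hγ.mul ha)).sub haD).mono hRD)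
      ((hb.sub ha).mono hRD) (fun z hz => hbab z (hRD hz))
      (fun z hz => sub_ne_zero.2 (hab z (hRD hz)).symm) (fun n => ((hu n).sub ha).mono hRD)
      (fun n z hz h0 => ⟨fun j hj => ?_, ?_⟩) fun n z hz h0 => ?_
    · rw [Nat.lt_one_iff.1 hj, iteratedDeriv_zero]
      exact h0
    · have h1 := hua n z (hRD hz) (sub_eq_zero.1 h0)
      rw [iteratedDeriv_one, hder n z (hRD hz)]
      rw [sub_eq_zero.1 h0] at h1
      rw [show deriv (u n) z - deriv a z = v z by simp only [v]; linear_combination h1]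
      exact (hRb z hz).1.le
    · rw [iteratedDeriv_one, hder n z (hRD hz)] at h0
      simp only [Pi.sub_apply, Pi.mul_apply] at h0 ⊢
      rw [hub n z (hRD hz) (by linear_combination h0)]
  simpa using hh.add_analyticAt (ha.analyticAt (hD.mem_nhds hz₀))

end NormalFamilies

open NormalFamilies

theorem theorem2p2 (D : Set ℂ) (hDo : IsOpen D) (hDc : IsConnected D)
    (k : ℕ) (hk : 1 ≤ k)
    (F : Set (ℂ → ℂ)) (hF : ∀ f ∈ F, DifferentiableOn ℂ f D)
    (hmult : ∀ f ∈ F, ∀ z ∈ D, f z = 0 → (k : ℕ∞) ≤ analyticOrderAt f z)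
    (a b α₀ α₁ : ℂ → ℂ)
    (ha : DifferentiableOn ℂ a D) (hb : DifferentiableOn ℂ b D)
    (hα₀ : DifferentiableOn ℂ α₀ D) (hα₁ : DifferentiableOn ℂ α₁ D)
    (hα₀_ne : ∀ z ∈ D, α₀ z ≠ 0)
    (hb_ne : ∀ z ∈ D, b z ≠ 0)
    (hab : ∀ z ∈ D, a z ≠ b z)
    (hbab : ∀ z ∈ D, b z - α₁ z * a z - α₀ z * iteratedDeriv k a z ≠ 0)
    (hshare_a : ∀ f ∈ F, ∀ z ∈ D,
      (f z = a z ↔ α₀ z * iteratedDeriv k f z + α₁ z * f z = a z))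
    (hshare_b : ∀ f ∈ F, ∀ z ∈ D,
      α₀ z * iteratedDeriv k f z + α₁ z * f z = b z → f z = b z) :
    IsNormalFamilyOn F D := by
  refine isNormalFamilyOn_of_sphericallyBoundedAt hDo hDc.isPreconnected fun u hu z₀ hz₀ => ?_
  have hγ : DifferentiableOn ℂ (fun z => α₁ z / α₀ z) D := hα₁.div hα₀ hα₀_ne
  have hκ : DifferentiableOn ℂ (fun z => (α₀ z)⁻¹) D := hα₀.inv hα₀_ne
  have hdiv : ∀ z ∈ D, ∀ x y c : ℂ,
      x + α₁ z / α₀ z * y = (α₀ z)⁻¹ * c ↔ α₀ z * x + α₁ z * y = c := by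
    intro z hz x y c
    have h0 := hα₀_ne z hz
    rw [eq_inv_mul_iff_mul_eq₀ h0, mul_add, ← mul_assoc, mul_div_cancel₀ _ h0]
  have hFz : ∀ f ∈ F, ∀ z ∈ D, f z = 0 → ∀ j < k, iteratedDeriv j f z = 0 := fun f hf z hz h0 =>
    (natCast_le_analyticOrderAt_iff_iteratedDeriv_eq_zero
      ((hF f hf).analyticAt (hDo.mem_nhds hz))).1 (hmult f hf z hz h0)
  have hFa : ∀ f ∈ F, ∀ z ∈ D,
      f z = a z ↔ iteratedDeriv k f z + α₁ z / α₀ z * f z = (α₀ z)⁻¹ * a z :=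
    fun f hf z hz => (hshare_a f hf z hz).trans (hdiv z hz _ _ _).symm
  have hFb : ∀ f ∈ F, ∀ z ∈ D,
      iteratedDeriv k f z + α₁ z / α₀ z * f z = (α₀ z)⁻¹ * b z → f z = b z :=
    fun f hf z hz h => hshare_b f hf z hz ((hdiv z hz _ _ _).1 h)
  rcases hk.eq_or_lt with rfl | hk2
  · simp only [iteratedDeriv_one] at hFa hFb hbab
    refine sphericallyBoundedAt_of_deriv_sharing hDo ha hb hγ hκ hab (fun z hz h0 => ?_)
      (fun n => hF _ (hu n)) (fun n z hz => (hFa _ (hu n) z hz).1) (fun n => hFb _ (hu n)) hz₀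
    refine hbab z hz ?_
    have h1 := hα₀_ne z hz
    field_simp at h0
    linear_combination h0
  · obtain ⟨r, hr, A, hA⟩ := exists_norm_iteratedDeriv_le hk2 hDo ha hb hγ hκ hab hF hFz hFa hFb hz₀
    obtain ⟨R, hR, hRD⟩ := Metric.mem_nhds_iff.1
      (Filter.inter_mem (hDo.mem_nhds hz₀) (Metric.ball_mem_nhds z₀ hr))
    have hD : Metric.ball z₀ R ⊆ D := fun z hz => (hRD hz).1
    exact sphericallyBoundedAt_of_iteratedDeriv_add_mul hR hk (le_max_right A 0) (hγ.mono hD)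
      ((hκ.mul hb).mono hD) (hb.mono hD)
      (fun z hz => mul_ne_zero (inv_ne_zero (hα₀_ne z (hD hz))) (hb_ne z (hD hz)))
      (fun z hz => hb_ne z (hD hz)) (fun n => (hF _ (hu n)).mono hD)
      (fun n z hz h0 => ⟨hFz _ (hu n) z (hD hz) h0,
        (hA _ (hu n) z (hRD hz).2 h0).trans (le_max_left A 0)⟩)
      fun n z hz h => hFb _ (hu n) z (hD hz) h
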